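/- Let $F=\mathbb F_q$ be a finite field, $n\ge 0$, $V=F^n$ the standard module of $GL_n(q)$, and identify $S^\bullet(V)=F[x_1,\dots,x_n]$, $\wedge^\bullet(V)=E[y_1,\dots,y_n]$, where $g\cdot x_j=\sum_k g_{kj}x_k$ and $g\cdot y_j=\sum_k g_{kj}y_k$. For $k\ge 0$ identify $S^\bullet(V)\otimes\wedge^\bullet(V)\otimes\mathrm{Det}^k$ with $S^\bullet(V)\otimes\wedge^\bullet(V)$ under the twisted action $g\cdot_k f=\det(g)^k\,(g\cdot f)$. Let $I=(n_1,\dots,n_\ell)$ be a composition of $n$ with positive parts, put $m_0=0$ and $m_i=n_1+\dots+n_i$, and let $P_I\le GL_n(q)$ be the subgroup of block upper triangular matrices with diagonal blocks of sizes $n_1,\dots,n_\ell$. Define $$L_m(z_1,\dots,z_m)=\prod_{s=1}^m\ \prod_{c_1,\dots,c_{s-1}\in F}(c_1z_1+\dots+c_{s-1}z_{s-1}+z_s),$$ $$v_{i,j}=\prod_{c_1,\dots,c_{m_{i-1}}\in F}(c_1x_1+\dots+c_{m_{i-1}}x_{m_{i-1}}+x_{m_{i-1}+j})\quad(1\le i\le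 \ell,\ 1\le j\le n_i),$$ $$\theta_i=L_{n_i}(v_{i,1},\dots,v_{i,n_i}).$$ For $1\le j\le m\le n$ and $0\le b_1<\dots<b_j\le m-1$ let $M_{m;b_1,\dots,b_j}\in S^\bullet(V)\otimes\wedge^\bullet(V)$ be $\frac1{j!}$ times the row determinant $\sum_{\sigma\in S_m}\mathrm{sgn}(\sigma)\,a_{1\sigma(1)}\cdots a_{m\sigma(m)}$ of the $m\times m$ matrix $(a_{rc})$ whose first $j$ rows are all $(y_1,\dots,y_m)$ and whose remaining rows are $(x_1^{q^e},\dots,x_m^{q^e})$ for $e\in\{0,\dots,m-1\}\setminus\{b_1,\dots,b_j\}$ in increasing order. Here the division by $j!$ is a formal one, possible in every characteristic: the determinant is a sum of groups of $j!$ equal terms (those $\sigma$ that differ by a permutation of the first $j$ rows), and $M_{m;b_1,\dots,b_j}$ is the sum with one term from each group, that is, the sum over the $\sigma\in S_m$ with $\sigma(1)<\dots<\sigma(j)$. **Theorem.** (1) $(S^\bullet(V)\otimes\wedge^\bullet(V))^{P_I}$ is a free $S^\bullet(V)^{P_I}$-module of rank $2^n$, with a basis consisting of $1$ and of the elements $$M_{m_i;b_1,\dots,b_j}\,\theta_1^{q-2}\cdots\theta_i^{q-2}$$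 for $1\le i\le\ell$, $1\le j\le m_i$ and $0\le b_1<\dots<b_j\le m_i-1$ with $b_j\ge m_{i-1}$. (2) For $1\le k\le q-2$, $(S^\bullet(V)\otimes\wedge^\bullet(V)\otimes\mathrm{Det}^k)^{P_I}$ is a free $S^\bullet(V)^{P_I}$-module of rank $2^n$, with a basis consisting of $(\theta_1\cdots\theta_\ell)^{q-1-k}$ and of the elements $$M_{m_i;b_1,\dots,b_j}\,\theta_1^{q-2-k}\cdots\theta_i^{q-2-k}\,\theta_{i+1}^{q-1-k}\cdots\theta_\ell^{q-1-k}$$ for $1\le i\le\ell$, $1\le j\le m_i$ and $0\le b_1<\dots<b_j\le m_i-1$ with $b_j\ge m_{i-1}$. -/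

import Mathlib

open scoped TensorProduct

/-! ### Row determinants and the Mui elements -/

/-- The row determinant `∑_σ sgn(σ) a_{1σ(1)} a_{2σ(2)} ⋯ a_{mσ(m)}` of a square matrix over a
possibly noncommutative ring (the factors are multiplied in the order of the rows). -/
def rowDet {A : Type*} [Ring A] {m : ℕ} (a : Matrix (Fin m) (Fin m) A) : A :=
  ∑ σ : Equiv.Perm (Fin m), Equiv.Perm.sign σ • (List.ofFn fun r => a r (σ r)).prod

/-- The matrix whose first `j = #B` rows are all equal to `(y_1, …, y_m)` and whose remaining rows
are `(x_1^{q^e}, …, x_m^{q^e})`, where `e` runs in increasing order through the natural numbers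
not in `B` (so through `{0, …, m-1} ∖ B` if `B ⊆ {0, …, m-1}`). -/
noncomputable def muiMatrix {A : Type*} [Ring A] (q : ℕ) {m : ℕ} (x y : Fin m → A)
    (B : Finset ℕ) : Matrix (Fin m) (Fin m) A :=
  Matrix.of fun r c =>
    if (r : ℕ) < B.card then y c else x c ^ q ^ Nat.nth (fun e => e ∉ B) (r - B.card)

/-- The permutations which are increasing on the first `j` positions. They represent the cosets
of the permutations of the first `j` positions. -/
def IncreasingUpTo {m : ℕ} (j : ℕ) (σ : Equiv.Perm (Fin m)) : Prop :=
  ∀ r s : Fin m, r < s → (s : ℕ) < j → σ r < σ s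

open Classical in
/-- The Mui element `M_{m; b_1, …, b_j} = (1/j!) · |muiMatrix|`, where `B = {b_1 < ⋯ < b_j}`.
As the first `j` rows are equal and the `y_c` anticommute, the `j!` terms of the row determinant
that differ by a permutation of the first `j` positions are equal; dividing by `j!` means to take
each of them once. This makes sense in every characteristic; see `factorial_smul_muiM`. -/
noncomputable def muiM {A : Type*} [Ring A] (q : ℕ) {m : ℕ} (x y : Fin m → A)
    (B : Finset ℕ) : A :=
  ∑ σ : Equiv.Perm (Fin m) with IncreasingUpTo B.card σ,
    Equiv.Perm.sign σ • (List.ofFn fun r => muiMatrix q x y B r (σ r)).prod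

/-- `j! · M_{m; b_1, …, b_j}` is the row determinant of the matrix with `j` repeated rows, over an
arbitrary ground ring. (Over `ℤ` this equation determines the Mui element.) -/
theorem factorial_smul_muiM {R V A : Type*} [CommRing R] [AddCommGroup V] [Module R V] [Ring A]
    [Algebra R A] (f : ExteriorAlgebra R V →ₐ[R] A) (q : ℕ) {m : ℕ} (x : Fin m → A)
    (v : Fin m → V) (B : Finset ℕ) (hB : B.card ≤ m) :
    B.card.factorial • muiM q x (fun c => f (ExteriorAlgebra.ι R (v c))) B =
      rowDet (muiMatrix q x (fun c => f (ExteriorAlgebra.ι R (v c))) B) := by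
  classical
  set a := muiMatrix q x (fun c => f (ExteriorAlgebra.ι R (v c))) B with ha
  set j := B.card with hj
  let emb : Fin j ↪ Fin m := (Fin.castLEEmb hB)
  let ext : Equiv.Perm (Fin j) → Equiv.Perm (Fin m) := fun τ => τ.viaFintypeEmbedding emb
  have ext_lt : ∀ τ (r : Fin j), ext τ (Fin.castLE hB r) = Fin.castLE hB (τ r) := fun τ r =>
    Equiv.Perm.viaFintypeEmbedding_apply_image τ emb r
  have ext_ge : ∀ τ (r : Fin m), ¬ (r : ℕ) < j → ext τ r = r := fun τ r hr => by
    apply Equiv.Perm.viaFintypeEmbedding_apply_notMem_range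
    rintro ⟨s, rfl⟩
    exact hr s.2
  let T : Equiv.Perm (Fin m) → A := fun σ =>
    Equiv.Perm.sign σ • (List.ofFn fun r => a r (σ r)).prod
  have hT : ∀ σ τ, T (σ * ext τ) = T σ := by
    intro σ τ
    have hprod : ∀ π : Equiv.Perm (Fin m), (List.ofFn fun r => a r (π r)).prod =
        f (ExteriorAlgebra.ιMulti R j fun r => v (π (Fin.castLE hB r))) *
          (List.ofFn fun s : Fin (m - j) =>
            x (π ⟨j + s, by omega⟩) ^ q ^ Nat.nth (fun e => e ∉ B) s).prod := by
      intro π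
      rw [List.ofFn_congr (show m = j + (m - j) by omega), List.ofFn_add, List.prod_append,
        ExteriorAlgebra.ιMulti_apply, map_list_prod, List.map_ofFn]
      congr 3
      · funext r
        have : (r : ℕ) < B.card := r.2
        simp only [ha, muiMatrix, Matrix.of_apply, Function.comp]
        exact if_pos this
      · funext s
        simp only [ha, muiMatrix, Matrix.of_apply]
        rw [if_neg (by simp [hj])]
        simp [← hj]
        rfl
    have h1 : (fun r => v ((σ * ext τ) (Fin.castLE hB r))) =
        (fun r => v (σ (Fin.castLE hB r))) ∘ τ := by
      funext r
      simp [ext_lt]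
    have h2 : ∀ s : Fin (m - j), (σ * ext τ) ⟨j + s, by omega⟩ = σ ⟨j + s, by omega⟩ := by
      intro s
      rw [Equiv.Perm.mul_apply, ext_ge _ _ (by simp)]
    have h3 : Equiv.Perm.sign (ext τ) = Equiv.Perm.sign τ :=
      Equiv.Perm.viaFintypeEmbedding_sign _ _
    simp only [T]
    rw [hprod, hprod, h1, AlternatingMap.map_perm]
    simp only [h2]
    rw [map_mul, h3, Units.smul_def (Equiv.Perm.sign τ), map_zsmul, smul_mul_assoc,
      ← Units.smul_def, smul_smul, mul_assoc, Int.units_mul_self, mul_one]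
  have hsum : ∑ p ∈ (Finset.univ.filter fun σ : Equiv.Perm (Fin m) => IncreasingUpTo j σ) ×ˢ
      (Finset.univ : Finset (Equiv.Perm (Fin j))), T p.1 = ∑ σ, T σ := by
    refine Finset.sum_bij (fun p _ => p.1 * ext p.2) (fun _ _ => Finset.mem_univ _) ?_ ?_
      (fun p _ => (hT p.1 p.2).symm)
    · rintro ⟨σ, τ⟩ h ⟨σ', τ'⟩ h' he
      simp only [Finset.mem_product, Finset.mem_filter, Finset.mem_univ, true_and,
        and_true] at h h' he
      have mono : ∀ π : Equiv.Perm (Fin m), IncreasingUpTo j π →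
          StrictMono fun r : Fin j => π (Fin.castLE hB r) := fun π hπ r s hrs =>
        hπ _ _ hrs s.2
      have hval : ∀ r : Fin j, σ (Fin.castLE hB (τ r)) = σ' (Fin.castLE hB (τ' r)) := by
        intro r
        have := Equiv.congr_fun he (Fin.castLE hB r)
        simpa [ext_lt] using this
      have hrange : (fun r : Fin j => σ (Fin.castLE hB r)) =
          fun r : Fin j => σ' (Fin.castLE hB r) := by
        rw [← (mono σ h).range_inj (mono σ' h')]
        ext z
        constructor
        · rintro ⟨r, rfl⟩
          exact ⟨τ' (τ.symm r), by simpa using (hval (τ.symm r)).symm⟩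
        · rintro ⟨r, rfl⟩
          exact ⟨τ (τ'.symm r), by simpa using hval (τ'.symm r)⟩
      have hσ : σ = σ' := by
        ext r
        by_cases hr : (r : ℕ) < j
        · exact congrArg Fin.val (congrFun hrange ⟨r, hr⟩)
        · have := Equiv.congr_fun he r
          simp only [Equiv.Perm.mul_apply, ext_ge _ _ hr] at this
          rw [this]
      subst hσ
      have hτ : τ = τ' := by
        ext r
        have := σ.injective (hval r)
        exact congrArg Fin.val (Fin.castLE_injective hB this)
      rw [hτ]
    · intro π _
      let g : Fin j → Fin m := fun r => π (Fin.castLE hB r)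
      have hg : Function.Injective g := fun r s h => Fin.castLE_injective hB (π.injective h)
      let τ := Tuple.sort g
      refine ⟨(π * ext τ, τ⁻¹), ?_, ?_⟩
      · simp only [Finset.mem_product, Finset.mem_filter, Finset.mem_univ, true_and, and_true]
        intro r s hrs hs
        have hsm : StrictMono (g ∘ τ) :=
          (Tuple.monotone_sort g).strictMono_of_injective (hg.comp τ.injective)
        have := hsm (show (⟨r, lt_trans hrs hs⟩ : Fin j) < ⟨s, hs⟩ from hrs)
        have e1 := ext_lt τ ⟨r, lt_trans hrs hs⟩
        have e2 := ext_lt τ ⟨s, hs⟩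
        change ext τ r = _ at e1
        change ext τ s = _ at e2
        rw [Equiv.Perm.mul_apply, Equiv.Perm.mul_apply, e1, e2]
        exact this
      · ext r
        by_cases hr : (r : ℕ) < j
        · have e1 := ext_lt τ⁻¹ ⟨r, hr⟩
          change ext τ⁻¹ r = _ at e1
          simp only [Equiv.Perm.mul_apply]
          rw [e1, ext_lt, show τ (τ⁻¹ ⟨r, hr⟩) = ⟨r, hr⟩ from τ.apply_symm_apply _]
          rfl
        · simp only [Equiv.Perm.mul_apply]
          rw [ext_ge _ _ hr, ext_ge _ _ hr]
  rw [rowDet, ← show _ = ∑ σ, Equiv.Perm.sign σ • (List.ofFn fun r => a r (σ r)).prod from hsum,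
    Finset.sum_product]
  simp only [Finset.sum_const, Finset.card_univ, Fintype.card_perm, Fintype.card_fin, T]
  rw [← Finset.smul_sum]
  rfl

/-! ### The action of `GL_n(q)` -/

section Action

variable (F : Type*) [Field F] (n : ℕ)

/-- `S(V) ⊗ ∧(V)` for `V = F^n`, with `S(V) = F[x_1, …, x_n]`. -/
abbrev SymExt : Type _ :=
  MvPolynomial (Fin n) F ⊗[F] ExteriorAlgebra F (Fin n → F)

variable {F n}

/-- The action of `g` on `S(V) = F[x_1, …, x_n]` by `g · x_j = ∑_k g_{kj} x_k`. -/
noncomputable def symAct (g : GL (Fin n) F) :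
    MvPolynomial (Fin n) F →ₐ[F] MvPolynomial (Fin n) F :=
  MvPolynomial.aeval fun j => ∑ k, MvPolynomial.C (g k j) * MvPolynomial.X k

/-- The action of `g` on `∧(V)`, induced by the standard action of `g` on `V = F^n`. -/
noncomputable def extAct (g : GL (Fin n) F) :
    ExteriorAlgebra F (Fin n → F) →ₐ[F] ExteriorAlgebra F (Fin n → F) :=
  ExteriorAlgebra.map (Matrix.toLin' (g : Matrix (Fin n) (Fin n) F))

/-- The diagonal action of `g` on `S(V) ⊗ ∧(V)`. -/
noncomputable def symExtAct (g : GL (Fin n) F) : SymExt F n →ₐ[F] SymExt F n :=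
  Algebra.TensorProduct.map (symAct g) (extAct g)

/-- The invariants `S(V)^P`. -/
noncomputable def symInvariants (P : Subgroup (GL (Fin n) F)) :
    Subalgebra F (MvPolynomial (Fin n) F) where
  carrier := {f | ∀ g ∈ P, symAct g f = f}
  mul_mem' ha hb g hg := by rw [map_mul, ha g hg, hb g hg]
  add_mem' ha hb g hg := by rw [map_add, ha g hg, hb g hg]
  algebraMap_mem' r g _ := AlgHom.commutes _ r

/-- The invariants `(S(V) ⊗ ∧(V) ⊗ Det^k)^P`, as an `S(V)^P`-submodule of `S(V) ⊗ ∧(V)` equipped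
with the twisted action `g ·_k f = det(g)^k (g · f)`. -/
noncomputable def twistedInvariants (P : Subgroup (GL (Fin n) F)) (k : ℕ) :
    Submodule (symInvariants P) (SymExt F n) where
  carrier := {f | ∀ g ∈ P, (g : Matrix (Fin n) (Fin n) F).det ^ k • symExtAct g f = f}
  add_mem' ha hb g hg := by rw [map_add, smul_add, ha g hg, hb g hg]
  zero_mem' g _ := by rw [map_zero, smul_zero]
  smul_mem' s f hf g hg := by
    have key : ∀ (t : MvPolynomial (Fin n) F) (w : SymExt F n), t • w = (t ⊗ₜ[F] 1) * w :=
      fun t w => (Algebra.smul_def (A := SymExt F n) t w)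
    have h1 : symExtAct g (s • f) = s • symExtAct g f := by
      change symExtAct g ((s : MvPolynomial (Fin n) F) • f) =
        (s : MvPolynomial (Fin n) F) • symExtAct g f
      rw [key, key, map_mul]
      congr 1
      simp only [symExtAct, Algebra.TensorProduct.map_tmul, map_one, s.2 g hg]
    rw [h1, smul_comm, hf g hg]

/-- A shortcut for instance search. -/
noncomputable instance instModuleSymInvariants (P : Subgroup (GL (Fin n) F))
    (N : Submodule (symInvariants P) (SymExt F n)) : Module (symInvariants P) N :=
  Submodule.module N

/-- The standard parabolic subgroup `P_I` of block upper triangular matrices. -/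
def parabolic (I : Composition n) : Subgroup (GL (Fin n) F) where
  carrier := {g | (g : Matrix (Fin n) (Fin n) F).BlockTriangular I.index}
  mul_mem' ha hb := by
    simp only [Set.mem_ofPred_eq, Units.val_mul] at *
    exact ha.mul hb
  one_mem' := Matrix.blockTriangular_one
  inv_mem' {g} hg := by
    simp only [Set.mem_ofPred_eq, Matrix.coe_units_inv] at *
    have : Invertible (g : Matrix (Fin n) (Fin n) F) := g.invertible
    exact Matrix.blockTriangular_inv_of_blockTriangular hg

end Action

/-! ### The elements `v_{i,j}`, `θ_i` and the elements of the basis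

`i : Fin I.length` counts from `0`, so that, in the usual notation `m_i = n_1 + ⋯ + n_i`, the
`i`-th block occupies the places from `I.sizeUpTo i` (included) to `I.sizeUpTo (i + 1)`
(excluded), counted from `0`. -/

section Elements

variable {F : Type*} [Field F] [Fintype F] {n : ℕ}

/-- `L_m(z_1, …, z_m) = ∏_k ∏_{c_1, …, c_{k-1} ∈ F} (c_1 z_1 + ⋯ + c_{k-1} z_{k-1} + z_k)`. -/
noncomputable def dicksonL {A : Type*} [CommRing A] [Algebra F A] {m : ℕ} (z : Fin m → A) : A :=
  ∏ k : Fin m, ∏ c : Fin (k : ℕ) → F, (∑ a, c a • z (Fin.castLE k.isLt.le a) + z k)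

/-- `v_{i,j} = ∏_{c} (c_1 x_1 + ⋯ + c_{m_{i-1}} x_{m_{i-1}} + x_{m_{i-1}+j})`, the product over all
`c_1, …, c_{m_{i-1}} ∈ F`. -/
noncomputable def blockV (I : Composition n) (i : Fin I.length) (j : Fin (I.blocksFun i)) :
    MvPolynomial (Fin n) F :=
  ∏ c : Fin (I.sizeUpTo i) → F,
    (∑ a, c a • MvPolynomial.X (Fin.castLE (I.sizeUpTo_le i) a)
      + MvPolynomial.X (I.embedding i j))

/-- `θ_i = L_{n_i}(v_{i,1}, …, v_{i,n_i})`. -/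
noncomputable def theta (F : Type*) [Field F] [Fintype F] (I : Composition n)
    (i : Fin I.length) : MvPolynomial (Fin n) F :=
  dicksonL (F := F) (blockV I i)

/-- The labels `(i; b_1, …, b_j)` with `1 ≤ i ≤ ℓ`, `j ≥ 1`, `0 ≤ b_1 < ⋯ < b_j ≤ m_i - 1` and
`b_j ≥ m_{i-1}` (so that `j ≤ m_i`); the sequence is encoded by the set `{b_1, …, b_j}`, and
`b_j ≥ m_{i-1}` says that some element of this set is at least `m_{i-1}`. -/
structure MuiLabel (I : Composition n) where
  /-- the block -/
  i : Fin I.length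
  /-- the set `{b_1, …, b_j}` -/
  B : Finset ℕ
  lt_top : ∀ b ∈ B, b < I.sizeUpTo ((i : ℕ) + 1)
  exists_ge : ∃ b ∈ B, I.sizeUpTo i ≤ b

/-- `M_{m; b_1, …, b_j}` for the variables `x_1, …, x_m` and `y_1, …, y_m` of `S(V) ⊗ ∧(V)`,
where `m ≤ n`, `B = {b_1, …, b_j}` and `q = |F|`. -/
noncomputable def muiInvariant (F : Type*) [Field F] [Fintype F] {m : ℕ} (hm : m ≤ n)
    (B : Finset ℕ) : SymExt F n :=
  muiM (Fintype.card F)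
    (fun c : Fin m => MvPolynomial.X (Fin.castLE hm c) ⊗ₜ[F] 1)
    (fun c : Fin m => 1 ⊗ₜ[F] ExteriorAlgebra.ι F (Pi.single (Fin.castLE hm c) 1)) B

end Elements

/-!
The structure of the invariants of a parabolic subgroup in `S(V) ⊗ ∧(V)`.

Let `S = S(V)`, let `K` be its field of fractions and `q = |F|`. The Moore matrix
`(x_c ^ (q ^ b))`, `b, c < m`, has the determinant `flagProd F n m`, the product of the linear forms
in `x_1, …, x_m` whose last nonzero coefficient is `1` (`mooreDet_eq_dicksonL`). The columns `u_b`
of its inverse (`invVec F K m b`), read as linear forms in the `y_c`, are a basis of `K^n` if they are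
completed by the `y_c` with `c ≥ m`, and the Mui element `M_{m; B}` is, up to sign, `flagProd F n m`
times the exterior product of the `u_b`, `b ∈ B` (`exists_extMap_muiInvariant`). The adjugate
columns `flagProd F n m • u_b` are multiplied by a determinant under every group element which
preserves the span of `x_1, …, x_m`, hence so is `M_{m; B}` (`symExtAct_muiInvariant`).

A set `B ⊆ {0, …, n-1}` gets as its `m` the end of the last block that meets it (`supEnd I B`).
Multiplying the exterior product of the `u_b` with a product of powers of linear forms
(`weight F I k B`) gives, up to sign, the element of the asserted basis with this label
(`invElt`). These elements are invariant, and they are linearly independent over `K`: there are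
`2 ^ n` of them, and they span the exterior algebra over `K`.

The point is that they span the invariants over `S`. A *mixed* basis of `K^n` is used for this: its
vector at `b` is `u_b` for the Moore matrix up to the end of the block of `b` (`mixedVec`). As
`z ↦ z ^ (q ^ t)` is, on the span of `x_1, …, x_m`, a combination of its analogues with `t < m` over
`S` and not only over `K`, weighted exterior products of the mixed basis are `S`-combinations of the
elements `invElt` (`weight_smul_mixedBasis_mem_span`). It remains to see that the coordinates of
an invariant `f` in the mixed basis are divisible by the weights (`exists_repr_mixedBasis_eq`). The
coordinate at `B` is the top coordinate of the product of `f` with the complementary exterior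
product, so that it is enough to bound the powers of linear forms in that top coordinate. For the
form `x_c` this is done term by term: invariance under the diagonal matrices and, if `k = 0`, under
transvections makes the coefficient of `f` at `y_D` divisible by a power of `x_c`
(`X_pow_dvd_repr`), and the other factor is a determinant whose rows are divisible by `x_c` after a
scaling of one column (`X_pow_dvd_repr_mul_blockForm`) or which vanishes for reasons of rank
(`repr_mul_blockForm_eq_zero`). Unipotent elements of the parabolic subgroup carry `x_c` to every
other linear form with leading variable `x_c`, and distinct forms are relatively prime
(`dvd_coord`). The coefficients of `f` with respect to the `invElt` are invariant by uniqueness.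
-/

/-! ### Bases of exterior algebras and determinants -/

section ExteriorBasis

open Module Set Set.powersetCard

variable {R M I : Type*} [CommRing R] [AddCommGroup M] [Module R M] [LinearOrder I]
  (b : Basis I R M)

theorem extBasis_apply (C : Finset I) :
    b.ExteriorAlgebra C = ExteriorAlgebra.ιMulti R C.card (b ∘ C.orderEmbOfFin rfl) := by
  rw [ExteriorAlgebra.basis_apply]
  rfl

theorem extBasis_apply_of_card {C : Finset I} {j : ℕ} (h : C.card = j) :
    b.ExteriorAlgebra C = ExteriorAlgebra.ιMulti R j (b ∘ C.orderEmbOfFin h) := by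
  subst h
  exact extBasis_apply b C

theorem extBasis_empty : b.ExteriorAlgebra ∅ = 1 := by
  rw [extBasis_apply_of_card b (j := 0) rfl]
  simp

theorem extBasis_singleton (a : I) : b.ExteriorAlgebra {a} = ExteriorAlgebra.ι R (b a) := by
  rw [extBasis_apply_of_card b (j := 1) (by simp), ExteriorAlgebra.ιMulti_apply]
  simp

theorem exists_extBasis_mul {C D : Finset I} (h : Disjoint C D) :
    ∃ ε : ℤˣ, b.ExteriorAlgebra C * b.ExteriorAlgebra D = ε • b.ExteriorAlgebra (C ∪ D) := by
  have h' : Disjoint ((ofCard (s := C) rfl).val) ((ofCard (s := D) rfl).val) := h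
  have hu : (disjUnion h').val = C ∪ D := by
    ext x
    simp [disjUnion]
  rw [← hu]
  exact ⟨_, ExteriorAlgebra.basis_mul_of_disjoint b _ _ h'⟩

theorem extBasis_mul_eq_zero {C D : Finset I} (h : ¬ Disjoint C D) :
    b.ExteriorAlgebra C * b.ExteriorAlgebra D = 0 :=
  ExteriorAlgebra.basis_mul_of_not_disjoint b (ofCard (s := C) rfl) (ofCard (s := D) rfl) h

theorem exists_ι_mul_extBasis {a : I} {C : Finset I} (h : a ∉ C) :
    ∃ ε : ℤˣ, ExteriorAlgebra.ι R (b a) * b.ExteriorAlgebra C =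
      ε • b.ExteriorAlgebra (insert a C) := by
  rw [← extBasis_singleton]
  exact exists_extBasis_mul b (Finset.disjoint_singleton_left.2 h)

theorem ι_mul_extBasis_eq_zero {a : I} {C : Finset I} (h : a ∈ C) :
    ExteriorAlgebra.ι R (b a) * b.ExteriorAlgebra C = 0 := by
  rw [← extBasis_singleton]
  exact extBasis_mul_eq_zero b (by simpa using h)

theorem extBasis_repr_of_mem {j : ℕ} (z : ⋀[R]^j M) (C : Finset I) :
    b.ExteriorAlgebra.repr (z : ExteriorAlgebra R M) C =
      if h : C.card = j then (b.exteriorPower j).repr z ⟨C, h⟩ else 0 := by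
  have key : (b.ExteriorAlgebra.coord C).comp (⋀[R]^j M).subtype =
      if h : C.card = j then (b.exteriorPower j).coord ⟨C, h⟩ else 0 := by
    refine (b.exteriorPower j).ext fun s => ?_
    rw [LinearMap.comp_apply, Submodule.subtype_apply, ← ExteriorAlgebra.basis_eq_coe_basis,
      Basis.coord_apply, Basis.repr_self]
    split_ifs with h
    · rw [Basis.coord_apply, Basis.repr_self, Finsupp.single_apply, Finsupp.single_apply]
      simp only [Subtype.ext_iff]
    · rw [Finsupp.single_eq_of_ne, LinearMap.zero_apply]
      rintro rfl
      exact h s.2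
  have := LinearMap.congr_fun key z
  simp only [LinearMap.comp_apply, Submodule.subtype_apply, Basis.coord_apply] at this
  rw [this]
  split_ifs <;> simp

/-- The coordinates of a product of vectors are minors. -/
theorem extBasis_repr_ιMulti {j : ℕ} {C : Finset I} (h : C.card = j) (w : Fin j → M) :
    b.ExteriorAlgebra.repr (ExteriorAlgebra.ιMulti R j w) C =
      (Matrix.of fun i k => b.repr (w i) (C.orderEmbOfFin h k)).det := by
  rw [← exteriorPower.ιMulti_apply_coe, extBasis_repr_of_mem, dif_pos h,
    exteriorPower.basis_repr_apply, exteriorPower.ιMultiDual_apply_ιMulti]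
  rfl

theorem extBasis_repr_ιMulti_of_ne {j : ℕ} {C : Finset I} (h : C.card ≠ j) (w : Fin j → M) :
    b.ExteriorAlgebra.repr (ExteriorAlgebra.ιMulti R j w) C = 0 := by
  rw [← exteriorPower.ιMulti_apply_coe, extBasis_repr_of_mem, dif_neg h]

end ExteriorBasis

section Top

open Module

variable {R : Type*} [CommRing R] {n : ℕ}

/-- The standard basis `y_C` of the exterior algebra of `R^n`. -/
noncomputable abbrev stdExtBasis (R : Type*) [CommRing R] (n : ℕ) :
    Basis (Finset (Fin n)) R (ExteriorAlgebra R (Fin n → R)) :=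
  (Pi.basisFun R (Fin n)).ExteriorAlgebra

/-- The coordinate of an element of the exterior algebra of `R^n` at `y_1 ⋯ y_n`. -/
noncomputable def topCoord (R : Type*) [CommRing R] (n : ℕ) :
    ExteriorAlgebra R (Fin n → R) →ₗ[R] R :=
  (stdExtBasis R n).coord Finset.univ

theorem topCoord_ιMulti (w : Fin n → Fin n → R) :
    topCoord R n (ExteriorAlgebra.ιMulti R n w) = (Matrix.of w).det := by
  rw [topCoord, Basis.coord_apply, extBasis_repr_ιMulti _ (by simp)]
  have : (Finset.univ : Finset (Fin n)).orderEmbOfFin (by simp) = RelEmbedding.refl _ := by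
    symm
    exact Finset.orderEmbOfFin_unique' _ (by simp)
  simp only [this]
  rfl

theorem topCoord_ιMulti_of_ne {j : ℕ} (hj : j ≠ n) (w : Fin j → Fin n → R) :
    topCoord R n (ExteriorAlgebra.ιMulti R j w) = 0 := by
  rw [topCoord, Basis.coord_apply, extBasis_repr_ιMulti_of_ne]
  simpa using hj.symm

/-- Multiplication by the basis element complementary to `B` turns the coordinate at `B` into a
top coordinate. -/
theorem exists_topCoord_mul_compl (U : Basis (Fin n) R (Fin n → R)) (B : Finset (Fin n)) :
    ∃ ε : ℤˣ, ∀ z : ExteriorAlgebra R (Fin n → R),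
      topCoord R n (z * U.ExteriorAlgebra Bᶜ) =
        ε • (U.ExteriorAlgebra.repr z B * (Matrix.of (fun i => U i)).det) := by
  have htop : ∀ C : Finset (Fin n), C ≠ Finset.univ →
      topCoord R n (U.ExteriorAlgebra C) = 0 := fun C hC => by
    rw [extBasis_apply]
    exact topCoord_ιMulti_of_ne (fun h => hC (by rw [← Finset.card_eq_iff_eq_univ]; simpa)) _
  have huniv : topCoord R n (U.ExteriorAlgebra Finset.univ) = (Matrix.of (fun i => U i)).det := by
    rw [extBasis_apply_of_card _ (j := n) (by simp), topCoord_ιMulti]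
    have : (Finset.univ : Finset (Fin n)).orderEmbOfFin (by simp) = RelEmbedding.refl _ := by
      symm
      exact Finset.orderEmbOfFin_unique' _ (by simp)
    simp only [this]
    rfl
  obtain ⟨ε, hε⟩ := exists_extBasis_mul U (disjoint_compl_right (a := B))
  refine ⟨ε, fun z => ?_⟩
  conv_lhs => rw [← U.ExteriorAlgebra.sum_repr z]
  rw [Finset.sum_mul, map_sum, Finset.sum_eq_single B]
  · rw [smul_mul_assoc, hε, map_smul]
    have : B ∪ Bᶜ = Finset.univ := by simp
    rw [this, Units.smul_def, map_zsmul, huniv, smul_eq_mul, mul_smul_comm, ← Units.smul_def]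
  · intro C _ hC
    rw [smul_mul_assoc, map_smul]
    by_cases hd : Disjoint C Bᶜ
    · obtain ⟨ε', h'⟩ := exists_extBasis_mul U hd
      rw [h', Units.smul_def, map_zsmul, htop, smul_zero, smul_zero]
      intro hu
      apply hC
      have h1 : C ≤ B := by simpa using hd.le_compl_right
      refine le_antisymm h1 fun x hx => ?_
      have : x ∈ C ∪ Bᶜ := by rw [hu]; simp
      simpa [hx] using this
    · rw [extBasis_mul_eq_zero U hd, map_zero, smul_zero]
  · simp

end Top

section Det

variable {R ι : Type*} [CommRing R] [Fintype ι] [DecidableEq ι]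

theorem Matrix.prod_dvd_det (A : Matrix ι ι R) (v : ι → R) (h : ∀ i j, v i ∣ A i j) :
    ∏ i, v i ∣ A.det := by
  choose A' hA' using h
  have : A = Matrix.of fun i j => v i * A' i j := by
    ext i j
    exact hA' i j
  rw [this]
  exact ⟨_, Matrix.det_mul_column v (Matrix.of A')⟩

/-- A matrix has determinant `0` if more rows than there are elements in `J` are supported on the
columns in `J`. -/
theorem Matrix.det_eq_zero_of_card_lt (A : Matrix ι ι R) (T J : Finset ι) (hc : J.card < T.card)
    (h : ∀ i ∈ T, ∀ j, j ∉ J → A i j = 0) : A.det = 0 := by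
  rw [← Matrix.det_transpose, Matrix.det_apply]
  refine Finset.sum_eq_zero fun σ _ => ?_
  obtain ⟨i, hi, hJ⟩ : ∃ i ∈ T, σ i ∉ J := by
    by_contra! hcon
    have := Finset.card_le_card_of_injOn σ hcon σ.injective.injOn
    omega
  rw [Finset.prod_eq_zero (Finset.mem_univ i) (by simpa using h i hi _ hJ), smul_zero]

theorem Matrix.dvd_det_of_dvd_column (A : Matrix ι ι R) (x : R) (j : ι) (h : ∀ i, x ∣ A i j) :
    x ∣ A.det := by
  rw [Matrix.det_apply]
  refine Finset.dvd_sum fun σ _ => ?_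
  rw [Units.smul_def, zsmul_eq_mul]
  exact ((h _).trans (Finset.dvd_prod_of_mem (fun i => A (σ i) i) (Finset.mem_univ j))).mul_left _

end Det

/-! ### Mui elements as exterior products of the columns of an inverse matrix -/

section Mui

open Module

theorem map_muiM {A A' : Type*} [Ring A] [Ring A'] (f : A →+* A') (q : ℕ) {m : ℕ}
    (x y : Fin m → A) (B : Finset ℕ) :
    f (muiM q x y B) = muiM q (fun c => f (x c)) (fun c => f (y c)) B := by
  classical
  rw [muiM, muiM, map_sum]
  refine Finset.sum_congr rfl fun σ _ => ?_
  rw [Units.smul_def, Units.smul_def, map_zsmul, map_list_prod, List.map_ofFn]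
  congr 4
  funext r
  simp only [Function.comp, muiMatrix, Matrix.of_apply]
  split_ifs <;> simp

variable {R : Type*} [CommRing R]

/-- The enumeration of `{0, …, j+l-1}` by the elements of `B` followed by those of its complement,
both in increasing order. This is the order in which the rows of `muiMatrix` are to be read. -/
theorem exists_equiv_complement {j l : ℕ} {B : Finset (Fin (j + l))} (hB : B.card = j) :
    ∃ π : Fin j ⊕ Fin l ≃ Fin (j + l), (∀ r, π (Sum.inl r) = B.orderEmbOfFin hB r) ∧
      ∀ s, (π (Sum.inr s) : ℕ) = Nat.nth (fun e => e ∉ B.map Fin.valEmbedding) s := by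
  classical
  set p : ℕ → Prop := fun e => e ∉ B.map Fin.valEmbedding with hp
  have hinf : {e | p e}.Infinite := (Finset.finite_toSet (B.map Fin.valEmbedding)).infinite_compl
  have hcount : Nat.count p (j + l) = l := by
    rw [Nat.count_eq_card_filter_range]
    have : (Finset.range (j + l)).filter p = Finset.range (j + l) \ B.map Fin.valEmbedding := by
      ext
      simp [hp]
    rw [this, Finset.card_sdiff_of_subset, Finset.card_map, Finset.card_range, hB]
    · omega
    · intro x hx
      simp only [Finset.mem_map, Fin.valEmbedding_apply] at hx
      obtain ⟨a, -, rfl⟩ := hx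
      simp
  have hlt : ∀ s : Fin l, Nat.nth p s < j + l := fun s =>
    Nat.nth_lt_of_lt_count (by rw [hcount]; exact s.2)
  let g : Fin j ⊕ Fin l → Fin (j + l) :=
    Sum.elim (B.orderEmbOfFin hB) fun s => ⟨Nat.nth p s, hlt s⟩
  have hg : Function.Injective g := by
    have hne : ∀ r (s : Fin l), B.orderEmbOfFin hB r ≠ ⟨Nat.nth p s, hlt s⟩ := by
      intro r s h
      have h1 : p (Nat.nth p s) := Nat.nth_mem_of_infinite hinf s
      apply h1
      rw [Finset.mem_map]
      exact ⟨_, B.orderEmbOfFin_mem hB r, by rw [h]; rfl⟩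
    rintro (r | r) (s | s) h
    · rw [(B.orderEmbOfFin hB).injective h]
    · exact absurd h (hne r s)
    · exact absurd h.symm (hne s r)
    · have := (Nat.nth_strictMono hinf).injective (congrArg Fin.val h)
      rw [Fin.ext this]
  have hbij : Function.Bijective g :=
    (Fintype.bijective_iff_injective_and_card g).2 ⟨hg, by simp⟩
  exact ⟨Equiv.ofBijective g hbij, fun _ => rfl, fun _ => rfl⟩

/-- A term of the row determinant which defines the Mui element, with the scalars collected. -/
theorem muiMatrix_prod {j l : ℕ} (q : ℕ) (x : Fin (j + l) → R) {B : Finset ℕ} (hB : B.card = j)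
    (σ : Equiv.Perm (Fin (j + l))) :
    (List.ofFn fun r => muiMatrix q (fun c => algebraMap R
        (ExteriorAlgebra R (Fin (j + l) → R)) (x c))
        (fun c => ExteriorAlgebra.ι R (Pi.single c 1)) B r (σ r)).prod =
      (∏ s : Fin l, x (σ (Fin.natAdd j s)) ^ q ^ Nat.nth (fun e => e ∉ B) s) •
        ExteriorAlgebra.ιMulti R j fun r => Pi.single (σ (Fin.castAdd l r)) 1 := by
  have h1 : ∀ i : Fin j, muiMatrix q (fun c => algebraMap R
      (ExteriorAlgebra R (Fin (j + l) → R)) (x c))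
      (fun c => ExteriorAlgebra.ι R (Pi.single c 1)) B (Fin.castAdd l i)
        (σ (Fin.castAdd l i)) = ExteriorAlgebra.ι R (Pi.single (σ (Fin.castAdd l i)) 1) := by
    intro i
    rw [muiMatrix, Matrix.of_apply, if_pos]
    rw [hB]
    exact i.2
  have h2 : ∀ s : Fin l, muiMatrix q (fun c => algebraMap R
      (ExteriorAlgebra R (Fin (j + l) → R)) (x c))
      (fun c => ExteriorAlgebra.ι R (Pi.single c 1)) B (Fin.natAdd j s)
        (σ (Fin.natAdd j s)) =
      algebraMap R _ (x (σ (Fin.natAdd j s)) ^ q ^ Nat.nth (fun e => e ∉ B) s) := by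
    intro s
    rw [muiMatrix, Matrix.of_apply, if_neg (by simp [hB]), map_pow]
    simp [hB]
  rw [List.ofFn_add, List.prod_append, Algebra.smul_def, Algebra.commutes,
    ExteriorAlgebra.ιMulti_apply, ← List.prod_ofFn, map_list_prod, List.map_ofFn]
  congr 3
  · funext i
    exact h1 i
  · funext s
    exact h2 s

/-- The coordinate of a Mui element at `y_C` is the determinant of the matrix whose first rows are
the unit vectors at the places in `C`. -/
theorem repr_muiM {j l : ℕ} (q : ℕ) (x : Fin (j + l) → R) {B : Finset ℕ} (hB : B.card = j)
    {C : Finset (Fin (j + l))} (hC : C.card = j) :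
    (stdExtBasis R (j + l)).repr (muiM q (fun c => algebraMap R _ (x c))
      (fun c => ExteriorAlgebra.ι R (Pi.single c 1)) B) C =
    (Matrix.of fun r c => Sum.elim (fun i => if c = C.orderEmbOfFin hC i then 1 else 0)
      (fun s : Fin l => x c ^ q ^ Nat.nth (fun e => e ∉ B) s) (finSumFinEquiv.symm r)).det := by
  classical
  rw [← Matrix.det_transpose, Matrix.det_apply, muiM, map_sum, Finsupp.finsetSum_apply,
    Finset.sum_filter]
  refine Finset.sum_congr rfl fun σ _ => ?_
  rw [muiMatrix_prod q x hB, Fin.prod_univ_add]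
  simp only [Matrix.transpose_apply, Matrix.of_apply, finSumFinEquiv_symm_apply_castAdd,
    finSumFinEquiv_symm_apply_natAdd, Sum.elim_inl, Sum.elim_inr]
  by_cases hσ : ∀ i, σ (Fin.castAdd l i) = C.orderEmbOfFin hC i
  · have hinc : IncreasingUpTo B.card σ := by
      intro r s hrs hs
      rw [hB] at hs
      have h1 := hσ ⟨r, lt_trans hrs hs⟩
      have h2 := hσ ⟨s, hs⟩
      have h3 := (C.orderEmbOfFin hC).strictMono (show (⟨r, lt_trans hrs hs⟩ : Fin j) < ⟨s, hs⟩
        from hrs)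
      rw [← h1, ← h2] at h3
      exact h3
    rw [if_pos hinc, Units.smul_def, Units.smul_def, map_zsmul, Finsupp.smul_apply, map_smul,
      Finsupp.smul_apply]
    have : (ExteriorAlgebra.ιMulti R j fun r => (Pi.single (σ (Fin.castAdd l r)) 1 :
        Fin (j + l) → R)) = stdExtBasis R (j + l) C := by
      rw [extBasis_apply_of_card _ hC]
      congr 1
      funext r
      simp [hσ]
    rw [this, Basis.repr_self, Finsupp.single_eq_same]
    simp [hσ]
  · have h0 : ∏ i, (if σ (Fin.castAdd l i) = C.orderEmbOfFin hC i then (1 : R) else 0) = 0 := by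
      push Not at hσ
      obtain ⟨i, hi⟩ := hσ
      exact Finset.prod_eq_zero (Finset.mem_univ i) (if_neg hi)
    rw [h0, zero_mul, smul_zero]
    split_ifs with hinc
    · have hmono : StrictMono fun r : Fin j => σ (Fin.castAdd l r) := fun r s hrs =>
        hinc _ _ hrs (by rw [hB]; exact s.2)
      let C' : Finset (Fin (j + l)) := Finset.univ.map ⟨_, hmono.injective⟩
      have hC' : C'.card = j := by simp [C']
      have hemb : (fun r : Fin j => σ (Fin.castAdd l r)) = C'.orderEmbOfFin hC' :=
        Finset.orderEmbOfFin_unique hC' (fun r => by simp [C']) hmono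
      have : (ExteriorAlgebra.ιMulti R j fun r => (Pi.single (σ (Fin.castAdd l r)) 1 :
          Fin (j + l) → R)) = stdExtBasis R (j + l) C' := by
        rw [extBasis_apply_of_card _ hC', ← hemb]
        congr 1
        funext r
        simp
      have hne : C ≠ C' := by
        rintro rfl
        exact hσ fun i => congrFun hemb i
      rw [this, Units.smul_def, map_zsmul, Finsupp.smul_apply, map_smul,
        Finsupp.smul_apply, Basis.repr_self, Finsupp.single_eq_of_ne hne, smul_zero, smul_zero]
    · simp

theorem repr_muiM_of_ne {j l : ℕ} (q : ℕ) (x : Fin (j + l) → R) {B : Finset ℕ}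
    (hB : B.card = j) {C : Finset (Fin (j + l))} (hC : C.card ≠ j) :
    (stdExtBasis R (j + l)).repr (muiM q (fun c => algebraMap R _ (x c))
      (fun c => ExteriorAlgebra.ι R (Pi.single c 1)) B) C = 0 := by
  classical
  rw [muiM, map_sum, Finsupp.finsetSum_apply]
  refine Finset.sum_eq_zero fun σ _ => ?_
  rw [muiMatrix_prod q x hB, Units.smul_def, map_zsmul, Finsupp.smul_apply, map_smul,
    Finsupp.smul_apply, extBasis_repr_ιMulti_of_ne _ hC, smul_zero, smul_zero]

/-- The Mui element is, up to sign, the determinant of the Moore matrix `X` times the exterior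
product of those columns of its inverse which are indexed by `B`. The coordinate of the Mui element
at `y_C` is the determinant of a matrix `Z` whose last rows are rows of `X`, so that `Z * X⁻¹` is,
after a permutation of its columns, block triangular with an identity block. -/
theorem exists_muiM_eq {m : ℕ} (q : ℕ) (x : Fin m → R) (X : Matrix (Fin m) (Fin m) R)
    (hX : ∀ b c, X b c = x c ^ q ^ (b : ℕ)) (hdet : IsUnit X.det) (B : Finset (Fin m)) :
    ∃ ε : ℤˣ, muiM q (fun c => algebraMap R (ExteriorAlgebra R (Fin m → R)) (x c))
      (fun c => ExteriorAlgebra.ι R (Pi.single c 1)) (B.map Fin.valEmbedding) =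
      ε • X.det • ExteriorAlgebra.ιMulti R B.card
        (fun i c => X⁻¹ c (B.orderEmbOfFin rfl i)) := by
  obtain ⟨j, hj⟩ : ∃ j, B.card = j := ⟨_, rfl⟩
  obtain ⟨l, rfl⟩ : ∃ l, m = j + l :=
    ⟨m - j, by have := Finset.card_le_univ B; simp only [Fintype.card_fin] at this; omega⟩
  obtain ⟨π, hπ1, hπ2⟩ := exists_equiv_complement hj
  have hmap : (B.map Fin.valEmbedding).card = j := by rw [Finset.card_map, hj]
  let ρ : Fin j ⊕ Fin l ≃ Fin (j + l) := finSumFinEquiv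
  refine ⟨Equiv.Perm.sign (ρ.symm.trans π), (stdExtBasis R (j + l)).repr.injective ?_⟩
  have hι : ∀ j' (hj' : B.card = j'),
      ExteriorAlgebra.ιMulti R B.card (fun i c => X⁻¹ c (B.orderEmbOfFin rfl i)) =
      ExteriorAlgebra.ιMulti R j' (fun i c => X⁻¹ c (B.orderEmbOfFin hj' i)) := by
    rintro _ rfl
    rfl
  ext C
  rw [hι j hj, Units.smul_def, map_zsmul, map_smul, Finsupp.smul_apply, Finsupp.smul_apply]
  by_cases hC : C.card = j
  · rw [repr_muiM q x hmap hC, extBasis_repr_ιMulti _ hC]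
    set Z : Matrix (Fin (j + l)) (Fin (j + l)) R := Matrix.of fun r c =>
      Sum.elim (fun i => if c = C.orderEmbOfFin hC i then 1 else 0)
      (fun s : Fin l => x c ^ q ^ Nat.nth (fun e => e ∉ B.map Fin.valEmbedding) s)
        (finSumFinEquiv.symm r) with hZ
    have hZX : (Z * X⁻¹).submatrix ρ π = Matrix.fromBlocks
        (Matrix.of fun i k => X⁻¹ (C.orderEmbOfFin hC i) (B.orderEmbOfFin hj k))
        ((Z * X⁻¹).submatrix ρ π).toBlocks₁₂ 0 1 := by
      ext (r | r) (c | c)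
      · simp [Matrix.mul_apply, hZ, ρ, hπ1]
      · rfl
      all_goals
        have hrow : ∀ c, Z (Fin.natAdd j r) c = X (π (Sum.inr r)) c := by
          intro c
          simp [hZ, hX, hπ2]
        have : (Z * X⁻¹) (Fin.natAdd j r) = (X * X⁻¹) (π (Sum.inr r)) := by
          funext c
          rw [Matrix.mul_apply, Matrix.mul_apply]
          simp only [hrow]
        simp only [Matrix.submatrix_apply, Matrix.fromBlocks_apply₂₁, Matrix.fromBlocks_apply₂₂]
        rw [show ρ (Sum.inr r) = Fin.natAdd j r from rfl, this, Matrix.mul_nonsing_inv _ hdet,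
          Matrix.one_apply]
      · simp
      · simp [Matrix.one_apply]
    have h1 := congrArg Matrix.det hZX
    rw [Matrix.det_fromBlocks_zero₂₁, Matrix.det_one, mul_one] at h1
    have h2 : ((Z * X⁻¹).submatrix ρ π).det =
        Equiv.Perm.sign (ρ.symm.trans π) * (Z * X⁻¹).det := by
      rw [← Matrix.det_permute', ← Matrix.det_submatrix_equiv_self ρ]
      congr 1
      ext r c
      simp
    have h3 : (Z * X⁻¹).det * X.det = Z.det := by
      rw [← Matrix.det_mul, Matrix.mul_assoc, Matrix.nonsing_inv_mul _ hdet, Matrix.mul_one]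
    have h4 : (Matrix.of fun i k => (Pi.basisFun R (Fin (j + l))).repr
        (fun c => X⁻¹ c (B.orderEmbOfFin hj i)) (C.orderEmbOfFin hC k)).det =
        (Matrix.of fun i k => X⁻¹ (C.orderEmbOfFin hC i) (B.orderEmbOfFin hj k)).det := by
      rw [← Matrix.det_transpose]
      congr 1
    rw [h4, ← h1, h2, ← h3, zsmul_eq_mul, smul_eq_mul]
    have h5 : ((Equiv.Perm.sign (ρ.symm.trans π) : ℤ) : R) *
        ((Equiv.Perm.sign (ρ.symm.trans π) : ℤ) : R) = 1 := by
      rw [← Int.cast_mul, ← Units.val_mul, Int.units_mul_self, Units.val_one, Int.cast_one]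
    linear_combination (-(X.det * (Z * X⁻¹).det)) * h5
  · rw [repr_muiM_of_ne q x hmap hC, extBasis_repr_ιMulti_of_ne _ hC, smul_zero, smul_zero]

end Mui

/-! ### Moore determinants -/

section Moore

open Polynomial

variable {F : Type*} [Fintype F]

/-- The `q`-power map is additive and commutes with scalars from `F`. -/
theorem sum_smul_pow_card_pow [Field F] {R ι : Type*} [CommRing R] [Algebra F R] (s : Finset ι)
    (a : ι → F) (z : ι → R) (e : ℕ) :
    (∑ i ∈ s, a i • z i) ^ Fintype.card F ^ e = ∑ i ∈ s, a i • z i ^ Fintype.card F ^ e := by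
  have h : ∀ y : R, ((FiniteField.frobeniusAlgHom F R) ^ e) y = y ^ Fintype.card F ^ e := by
    intro y
    induction e with
    | zero => simp
    | succ e ih =>
      rw [pow_succ', AlgHom.mul_apply, ih, FiniteField.coe_frobeniusAlgHom]
      beta_reduce
      rw [← pow_mul, ← pow_succ]
  rw [← h, map_sum]
  refine Finset.sum_congr rfl fun i _ => ?_
  rw [map_smul, h]

variable {R : Type*} [CommRing R] {m : ℕ}

/-- The Moore determinant `det (x_c^{q^b})`. -/
noncomputable def mooreDet (F : Type*) [Fintype F] (x : Fin m → R) : R :=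
  (Matrix.of fun b c : Fin m => x c ^ Fintype.card F ^ (b : ℕ)).det

/-- The coefficients of the expansion of a Moore determinant along the last column. -/
noncomputable def mooreCofactor (F : Type*) [Fintype F] (x : Fin m → R) (i : Fin (m + 1)) : R :=
  (-1) ^ ((i : ℕ) + m) *
    (Matrix.of fun b c : Fin m => x c ^ Fintype.card F ^ (i.succAbove b : ℕ)).det

theorem mooreDet_snoc (x : Fin m → R) (z : R) :
    mooreDet F (Fin.snoc x z : Fin (m + 1) → R) =
      ∑ i : Fin (m + 1), mooreCofactor F x i * z ^ Fintype.card F ^ (i : ℕ) := by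
  rw [mooreDet, Matrix.det_succ_column _ (Fin.last m)]
  refine Finset.sum_congr rfl fun i _ => ?_
  have h : (Matrix.of fun b c : Fin (m + 1) => (Fin.snoc x z : Fin (m + 1) → R) c ^
      Fintype.card F ^ (b : ℕ)).submatrix i.succAbove (Fin.last m).succAbove =
      Matrix.of fun b c : Fin m => x c ^ Fintype.card F ^ (i.succAbove b : ℕ) := by
    ext b c
    simp
  rw [mooreCofactor, mul_right_comm, h]
  simp

theorem mooreCofactor_last (x : Fin m → R) :
    mooreCofactor F x (Fin.last m) = mooreDet F x := by
  rw [mooreCofactor, mooreDet, Fin.val_last, Even.neg_one_pow ⟨m, rfl⟩, one_mul]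
  simp

variable [Field F] [Algebra F R]

/-- The product of all `λ_1 x_1 + ⋯ + λ_m x_m + z` with `λ_1, …, λ_m` in `F`. -/
noncomputable def spanProd (F : Type*) [Field F] [Fintype F] [Algebra F R] (x : Fin m → R) (z : R) :
    R :=
  ∏ l : Fin m → F, (∑ a, l a • x a + z)

/-- The product of all `λ_1 x_1 + ⋯ + λ_m x_m + T` as a polynomial in `T`. -/
noncomputable def spanPoly (F : Type*) [Field F] [Fintype F] [Algebra F R] (x : Fin m → R) : R[X] :=
  ∏ l : Fin m → F, (X + C (∑ a, l a • x a))

theorem eval_spanPoly (x : Fin m → R) (z : R) : (spanPoly F x).eval z = spanProd F x z := by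
  rw [spanPoly, spanProd, eval_prod]
  refine Finset.prod_congr rfl fun l _ => ?_
  rw [eval_add, eval_X, eval_C, add_comm]

theorem monic_spanPoly (x : Fin m → R) : (spanPoly F x).Monic :=
  monic_prod_of_monic _ _ fun _ _ => monic_X_add_C _

theorem natDegree_spanPoly [Nontrivial R] (x : Fin m → R) :
    (spanPoly F x).natDegree = Fintype.card F ^ m := by
  rw [spanPoly, natDegree_prod_of_monic _ _ fun _ _ => monic_X_add_C _]
  simp only [natDegree_X_add_C]
  simp

theorem spanProd_self (x : Fin m → R) (c : Fin m) : spanProd F x (x c) = 0 := by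
  classical
  refine Finset.prod_eq_zero (Finset.mem_univ (Pi.single c (-1))) ?_
  rw [Finset.sum_eq_single c]
  · simp
  · intro a _ ha
    simp [ha]
  · simp

variable [IsDomain R]

/-- Both sides are polynomials in `T` of degree at most `q^m` with the coefficient `mooreDet F x` at
`T^(q^m)`, and both vanish at the `q^m` points of the span of the `x_a`: the right-hand side is the
Moore determinant of `x_1, …, x_m, T`, whose columns become dependent there. -/
theorem mooreDet_mul_spanPoly {x : Fin m → R} (hx : LinearIndependent F x) :
    C (mooreDet F x) * spanPoly F x =
      ∑ i : Fin (m + 1), C (mooreCofactor F x i) * X ^ Fintype.card F ^ (i : ℕ) := by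
  set q := Fintype.card F with hq
  have hq1 : 1 < q := Fintype.one_lt_card
  set P : R[X] := ∑ i : Fin (m + 1), C (mooreCofactor F x i) * X ^ q ^ (i : ℕ) with hP
  have hPdeg : P.natDegree ≤ q ^ m :=
    natDegree_sum_le_of_forall_le _ _ fun i _ => (natDegree_C_mul_X_pow_le _ _).trans
      (Nat.pow_le_pow_right hq1.le (by omega))
  have hPcoeff : P.coeff (q ^ m) = mooreDet F x := by
    rw [hP, finsetSum_coeff, Finset.sum_eq_single (Fin.last m)]
    · simp [mooreCofactor_last]
    · intro i _ hi
      rw [coeff_C_mul_X_pow, if_neg]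
      intro h
      apply hi
      ext
      exact (Nat.pow_right_injective hq1 h).symm
    · simp
  have hQdeg : (C (mooreDet F x) * spanPoly F x).natDegree ≤ q ^ m :=
    (natDegree_C_mul_le _ _).trans (natDegree_spanPoly x).le
  have hQcoeff : (C (mooreDet F x) * spanPoly F x).coeff (q ^ m) = mooreDet F x := by
    rw [coeff_C_mul, ← natDegree_spanPoly (F := F) x, (monic_spanPoly x).coeff_natDegree, mul_one]
  rw [← sub_eq_zero]
  refine eq_zero_of_natDegree_lt_card_of_eval_eq_zero (f := fun l : Fin m → F => -∑ a, l a • x a)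
    _ ?_ ?_ ?_
  · intro l l' h
    have h' := neg_injective h
    have := Fintype.linearIndependent_iff.1 hx (fun a => l a - l' a)
      (by simp only [sub_smul, Finset.sum_sub_distrib]; exact sub_eq_zero.2 h')
    funext a
    exact sub_eq_zero.1 (this a)
  · intro l
    have h1 : (spanPoly F x).eval (-∑ a, l a • x a) = 0 := by
      rw [eval_spanPoly]
      exact Finset.prod_eq_zero (Finset.mem_univ l) (by simp)
    have h2 : P.eval (-∑ a, l a • x a) = 0 := by
      have : P.eval (-∑ a, l a • x a) = mooreDet F (Fin.snoc x (-∑ a, l a • x a)) := by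
        rw [mooreDet_snoc, hP, eval_finsetSum]
        simp [hq]
      rw [this, mooreDet, ← Matrix.exists_mulVec_eq_zero_iff]
      refine ⟨Fin.snoc (fun a => algebraMap F R (l a)) 1, ?_, ?_⟩
      · intro h
        have := congrFun h (Fin.last m)
        simp at this
      · funext b
        rw [Matrix.mulVec, dotProduct, Fin.sum_univ_castSucc]
        simp only [Matrix.of_apply, Fin.snoc_castSucc, Fin.snoc_last, mul_one, Pi.zero_apply]
        have h3 := sum_smul_pow_card_pow Finset.univ (fun a => - l a) x (b : ℕ)
        simp only [neg_smul, Finset.sum_neg_distrib] at h3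
        rw [h3, ← sub_eq_add_neg, sub_eq_zero]
        refine Finset.sum_congr rfl fun a _ => ?_
        rw [Algebra.smul_def, mul_comm]
    rw [eval_sub, eval_mul, h1, h2, mul_zero, sub_zero]
  · have hle : (C (mooreDet F x) * spanPoly F x - P).natDegree ≤ q ^ m :=
      (natDegree_sub_le _ _).trans (max_le hQdeg hPdeg)
    have hcard : Fintype.card (Fin m → F) = q ^ m := by simp [hq]
    rw [hcard]
    refine lt_of_le_of_ne hle fun h => ?_
    have hc : (C (mooreDet F x) * spanPoly F x - P).coeff (q ^ m) = 0 := by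
      rw [coeff_sub, hQcoeff, hPcoeff, sub_self]
    rw [← h, coeff_natDegree, leadingCoeff_eq_zero] at hc
    rw [hc, natDegree_zero] at h
    exact (pow_pos (by omega : 0 < q) m).ne h

theorem mooreDet_snoc_eq {x : Fin m → R} (hx : LinearIndependent F x) (z : R) :
    mooreDet F (Fin.snoc x z : Fin (m + 1) → R) = mooreDet F x * spanProd F x z := by
  have := congrArg (eval z) (mooreDet_mul_spanPoly hx)
  rw [eval_mul, eval_C, eval_spanPoly, eval_finsetSum] at this
  rw [this, mooreDet_snoc]
  simp

/-- Moore's determinant formula. -/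
theorem mooreDet_eq_dicksonL {x : Fin m → R} (hx : LinearIndependent F x) :
    mooreDet F x = dicksonL (F := F) x := by
  induction m with
  | zero => simp [mooreDet, dicksonL]
  | succ m ih =>
    have h1 : LinearIndependent F (fun a : Fin m => x a.castSucc) :=
      hx.comp _ (Fin.castSucc_injective m)
    have h2 : x = Fin.snoc (fun a : Fin m => x a.castSucc) (x (Fin.last m)) := by
      funext a
      refine Fin.lastCases ?_ (fun a => ?_) a <;> simp
    conv_lhs => rw [h2]
    rw [mooreDet_snoc_eq h1, ih h1, dicksonL, dicksonL, Fin.prod_univ_castSucc]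
    rfl

theorem spanProd_ne_zero {x : Fin m → R} {z : R}
    (hx : LinearIndependent F (Fin.snoc x z : Fin (m + 1) → R)) : spanProd F x z ≠ 0 := by
  refine Finset.prod_ne_zero_iff.2 fun l _ h => ?_
  have := Fintype.linearIndependent_iff.1 hx (Fin.snoc l 1)
    (by rw [Fin.sum_univ_castSucc]; simpa using h) (Fin.last m)
  simp at this

theorem mooreDet_ne_zero {x : Fin m → R} (hx : LinearIndependent F x) : mooreDet F x ≠ 0 := by
  induction m with
  | zero => simp [mooreDet]
  | succ m ih =>
    have h1 : LinearIndependent F (fun a : Fin m => x a.castSucc) :=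
      hx.comp _ (Fin.castSucc_injective m)
    have h2 : x = Fin.snoc (fun a : Fin m => x a.castSucc) (x (Fin.last m)) := by
      funext a
      refine Fin.lastCases ?_ (fun a => ?_) a <;> simp
    rw [h2, mooreDet_snoc_eq h1]
    exact mul_ne_zero (ih h1) (spanProd_ne_zero (h2 ▸ hx))

/-- The product over a translate of an `F`-subspace depends linearly on the translation. -/
theorem spanProd_sum {x : Fin m → R} (hx : LinearIndependent F x) {ι : Type*} (s : Finset ι)
    (a : ι → F) (z : ι → R) :
    spanProd F x (∑ i ∈ s, a i • z i) = ∑ i ∈ s, a i • spanProd F x (z i) := by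
  apply mul_left_cancel₀ (mooreDet_ne_zero hx)
  rw [← mooreDet_snoc_eq hx, Finset.mul_sum]
  simp only [mul_smul_comm, ← mooreDet_snoc_eq hx, mooreDet_snoc, sum_smul_pow_card_pow,
    Finset.mul_sum, Finset.smul_sum]
  exact Finset.sum_comm

/-- On the span of `x_1, …, x_m`, each power map `z ↦ z^{q^t}` is a combination of
those with `t < m`, with coefficients in `R` itself: the polynomial `spanPoly F x` is monic and
involves the exponents `q^i` only. -/
theorem exists_pow_eq_sum {x : Fin m → R} (hx : LinearIndependent F x) (t : ℕ) :
    ∃ r : Fin m → R, ∀ c, x c ^ Fintype.card F ^ t =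
      ∑ b, r b * x c ^ Fintype.card F ^ (b : ℕ) := by
  classical
  set q := Fintype.card F with hq
  have hq1 : 1 < q := Fintype.one_lt_card
  have hbase : ∃ d : Fin m → R, ∀ c, x c ^ q ^ m = ∑ b, d b * x c ^ q ^ (b : ℕ) := by
    refine ⟨fun b => -(spanPoly F x).coeff (q ^ (b : ℕ)), fun c => ?_⟩
    have hcof : ∀ i : Fin (m + 1), mooreDet F x * (spanPoly F x).coeff (q ^ (i : ℕ)) =
        mooreCofactor F x i := by
      intro i
      have := congrArg (fun p => coeff p (q ^ (i : ℕ))) (mooreDet_mul_spanPoly hx)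
      simp only [coeff_C_mul, finsetSum_coeff] at this
      rw [this, Finset.sum_eq_single i]
      · simp [hq]
      · intro j _ hj
        rw [coeff_X_pow, if_neg, mul_zero]
        intro h
        apply hj
        ext
        exact (Nat.pow_right_injective hq1 h).symm
      · simp
    have h0 : ∑ i : Fin (m + 1), mooreCofactor F x i * x c ^ q ^ (i : ℕ) = 0 := by
      rw [← mooreDet_snoc, mooreDet_snoc_eq hx, spanProd_self, mul_zero]
    apply mul_left_cancel₀ (mooreDet_ne_zero hx)
    rw [Fin.sum_univ_castSucc, mooreCofactor_last] at h0
    simp only [neg_mul, Finset.sum_neg_distrib, mul_neg, Finset.mul_sum]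
    rw [← add_eq_zero_iff_eq_neg, add_comm, ← h0]
    congr 1
    refine Finset.sum_congr rfl fun b _ => ?_
    rw [← mul_assoc]
    have := hcof b.castSucc
    rw [Fin.val_castSucc] at this
    rw [this]
    rfl
  obtain ⟨d, hd⟩ := hbase
  induction t with
  | zero =>
    rcases Nat.eq_zero_or_pos m with rfl | hm
    · exact ⟨fun _ => 0, fun c => c.elim0⟩
    · refine ⟨Pi.single ⟨0, hm⟩ 1, fun c => ?_⟩
      rw [Finset.sum_eq_single ⟨0, hm⟩]
      · simp
      · intro b _ hb
        simp [hb]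
      · simp
  | succ t ih =>
    obtain ⟨r, hr⟩ := ih
    have hpow : ∀ b : Fin m, ∃ s : Fin m → R, ∀ c, x c ^ q ^ ((b : ℕ) + 1) =
        ∑ b', s b' * x c ^ q ^ (b' : ℕ) := by
      intro b
      by_cases hb : (b : ℕ) + 1 < m
      · refine ⟨Pi.single ⟨b + 1, hb⟩ 1, fun c => ?_⟩
        rw [Finset.sum_eq_single ⟨b + 1, hb⟩]
        · simp
        · intro b' _ hb'
          simp [hb']
        · simp
      · have : (b : ℕ) + 1 = m := by omega
        exact ⟨d, fun c => by rw [this, hd]⟩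
    choose s hs using hpow
    refine ⟨fun b' => ∑ b, r b ^ q * s b b', fun c => ?_⟩
    have h1 := sum_smul_pow_card_pow (F := F) Finset.univ (fun _ => 1)
      (fun b => r b * x c ^ q ^ (b : ℕ)) 1
    simp only [one_smul, pow_one] at h1
    rw [pow_succ, pow_mul, hr, h1]
    simp only [mul_pow, ← pow_mul, ← pow_succ, ← hq, hs, Finset.mul_sum, Finset.sum_mul]
    rw [Finset.sum_comm]
    simp only [mul_assoc]

end Moore

/-! ### The products of linear forms with a given leading variable -/

section LeadProd

variable {F : Type*} [Field F] [Fintype F] {n : ℕ}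

/-- The product over all combinations of `m + k` elements, arranged by the last `k` coefficients. -/
theorem spanProd_add {R : Type*} [CommRing R] [Algebra F R] {m k : ℕ} (x : Fin (m + k) → R)
    (z : R) : spanProd F x z = ∏ c : Fin k → F, spanProd F (fun a => x (Fin.castAdd k a))
      (∑ a, c a • x (Fin.natAdd m a) + z) := by
  simp only [spanProd]
  rw [← (Fin.appendEquiv m k).prod_comp, Fintype.prod_prod_type_right]
  refine Finset.prod_congr rfl fun c _ => Finset.prod_congr rfl fun d _ => ?_
  rw [Fin.sum_univ_add, add_assoc]
  simp [Fin.appendEquiv]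

theorem spanProd_sum_add {R : Type*} [CommRing R] [IsDomain R] [Algebra F R] {m : ℕ}
    {x : Fin m → R} (hx : LinearIndependent F x) {ι : Type*} [Fintype ι] (a : ι → F)
    (z : ι → R) (w : R) :
    spanProd F x (∑ i, a i • z i + w) = ∑ i, a i • spanProd F x (z i) + spanProd F x w := by
  have := spanProd_sum hx (Finset.univ : Finset (Option ι)) (fun o => o.elim 1 a)
    (fun o => o.elim w z)
  simpa [Fintype.sum_option, add_comm] using this

variable (F) in
/-- The product of all linear forms in `x_1, …, x_n` with coefficient `1` at `x_c` which do not
involve the variables after `x_c`. -/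
noncomputable def leadProd (c : Fin n) : MvPolynomial (Fin n) F :=
  spanProd F (fun a : Fin (c : ℕ) => MvPolynomial.X (Fin.castLE c.isLt.le a)) (MvPolynomial.X c)

theorem leadProd_eq_spanProd {c : Fin n} {m : ℕ} (h : (c : ℕ) = m) (hm : m ≤ n) :
    leadProd F c = spanProd F (fun a : Fin m => MvPolynomial.X (Fin.castLE hm a))
      (MvPolynomial.X c) := by
  subst h
  rfl

omit [Fintype F] in
theorem linearIndependent_X_castLE {m : ℕ} (hm : m ≤ n) :
    LinearIndependent F
      (fun a : Fin m => (MvPolynomial.X (Fin.castLE hm a) : MvPolynomial (Fin n) F)) :=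
  (MvPolynomial.linearIndependent_X (Fin n) F).comp _ (Fin.castLE_injective hm)

/-- The map `z ↦ spanProd F x z` for `x = (x_1, …, x_{m_{i-1}})` is linear and carries the variables
of the block to the `v_{i,j}`; thus every factor of `θ_i` is a product of linear forms. -/
theorem theta_eq_prod (I : Composition n) (i : Fin I.length) :
    theta F I i = ∏ j, leadProd F (I.embedding i j) := by
  rw [theta, dicksonL]
  refine Finset.prod_congr rfl fun k _ => ?_
  have hk : ((I.embedding i k : Fin n) : ℕ) = I.sizeUpTo i + k := I.coe_embedding i k
  have hle : I.sizeUpTo i + (k : ℕ) ≤ n := hk ▸ (I.embedding i k).isLt.le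
  rw [leadProd_eq_spanProd hk hle, spanProd_add]
  refine Finset.prod_congr rfl fun c _ => ?_
  have hli := linearIndependent_X_castLE (F := F) (I.sizeUpTo_le i)
  refine Eq.trans ?_ (spanProd_sum_add hli c
    (fun a => MvPolynomial.X (I.embedding i (Fin.castLE k.isLt.le a)))
    (MvPolynomial.X (I.embedding i k))).symm
  rfl

theorem prod_theta_pow (I : Composition n) (p : Fin I.length → Prop) [DecidablePred p] (e : ℕ) :
    ∏ a with p a, theta F I a ^ e = ∏ c with p (I.index c), leadProd F c ^ e := by
  rw [Finset.prod_filter, Finset.prod_filter, ← I.blocksFinEquiv.prod_comp, Fintype.prod_sigma]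
  refine Finset.prod_congr rfl fun a _ => ?_
  have : ∀ j, I.index (I.blocksFinEquiv ⟨a, j⟩) = a := fun j => I.index_embedding a j
  simp only [this]
  split_ifs
  · rw [theta_eq_prod, Finset.prod_pow]
    rfl
  · simp

variable (F n) in
/-- The Moore matrix of `x_1, …, x_m`, enlarged to an `n × n` matrix by an identity matrix. -/
noncomputable def mooreMat (m : ℕ) : Matrix (Fin n) (Fin n) (MvPolynomial (Fin n) F) :=
  Matrix.of fun b c => if (b : ℕ) < m ∧ (c : ℕ) < m then
    MvPolynomial.X c ^ Fintype.card F ^ (b : ℕ) else if b = c then 1 else 0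

variable (F n) in
/-- The product of the linear forms in `x_1, …, x_m` whose last nonzero coefficient is `1`. -/
noncomputable def flagProd (m : ℕ) : MvPolynomial (Fin n) F :=
  ∏ c with (c : Fin n).val < m, leadProd F c

theorem dicksonL_X {m : ℕ} (hm : m ≤ n) :
    dicksonL (F := F) (fun a : Fin m => (MvPolynomial.X (Fin.castLE hm a) :
      MvPolynomial (Fin n) F)) = flagProd F n m := by
  have h : (Finset.univ.filter fun c : Fin n => c.val < m) =
      Finset.univ.map (Fin.castLEEmb hm) := by
    ext c
    simp only [Finset.mem_filter, Finset.mem_univ, true_and, Finset.mem_map]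
    exact ⟨fun h => ⟨⟨c, h⟩, rfl⟩, fun ⟨a, ha⟩ => ha ▸ a.2⟩
  rw [flagProd, h, Finset.prod_map]
  rfl

theorem mooreMat_apply_of_lt {m : ℕ} {b c : Fin n} (hb : (b : ℕ) < m) (hc : (c : ℕ) < m) :
    mooreMat F n m b c = MvPolynomial.X c ^ Fintype.card F ^ (b : ℕ) := by
  rw [mooreMat, Matrix.of_apply, if_pos ⟨hb, hc⟩]

theorem mooreMat_apply_of_le_left {m : ℕ} {b : Fin n} (hb : m ≤ b) (c : Fin n) :
    mooreMat F n m b c = if b = c then 1 else 0 := by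
  rw [mooreMat, Matrix.of_apply, if_neg (by omega)]

theorem mooreMat_apply_of_le_right {m : ℕ} (b : Fin n) {c : Fin n} (hc : m ≤ c) :
    mooreMat F n m b c = if b = c then 1 else 0 := by
  rw [mooreMat, Matrix.of_apply, if_neg (by omega)]

theorem det_mooreMat {m : ℕ} (hm : m ≤ n) : (mooreMat F n m).det = flagProd F n m := by
  rw [Matrix.twoBlockTriangular_det _ (fun i : Fin n => (i : ℕ) < m)]
  · have h1 : ((mooreMat F n m).toSquareBlockProp fun i => ¬ (i : ℕ) < m) = 1 := by
      refine Matrix.ext fun i j => ?_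
      refine (mooreMat_apply_of_le_left (F := F) (not_lt.1 i.2) (j : Fin n)).trans ?_
      rw [Matrix.one_apply]
      simp only [Subtype.ext_iff]
    let e : Fin m ≃ {i : Fin n // (i : ℕ) < m} :=
      ⟨fun a => ⟨Fin.castLE hm a, a.2⟩, fun i => ⟨i, i.2⟩, fun _ => rfl, fun _ => rfl⟩
    have h2 : ((mooreMat F n m).toSquareBlockProp fun i => (i : ℕ) < m).det =
        mooreDet F (fun a : Fin m => (MvPolynomial.X (Fin.castLE hm a) :
          MvPolynomial (Fin n) F)) := by
      rw [← Matrix.det_submatrix_equiv_self e, mooreDet]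
      congr 1
      refine Matrix.ext fun b c => ?_
      exact mooreMat_apply_of_lt (F := F) (b := Fin.castLE hm b) (c := Fin.castLE hm c) b.2 c.2
    have h3 : ((mooreMat F n m).toSquareBlockProp fun i => ¬ (i : ℕ) < m).det = 1 :=
      (congrArg Matrix.det h1).trans Matrix.det_one
    rw [h2, h3, mooreDet_eq_dicksonL (linearIndependent_X_castLE (F := F) hm), dicksonL_X]
    exact mul_one _
  · intro i hi j hj
    rw [mooreMat_apply_of_le_left (not_lt.1 hi), if_neg]
    rintro rfl
    exact hi hj

theorem leadProd_ne_zero (c : Fin n) : leadProd F c ≠ 0 := by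
  have h : (c : ℕ) + 1 ≤ n := c.isLt
  have h2 : (Fin.snoc (fun a : Fin (c : ℕ) => MvPolynomial.X (Fin.castLE c.isLt.le a))
      (MvPolynomial.X c) : Fin ((c : ℕ) + 1) → MvPolynomial (Fin n) F) =
      fun a => MvPolynomial.X (Fin.castLE h a) := by
    funext a
    refine Fin.lastCases ?_ (fun a => ?_) a
    · rw [Fin.snoc_last]
      rfl
    · rw [Fin.snoc_castSucc]
      rfl
  exact spanProd_ne_zero (h2 ▸ linearIndependent_X_castLE h)

theorem flagProd_ne_zero (m : ℕ) : flagProd F n m ≠ 0 :=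
  Finset.prod_ne_zero_iff.2 fun _ _ => leadProd_ne_zero _

end LeadProd

/-! ### Divisibility by products of linear forms -/

section LinearForms

variable {F : Type*} [Field F] {n : ℕ}

/-- The linear form `∑ v_a x_a`. -/
noncomputable def linForm (v : Fin n → F) : MvPolynomial (Fin n) F :=
  ∑ a, v a • MvPolynomial.X a

theorem linForm_injective : Function.Injective (linForm : (Fin n → F) → _) := by
  intro v w h
  have := Fintype.linearIndependent_iff.1 (MvPolynomial.linearIndependent_X (Fin n) F)
    (fun a => v a - w a)
    (by simp only [sub_smul, Finset.sum_sub_distrib]; exact sub_eq_zero.2 h)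
  funext a
  exact sub_eq_zero.1 (this a)

theorem linForm_single (c : Fin n) : linForm (Pi.single c (1 : F)) = MvPolynomial.X c := by
  rw [linForm, Finset.sum_eq_single c]
  · simp
  · intro a _ ha
    simp [ha]
  · simp

/-- The coefficient vectors of the factors of `leadProd F c`. -/
noncomputable def leadVec (c : Fin n) (l : Fin (c : ℕ) → F) : Fin n → F :=
  fun a => if h : (a : ℕ) < c then l ⟨a, h⟩ else if a = c then 1 else 0

theorem leadVec_self (c : Fin n) (l : Fin (c : ℕ) → F) : leadVec c l c = 1 := by
  simp [leadVec]

theorem leadVec_of_lt {c a : Fin n} (l : Fin (c : ℕ) → F) (h : c < a) : leadVec c l a = 0 := by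
  rw [leadVec, dif_neg (by omega), if_neg (by omega)]

theorem leadVec_injective (c : Fin n) : Function.Injective (leadVec (F := F) c) := by
  intro l l' h
  funext a
  have := congrFun h (Fin.castLE c.isLt.le a)
  simpa [leadVec] using this

theorem linForm_leadVec (c : Fin n) (l : Fin (c : ℕ) → F) : linForm (leadVec c l) =
    ∑ a, l a • MvPolynomial.X (Fin.castLE c.isLt.le a) + MvPolynomial.X c := by
  have h1 : linForm (leadVec c l) =
      ∑ a : Fin n, ((if h : (a : ℕ) < c then l ⟨a, h⟩ else 0) • MvPolynomial.X a +
        (if a = c then (1 : F) else 0) • MvPolynomial.X a) := by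
    refine Finset.sum_congr rfl fun a _ => ?_
    rw [← add_smul, leadVec]
    congr 1
    split_ifs <;> first | omega | simp
  rw [h1, Finset.sum_add_distrib]
  congr 1
  · symm
    refine Finset.sum_of_injOn (Fin.castLE c.isLt.le) (Fin.castLE_injective _).injOn
      (by simp) ?_ ?_
    · intro a _ ha
      rw [dif_neg, zero_smul]
      intro h
      exact ha ⟨⟨a, h⟩, by simp, rfl⟩
    · intro a _
      simp
  · rw [Finset.sum_eq_single c]
    · simp
    · intro a _ ha
      simp [ha]
    · simp

theorem leadProd_eq_prod_linForm [Fintype F] (c : Fin n) :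
    leadProd F c = ∏ l, linForm (leadVec c l) := by
  simp only [linForm_leadVec]
  rfl

/-- The substitution `x_c ↦ -∑_{a < c} l_a x_a`, which annihilates `∑_{a < c} l_a x_a + x_c`. -/
theorem exists_killing_algHom (c : Fin n) (l : Fin (c : ℕ) → F) :
    ∃ φ : MvPolynomial (Fin n) F →ₐ[F] MvPolynomial (Fin n) F,
      ∀ v, φ (linForm v) = linForm (v - v c • leadVec c l) := by
  refine ⟨MvPolynomial.aeval fun a => if a = c then MvPolynomial.X c - linForm (leadVec c l)
    else MvPolynomial.X a, fun v => ?_⟩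
  have h1 : linForm (v - v c • leadVec c l) = linForm v - v c • linForm (leadVec c l) := by
    simp only [linForm, Pi.sub_apply, Pi.smul_apply, sub_smul, Finset.sum_sub_distrib,
      Finset.smul_sum, smul_smul, smul_eq_mul]
  have h2 : ∀ a, (if a = c then MvPolynomial.X c - linForm (leadVec c l)
      else (MvPolynomial.X a : MvPolynomial (Fin n) F)) =
      MvPolynomial.X a - if a = c then linForm (leadVec c l) else 0 := by
    intro a
    split_ifs with h
    · rw [h]
    · simp
  rw [h1, show linForm v = ∑ a, v a • MvPolynomial.X a from rfl, map_sum]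
  simp only [map_smul, MvPolynomial.aeval_X, h2, smul_sub, Finset.sum_sub_distrib]
  congr 1
  rw [Finset.sum_eq_single c]
  · simp
  · intro a _ ha
    simp [ha]
  · simp

/-- Two linear forms with last nonzero coefficient `1` are equal if one divides the other. -/
theorem eq_of_linForm_dvd {c c' : Fin n} {l : Fin (c : ℕ) → F} {l' : Fin (c' : ℕ) → F}
    (h : linForm (leadVec c l) ∣ linForm (leadVec c' l')) :
    (⟨c, l⟩ : Σ c : Fin n, Fin (c : ℕ) → F) = ⟨c', l'⟩ := by
  obtain ⟨φ, hφ⟩ := exists_killing_algHom c l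
  obtain ⟨p, hp⟩ := h
  have h1 : leadVec c' l' = leadVec c' l' c • leadVec c l := by
    have h2 := congrArg φ hp
    rw [map_mul, hφ, hφ, leadVec_self, one_smul, sub_self] at h2
    have h0 : linForm (0 : Fin n → F) = 0 := by simp [linForm]
    rw [h0, zero_mul, ← h0] at h2
    exact sub_eq_zero.1 (linForm_injective h2)
  rcases lt_trichotomy c c' with hc | rfl | hc
  · have := congrFun h1 c'
    rw [Pi.smul_apply, leadVec_self, leadVec_of_lt l hc, smul_zero] at this
    exact absurd this one_ne_zero
  · rw [leadVec_self, one_smul] at h1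
    rw [leadVec_injective c h1]
  · rw [leadVec_of_lt l' hc, zero_smul] at h1
    have := congrFun h1 c'
    rw [leadVec_self] at this
    exact absurd this one_ne_zero

end LinearForms

/-! ### Blocks of a composition -/

section Blocks

variable {n : ℕ} (I : Composition n)

/-- The number of places in the blocks before the block of `c`. -/
def blockStart (c : Fin n) : ℕ := I.sizeUpTo (I.index c)

/-- The number of places in the blocks up to the block of `c`, this one included. -/
def blockEnd (c : Fin n) : ℕ := I.sizeUpTo (I.index c + 1)

/-- The end of the last block which contains an element of `B`, and `0` if `B` is empty. -/
def supEnd (B : Finset (Fin n)) : ℕ := B.sup (blockEnd I)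

theorem lt_blockEnd (c : Fin n) : (c : ℕ) < blockEnd I c := I.lt_sizeUpTo_index_succ c

theorem blockStart_le (c : Fin n) : blockStart I c ≤ c := I.sizeUpTo_index_le c

theorem blockEnd_le_card (c : Fin n) : blockEnd I c ≤ n := I.sizeUpTo_le _

variable {I}

theorem blockEnd_le_of_lt {b c : Fin n} (h : (b : ℕ) < blockEnd I c) :
    blockEnd I b ≤ blockEnd I c := by
  apply I.monotone_sizeUpTo
  by_contra! hlt
  have : (I.index c : ℕ) + 1 ≤ I.index b := by omega
  have h1 := I.monotone_sizeUpTo this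
  have h2 := I.sizeUpTo_index_le b
  rw [blockEnd] at h
  omega

theorem index_le_index_of_blockStart_le {c d : Fin n} (h : blockStart I c ≤ d) :
    I.index c ≤ I.index d := by
  by_contra! hlt
  have h1 := I.monotone_sizeUpTo (show (I.index d : ℕ) + 1 ≤ I.index c from hlt)
  have h2 : (d : ℕ) < I.sizeUpTo ((I.index d : ℕ) + 1) := lt_blockEnd I d
  have h3 : I.sizeUpTo (I.index c) ≤ d := h
  omega

theorem blockEnd_le_blockStart_of_lt {b c : Fin n} (h : (b : ℕ) < blockStart I c) :
    blockEnd I b ≤ blockStart I c := by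
  have hlt : I.index b < I.index c := by
    by_contra! hle
    have h1 := I.monotone_sizeUpTo (show (I.index c : ℕ) ≤ I.index b from hle)
    have h2 := I.sizeUpTo_index_le b
    have h3 : (b : ℕ) < I.sizeUpTo (I.index c) := h
    omega
  exact I.monotone_sizeUpTo (show (I.index b : ℕ) + 1 ≤ I.index c from hlt)

theorem supEnd_le_card (B : Finset (Fin n)) : supEnd I B ≤ n :=
  Finset.sup_le fun c _ => blockEnd_le_card I c

theorem lt_supEnd {B : Finset (Fin n)} {c : Fin n} (h : c ∈ B) : (c : ℕ) < supEnd I B :=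
  (lt_blockEnd I c).trans_le (Finset.le_sup (f := blockEnd I) h)

theorem exists_blockEnd_eq_supEnd {B : Finset (Fin n)} (h : B.Nonempty) :
    ∃ b ∈ B, blockEnd I b = supEnd I B := by
  obtain ⟨b, hb, h'⟩ := Finset.exists_mem_eq_sup B h (blockEnd I)
  exact ⟨b, hb, h'.symm⟩

/-- If `c` lies before the end of the last block that meets `B`, then `B` has an element in the
block of `c` or in a later block. -/
theorem exists_blockStart_le {B : Finset (Fin n)} {c : Fin n} (h : (c : ℕ) < supEnd I B) :
    ∃ b ∈ B, blockStart I c ≤ b := by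
  obtain ⟨b, hb, hc⟩ := (Finset.lt_sup_iff).1 h
  refine ⟨b, hb, ?_⟩
  by_contra! hlt
  have h1 := blockEnd_le_blockStart_of_lt hlt
  have h2 := blockStart_le I c
  omega

end Blocks

/-! ### The columns of the inverse Moore matrices -/

section InvVec

open Module

variable (F : Type*) [Field F] [Fintype F] {n : ℕ}
  (K : Type*) [Field K] [Algebra (MvPolynomial (Fin n) F) K]

/-- The column with index `b` of the inverse of the Moore matrix of `x_1, …, x_m`. For `b < m`, as
linear forms in the `y_c`, these are the solutions `u_b` of the equations
`y_c = ∑_{b < m} x_c^{q^b} u_b`, `c < m`. -/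
noncomputable def invVec (m : ℕ) (b : Fin n) : Fin n → K :=
  fun c => ((mooreMat F n m).map (algebraMap (MvPolynomial (Fin n) F) K))⁻¹ c b

variable [IsFractionRing (MvPolynomial (Fin n) F) K]

theorem algebraMap_flagProd_ne_zero (m : ℕ) :
    algebraMap (MvPolynomial (Fin n) F) K (flagProd F n m) ≠ 0 := by
  rw [Ne, FaithfulSMul.algebraMap_eq_zero_iff]
  exact flagProd_ne_zero m

omit [IsFractionRing (MvPolynomial (Fin n) F) K] in
theorem det_map_mooreMat {m : ℕ} (hm : m ≤ n) :
    ((mooreMat F n m).map (algebraMap (MvPolynomial (Fin n) F) K)).det =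
      algebraMap _ K (flagProd F n m) := by
  rw [← det_mooreMat hm, RingHom.map_det]
  rfl

theorem isUnit_det_map_mooreMat {m : ℕ} (hm : m ≤ n) :
    IsUnit ((mooreMat F n m).map (algebraMap (MvPolynomial (Fin n) F) K)).det := by
  rw [det_map_mooreMat F K hm]
  exact (algebraMap_flagProd_ne_zero F K m).isUnit

omit [IsFractionRing (MvPolynomial (Fin n) F) K] in
/-- The equations that determine the vectors `invVec F K m b`. -/
theorem eq_invVec {m : ℕ} {w : Fin n → Fin n → K} (h : ∀ c,
    ∑ b, algebraMap (MvPolynomial (Fin n) F) K (mooreMat F n m b c) • w b = Pi.single c 1)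
    (b : Fin n) : w b = invVec F K m b := by
  have : (Matrix.of fun c b => w b c) *
      (mooreMat F n m).map (algebraMap (MvPolynomial (Fin n) F) K) = 1 := by
    refine Matrix.ext fun c' c => ?_
    have h1 := congrFun (h c) c'
    rw [Finset.sum_apply] at h1
    rw [Matrix.mul_apply, Matrix.one_apply]
    simp only [Pi.smul_apply, smul_eq_mul, Pi.single_apply] at h1
    rw [← h1]
    refine Finset.sum_congr rfl fun b _ => ?_
    rw [Matrix.of_apply, Matrix.map_apply, mul_comm]
  funext c
  rw [invVec, Matrix.inv_eq_left_inv this]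
  rfl

theorem sum_smul_invVec {m : ℕ} (hm : m ≤ n) (c : Fin n) :
    ∑ b, algebraMap (MvPolynomial (Fin n) F) K (mooreMat F n m b c) • invVec F K m b =
      Pi.single c 1 := by
  funext c'
  have h1 := congrFun (congrFun (Matrix.nonsing_inv_mul _ (isUnit_det_map_mooreMat F K hm)) c') c
  rw [Matrix.mul_apply, Matrix.one_apply] at h1
  rw [Finset.sum_apply, Pi.single_apply, ← h1]
  refine Finset.sum_congr rfl fun b _ => ?_
  rw [Pi.smul_apply, smul_eq_mul, mul_comm]
  rfl

/-- The rows of an invertible matrix form a basis. -/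
theorem exists_basis_of_det {K : Type*} [Field K] {n : ℕ} (w : Fin n → Fin n → K)
    (h : (Matrix.of w).det ≠ 0) : ∃ U : Basis (Fin n) K (Fin n → K), ∀ b, U b = w b := by
  have hli : LinearIndependent K w :=
    Matrix.linearIndependent_rows_iff_isUnit.2
      ((Matrix.isUnit_iff_isUnit_det (Matrix.of w)).2 h.isUnit)
  refine ⟨basisOfLinearIndependentOfCardEqFinrank' w hli (by simp), fun b => ?_⟩
  simp

theorem exists_basis_invVec {m : ℕ} (hm : m ≤ n) :
    ∃ U : Basis (Fin n) K (Fin n → K), ∀ b, U b = invVec F K m b := by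
  apply exists_basis_of_det
  have : Matrix.of (invVec F K m) =
      (((mooreMat F n m).map (algebraMap (MvPolynomial (Fin n) F) K))⁻¹).transpose := rfl
  rw [this, Matrix.det_transpose]
  exact (Matrix.isUnit_nonsing_inv_det _ (isUnit_det_map_mooreMat F K hm)).ne_zero

/-- Comparison of the vectors `invVec` for `m' ≤ m`: the coefficients are polynomials, because
`z ↦ z^{q^t}` is a polynomial combination of the `z ↦ z^{q^b}` with `b < m'` on the span of
`x_1, …, x_{m'}`. -/
theorem exists_invVec_eq_sum {m' m : ℕ} (hm' : m' ≤ m) (hm : m ≤ n) :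
    ∃ r : Fin n → Fin n → MvPolynomial (Fin n) F,
      (∀ b : Fin n, (b : ℕ) < m' →
        invVec F K m' b = ∑ t, algebraMap _ K (r b t) • invVec F K m t) ∧
      (∀ b : Fin n, (b : ℕ) < m' → r b b = 1) ∧
      (∀ b t : Fin n, (b : ℕ) < m' → (t : ℕ) < m' → t ≠ b → r b t = 0) ∧
      ∀ b t : Fin n, m ≤ t → r b t = 0 ∨ m' ≤ b := by
  have hm'n := hm'.trans hm
  choose r hr using exists_pow_eq_sum (linearIndependent_X_castLE (F := F) hm'n)
  -- the expression of the power maps with `m' ≤ t < m` by those with `b < m'`, completed by the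
  -- identity for `t < m'`
  let ρ : Fin n → Fin n → MvPolynomial (Fin n) F := fun b t =>
    if h : (b : ℕ) < m' then
      if (t : ℕ) < m' then (if t = b then 1 else 0)
      else if (t : ℕ) < m then r t ⟨b, h⟩ else 0
    else 0
  refine ⟨ρ, fun b hb => ?_, fun b hb => ?_, fun b t hb ht hne => ?_, fun b t ht => ?_⟩
  · -- the asserted combinations satisfy the equations which characterize `invVec F K m'`
    let w : Fin n → Fin n → K := fun b => if (b : ℕ) < m' then
      ∑ t, algebraMap _ K (ρ b t) • invVec F K m t else Pi.single b 1
    have hw : w b = ∑ t, algebraMap _ K (ρ b t) • invVec F K m t := if_pos hb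
    rw [← hw]
    refine (eq_invVec F K (fun c => ?_) b).symm
    by_cases hc : (c : ℕ) < m'
    · rw [← sum_smul_invVec F K hm c]
      have h1 : ∀ b, algebraMap _ K (mooreMat F n m' b c) • w b =
          ∑ t, algebraMap _ K (mooreMat F n m' b c * ρ b t) • invVec F K m t := by
        intro b
        by_cases hb : (b : ℕ) < m'
        · have : w b = ∑ t, algebraMap _ K (ρ b t) • invVec F K m t := if_pos hb
          rw [this, Finset.smul_sum]
          simp only [smul_smul, map_mul]
        · have hbc : b ≠ c := by
            rintro rfl
            exact hb hc
          rw [mooreMat_apply_of_le_left (not_lt.1 hb), if_neg hbc]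
          simp
      simp only [h1]
      rw [Finset.sum_comm]
      refine Finset.sum_congr rfl fun t _ => ?_
      rw [← Finset.sum_smul, ← map_sum]
      congr 2
      by_cases ht : (t : ℕ) < m'
      · rw [Finset.sum_eq_single t]
        · simp only [ρ, dif_pos ht, if_pos ht, if_true, mul_one]
          rw [mooreMat_apply_of_lt ht hc, mooreMat_apply_of_lt (by omega) (by omega)]
        · intro b _ hb
          simp only [ρ, if_pos ht, if_neg hb.symm]
          split_ifs <;> simp
        · simp
      · by_cases ht' : (t : ℕ) < m
        · rw [mooreMat_apply_of_lt ht' (by omega)]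
          have h2 := hr t ⟨c, hc⟩
          refine Eq.trans ?_ h2.symm
          symm
          refine Finset.sum_of_injOn (Fin.castLE hm'n) (Fin.castLE_injective _).injOn
            (by simp) ?_ ?_
          · intro b _ hb
            have : ¬ (b : ℕ) < m' := fun h => hb ⟨⟨b, h⟩, by simp, rfl⟩
            simp only [ρ, dif_neg this, mul_zero]
          · intro b _
            have hb : ((Fin.castLE hm'n b : Fin n) : ℕ) < m' := b.2
            simp only [ρ, dif_pos hb, if_neg ht, if_pos ht']
            rw [mooreMat_apply_of_lt hb hc, mul_comm]
            rfl
        · have htc : t ≠ c := by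
            rintro rfl
            exact ht hc
          rw [mooreMat_apply_of_le_left (not_lt.1 ht'), if_neg htc]
          refine Finset.sum_eq_zero fun b _ => ?_
          simp only [ρ, if_neg ht, if_neg ht']
          split_ifs <;> simp
    · rw [Finset.sum_eq_single c]
      · rw [mooreMat_apply_of_le_left (not_lt.1 hc), if_pos rfl, map_one, one_smul]
        exact if_neg hc
      · intro b _ hb
        rw [mooreMat_apply_of_le_right b (not_lt.1 hc), if_neg hb, map_zero, zero_smul]
      · simp
  · simp [ρ, hb]
  · simp [ρ, hb, ht, hne]
  · by_cases hb : (b : ℕ) < m'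
    · left
      have h1 : ¬ (t : ℕ) < m' := by omega
      have h2 : ¬ (t : ℕ) < m := by omega
      simp only [ρ, dif_pos hb, if_neg h1, if_neg h2]
    · exact Or.inr (not_lt.1 hb)

/-- The vector `u_b`, formed with the Moore matrix up to the end of the block of `b`. -/
noncomputable def mixedVec (I : Composition n) (b : Fin n) : Fin n → K :=
  invVec F K (blockEnd I b) b

/-- The transition from the columns of the full inverse Moore matrix to the mixed vectors is
unitriangular. -/
theorem det_mixedVec (I : Composition n) :
    (Matrix.of (mixedVec F K I)).det = (algebraMap _ K (flagProd F n n))⁻¹ := by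
  choose r hr hr1 hr0 _ using fun b : Fin n =>
    exists_invVec_eq_sum F K (blockEnd_le_card I b) le_rfl
  have h : Matrix.of (mixedVec F K I) =
      (Matrix.of fun b t => algebraMap (MvPolynomial (Fin n) F) K (r b b t)) *
        (((mooreMat F n n).map (algebraMap (MvPolynomial (Fin n) F) K))⁻¹).transpose := by
    refine Matrix.ext fun b c => ?_
    rw [Matrix.of_apply, mixedVec, hr b b (lt_blockEnd I b), Finset.sum_apply, Matrix.mul_apply]
    rfl
  rw [h, Matrix.det_mul, Matrix.det_transpose, Matrix.det_nonsing_inv,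
    det_map_mooreMat F K le_rfl, Ring.inverse_eq_inv',
    Matrix.det_of_isUpperTriangular, Finset.prod_eq_one, one_mul]
  · intro b _
    rw [Matrix.of_apply, hr1 b b (lt_blockEnd I b), map_one]
  · intro b t hbt
    have h1 := lt_blockEnd I b
    rw [Matrix.of_apply, hr0 b b t h1 (lt_trans hbt h1) hbt.ne, map_zero]

theorem exists_basis_mixedVec (I : Composition n) :
    ∃ U : Basis (Fin n) K (Fin n → K), ∀ b, U b = mixedVec F K I b := by
  apply exists_basis_of_det
  rw [det_mixedVec]
  exact inv_ne_zero (algebraMap_flagProd_ne_zero F K n)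

end InvVec

/-! ### Embedding `S(V) ⊗ ∧(V)` into an exterior algebra over the field of rational functions -/

section ExtMap

open Module

variable (F : Type*) [Field F] {n : ℕ}
  (K : Type*) [Field K] [Algebra (MvPolynomial (Fin n) F) K] [Algebra F K]
  [IsScalarTower F (MvPolynomial (Fin n) F) K]

/-- The inclusion of `F^n` into the exterior algebra of `K^n`. -/
noncomputable def vecToExt : (Fin n → F) →ₗ[F] ExteriorAlgebra K (Fin n → K) :=
  ((ExteriorAlgebra.ι K).restrictScalars F).comp ((Algebra.linearMap F K).compLeft (Fin n))

omit [Algebra (MvPolynomial (Fin n) F) K] [IsScalarTower F (MvPolynomial (Fin n) F) K] in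
theorem vecToExt_mul_self (v : Fin n → F) : vecToExt F K v * vecToExt F K v = 0 :=
  ExteriorAlgebra.ι_sq_zero _

omit [IsScalarTower F (MvPolynomial (Fin n) F) K] in
theorem commute_ofId_lift_vecToExt (s : MvPolynomial (Fin n) F)
    (y : ExteriorAlgebra F (Fin n → F)) :
    Commute (Algebra.ofId (MvPolynomial (Fin n) F) (ExteriorAlgebra K (Fin n → K)) s)
      (ExteriorAlgebra.lift F ⟨vecToExt F K, vecToExt_mul_self F K⟩ y) :=
  Algebra.commutes s _

/-- The homomorphism from `S(V) ⊗ ∧(V)` to the exterior algebra of `K^n`, where `K` is an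
extension of `S(V)`. -/
noncomputable def extMap :
    SymExt F n →ₐ[MvPolynomial (Fin n) F] ExteriorAlgebra K (Fin n → K) :=
  Algebra.TensorProduct.lift (Algebra.ofId _ _)
    (ExteriorAlgebra.lift F ⟨vecToExt F K, vecToExt_mul_self F K⟩)
    (commute_ofId_lift_vecToExt F K)

theorem extMap_tmul_one (s : MvPolynomial (Fin n) F) :
    extMap F K (s ⊗ₜ[F] 1) = algebraMap _ _ s := by
  rw [extMap, Algebra.TensorProduct.lift_tmul, map_one, mul_one]
  rfl

theorem extMap_one_tmul_ι (v : Fin n → F) :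
    extMap F K (1 ⊗ₜ[F] ExteriorAlgebra.ι F v) =
      ExteriorAlgebra.ι K fun c => algebraMap F K (v c) := by
  rw [extMap, Algebra.TensorProduct.lift_tmul, map_one, one_mul, ExteriorAlgebra.lift_ι_apply]
  rfl

theorem extMap_one_tmul_ι_single (c : Fin n) :
    extMap F K (1 ⊗ₜ[F] ExteriorAlgebra.ι F (Pi.single c 1)) =
      ExteriorAlgebra.ι K (Pi.single c 1) := by
  rw [extMap_one_tmul_ι]
  congr 1
  funext a
  rw [Pi.single_apply, Pi.single_apply]
  split_ifs <;> simp

variable (n) in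
/-- The basis of `S(V) ⊗ ∧(V)` over `S(V)` which consists of the products `y_C`. -/
noncomputable def symExtBasis :
    Basis (Finset (Fin n)) (MvPolynomial (Fin n) F) (SymExt F n) :=
  (stdExtBasis F n).baseChange (MvPolynomial (Fin n) F)

theorem symExtBasis_apply (C : Finset (Fin n)) :
    symExtBasis F n C = 1 ⊗ₜ[F] stdExtBasis F n C :=
  Basis.baseChange_apply _ _ _

theorem extMap_symExtBasis (C : Finset (Fin n)) :
    extMap F K (symExtBasis F n C) = stdExtBasis K n C := by
  rw [symExtBasis_apply, stdExtBasis, extBasis_apply, extBasis_apply, ExteriorAlgebra.ιMulti_apply,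
    ExteriorAlgebra.ιMulti_apply, ← Algebra.TensorProduct.includeRight_apply, map_list_prod,
    map_list_prod, List.map_ofFn, List.map_ofFn]
  congr 2
  funext i
  simp only [Function.comp, Algebra.TensorProduct.includeRight_apply, Pi.basisFun_apply]
  exact extMap_one_tmul_ι_single F K _

variable {F}

theorem repr_extMap (z : SymExt F n) (C : Finset (Fin n)) :
    (stdExtBasis K n).repr (extMap F K z) C = algebraMap _ K ((symExtBasis F n).repr z C) := by
  conv_lhs => rw [← (symExtBasis F n).sum_repr z]
  rw [map_sum, map_sum, Finsupp.finsetSum_apply, Finset.sum_eq_single C]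
  · rw [map_smul, extMap_symExtBasis, ← algebraMap_smul K, map_smul, Finsupp.smul_apply,
      Basis.repr_self, Finsupp.single_eq_same, smul_eq_mul, mul_one]
  · intro D _ hD
    rw [map_smul, extMap_symExtBasis, ← algebraMap_smul K, map_smul, Finsupp.smul_apply,
      Basis.repr_self, Finsupp.single_eq_of_ne hD.symm, smul_zero]
  · simp

/-- An element of `S(V) ⊗ ∧(V)` is determined by its image over the field of fractions. -/
theorem extMap_injective [IsFractionRing (MvPolynomial (Fin n) F) K] :
    Function.Injective (extMap F K : SymExt F n → _) := by
  intro z w h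
  refine (symExtBasis F n).repr.injective (Finsupp.ext fun C => ?_)
  apply IsFractionRing.injective (MvPolynomial (Fin n) F) K
  rw [← repr_extMap, ← repr_extMap, h]

/-- The element `∑ v_c y_c` of `S(V) ⊗ ∧(V)`. -/
noncomputable def oneForm (v : Fin n → MvPolynomial (Fin n) F) : SymExt F n :=
  ∑ c, v c ⊗ₜ[F] ExteriorAlgebra.ι F (Pi.single c 1 : Fin n → F)

theorem extMap_oneForm (v : Fin n → MvPolynomial (Fin n) F) :
    extMap F K (oneForm v) = ExteriorAlgebra.ι K fun c => algebraMap _ K (v c) := by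
  have h : ∀ c, extMap F K (v c ⊗ₜ[F] ExteriorAlgebra.ι F (Pi.single c 1 : Fin n → F)) =
      ExteriorAlgebra.ι K (algebraMap _ K (v c) • Pi.single c 1) := by
    intro c
    have : v c ⊗ₜ[F] ExteriorAlgebra.ι F (Pi.single c 1 : Fin n → F) =
        v c • ((1 : MvPolynomial (Fin n) F) ⊗ₜ[F]
          ExteriorAlgebra.ι F (Pi.single c 1 : Fin n → F)) := by
      rw [TensorProduct.smul_tmul', smul_eq_mul, mul_one]
    rw [this, map_smul, extMap_one_tmul_ι_single, map_smul, algebraMap_smul]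
  rw [oneForm, map_sum]
  simp only [h]
  rw [← map_sum]
  congr 1
  funext c
  rw [Finset.sum_apply, Finset.sum_eq_single c]
  · simp
  · intro b _ hb
    simp [hb.symm]
  · simp

end ExtMap

section ExtMapMui

open Module

variable {F : Type*} [Field F] [Fintype F] {n : ℕ}
  (K : Type*) [Field K] [Algebra (MvPolynomial (Fin n) F) K] [Algebra F K]
  [IsScalarTower F (MvPolynomial (Fin n) F) K] [IsFractionRing (MvPolynomial (Fin n) F) K]

/-- The Mui element `M_{m; B}` is, up to sign, the product of `flagProd F n m` with the exterior
product of the `u_b`, `b ∈ B`. -/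
theorem exists_extMap_muiInvariant {m : ℕ} (hm : m ≤ n) (U : Basis (Fin n) K (Fin n → K))
    (hU : ∀ b, U b = invVec F K m b) (B : Finset (Fin n)) (hB : ∀ b ∈ B, (b : ℕ) < m) :
    ∃ ε : ℤˣ, extMap F K (muiInvariant F hm (B.map Fin.valEmbedding)) =
      ε • algebraMap _ K (flagProd F n m) • U.ExteriorAlgebra B := by
  classical
  obtain ⟨B, rfl⟩ : ∃ B' : Finset (Fin m), B = B'.map (Fin.castLEEmb hm) := by
    refine ⟨Finset.univ.filter fun a => Fin.castLE hm a ∈ B, ?_⟩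
    ext c
    simp only [Finset.mem_map, Finset.mem_filter, Finset.mem_univ, true_and]
    exact ⟨fun h => ⟨⟨c, hB c h⟩, h, rfl⟩, fun ⟨a, ha, h⟩ => h ▸ ha⟩
  have hval : (B.map (Fin.castLEEmb hm)).map Fin.valEmbedding = B.map Fin.valEmbedding := by
    rw [Finset.map_map]
    rfl
  let x : Fin m → K := fun c => algebraMap _ K (MvPolynomial.X (Fin.castLE hm c) :
    MvPolynomial (Fin n) F)
  let X : Matrix (Fin m) (Fin m) K := Matrix.of fun b c => x c ^ Fintype.card F ^ (b : ℕ)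
  have hXdet : X.det = algebraMap _ K (flagProd F n m) := by
    rw [← dicksonL_X hm, ← mooreDet_eq_dicksonL (linearIndependent_X_castLE (F := F) hm),
      mooreDet, RingHom.map_det]
    congr 1
    refine Matrix.ext fun b c => ?_
    simp [X, x]
  have hXu : IsUnit X.det := hXdet ▸ (algebraMap_flagProd_ne_zero F K m).isUnit
  obtain ⟨ε, hε⟩ := exists_muiM_eq (Fintype.card F) x X (fun _ _ => rfl) hXu B
  refine ⟨ε, ?_⟩
  -- extension by zero of vectors of length `m`; it carries the columns of the inverse of the small
  -- Moore matrix `X` to those of the inverse of `mooreMat F n m`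
  let incl : (Fin m → K) →ₗ[K] (Fin n → K) :=
    LinearMap.pi fun c => if h : (c : ℕ) < m then LinearMap.proj ⟨c, h⟩ else 0
  have hincl : ∀ (v : Fin m → K) (a : Fin m), incl v (Fin.castLE hm a) = v a := by
    intro v a
    simp [incl]
  have hincl0 : ∀ (v : Fin m → K) (c : Fin n), ¬ (c : ℕ) < m → incl v c = 0 := by
    intro v c hc
    simp [incl, hc]
  have hsingle : ∀ a : Fin m, incl (Pi.single a 1) = Pi.single (Fin.castLE hm a) 1 := by
    intro a
    funext c
    by_cases hc : (c : ℕ) < m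
    · obtain ⟨c, rfl⟩ : ∃ c', c = Fin.castLE hm c' := ⟨⟨c, hc⟩, rfl⟩
      rw [hincl, Pi.single_apply, Pi.single_apply]
      simp only [(Fin.castLE_injective hm).eq_iff]
    · rw [hincl0 _ _ hc, Pi.single_eq_of_ne]
      rintro rfl
      exact hc a.2
  have hcol : ∀ b : Fin m, incl (fun c => X⁻¹ c b) = U (Fin.castLE hm b) := by
    intro b
    rw [hU]
    let w : Fin n → Fin n → K := fun b => if h : (b : ℕ) < m then
      incl (fun c => X⁻¹ c ⟨b, h⟩) else Pi.single b 1
    have hw : ∀ b : Fin m, w (Fin.castLE hm b) = incl (fun c => X⁻¹ c b) := by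
      intro b
      simp [w]
    rw [← hw]
    refine eq_invVec F K (fun c => ?_) _
    by_cases hc : (c : ℕ) < m
    · obtain ⟨c, rfl⟩ : ∃ c', c = Fin.castLE hm c' := ⟨⟨c, hc⟩, rfl⟩
      have h1 : ∑ b : Fin m, X b c • (fun c' => X⁻¹ c' b) = Pi.single c 1 := by
        funext c'
        have := congrFun (congrFun (Matrix.nonsing_inv_mul X hXu) c') c
        rw [Matrix.mul_apply, Matrix.one_apply] at this
        rw [Finset.sum_apply, Pi.single_apply, ← this]
        refine Finset.sum_congr rfl fun b _ => ?_
        rw [Pi.smul_apply, smul_eq_mul, mul_comm]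
      rw [← hsingle, ← h1, map_sum]
      symm
      refine Finset.sum_of_injOn (Fin.castLE hm) (Fin.castLE_injective _).injOn (by simp) ?_ ?_
      · intro b _ hb
        have hb' : ¬ (b : ℕ) < m := fun h => hb ⟨⟨b, h⟩, by simp, rfl⟩
        rw [mooreMat_apply_of_le_left (not_lt.1 hb'), if_neg, map_zero, zero_smul]
        rintro rfl
        exact hb' c.2
      · intro b _
        rw [hw, map_smul, mooreMat_apply_of_lt (by simp) (by simp)]
        simp [X, x]
    · rw [Finset.sum_eq_single c]
      · rw [mooreMat_apply_of_le_left (not_lt.1 hc), if_pos rfl, map_one, one_smul]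
        simp only [w, dif_neg hc]
      · intro b _ hb
        rw [mooreMat_apply_of_le_right b (not_lt.1 hc), if_neg hb, map_zero, zero_smul]
      · simp
  have hφ := congrArg (ExteriorAlgebra.map incl) hε
  have hM : ExteriorAlgebra.map incl (muiM (Fintype.card F)
      (fun c => algebraMap K (ExteriorAlgebra K (Fin m → K)) (x c))
      (fun c => ExteriorAlgebra.ι K (Pi.single c 1)) (B.map Fin.valEmbedding)) =
      extMap F K (muiInvariant F hm (B.map Fin.valEmbedding)) := by
    rw [muiInvariant]
    refine (map_muiM (ExteriorAlgebra.map incl).toRingHom _ _ _ _).trans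
      (Eq.trans ?_ (map_muiM (extMap F K).toRingHom _ _ _ _).symm)
    congr 1
    · funext c
      refine Eq.trans ?_ (extMap_tmul_one F K _).symm
      exact (ExteriorAlgebra.map incl).commutes (x c)
    · funext c
      refine Eq.trans ?_ (extMap_one_tmul_ι_single F K _).symm
      refine (ExteriorAlgebra.map_apply_ι incl _).trans ?_
      rw [hsingle]
  rw [hval, ← hM, hφ, Units.smul_def, map_zsmul, map_smul, hXdet, ← Units.smul_def,
    extBasis_apply_of_card U (j := B.card) (by simp), ExteriorAlgebra.map_apply_ιMulti]
  congr 3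
  funext i
  have hemb : (fun i => Fin.castLE hm (B.orderEmbOfFin rfl i)) =
      (B.map (Fin.castLEEmb hm)).orderEmbOfFin (by simp) :=
    Finset.orderEmbOfFin_unique (by simp)
      (fun i => Finset.mem_map_of_mem _ (B.orderEmbOfFin_mem rfl i))
      ((Fin.strictMono_castLE hm).comp (B.orderEmbOfFin rfl).strictMono)
  rw [Function.comp, Function.comp, ← congrFun hemb i, ← hcol]

end ExtMapMui

/-! ### The action on Moore matrices, Mui elements and top coordinates -/

section Action

open Module

variable {F : Type*} [Field F] {n : ℕ}

theorem symAct_X (g : GL (Fin n) F) (c : Fin n) :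
    symAct g (MvPolynomial.X c) = ∑ k, g k c • MvPolynomial.X k := by
  rw [symAct, MvPolynomial.aeval_X]
  simp only [MvPolynomial.smul_eq_C_mul]

theorem symAct_linForm (g : GL (Fin n) F) (v : Fin n → F) :
    symAct g (linForm v) = linForm ((g : Matrix (Fin n) (Fin n) F).mulVec v) := by
  rw [linForm, map_sum, linForm]
  simp only [map_smul, symAct_X, Finset.smul_sum, Matrix.mulVec, dotProduct, Finset.sum_smul,
    smul_smul]
  rw [Finset.sum_comm]
  simp only [mul_comm]

theorem symExtAct_tmul (g : GL (Fin n) F) (s : MvPolynomial (Fin n) F)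
    (y : ExteriorAlgebra F (Fin n → F)) :
    symExtAct g (s ⊗ₜ[F] y) = symAct g s ⊗ₜ[F] extAct g y :=
  Algebra.TensorProduct.map_tmul _ _ _ _

theorem symExtAct_smul (g : GL (Fin n) F) (s : MvPolynomial (Fin n) F) (z : SymExt F n) :
    symExtAct g (s • z) = symAct g s • symExtAct g z := by
  have key : ∀ (t : MvPolynomial (Fin n) F) (w : SymExt F n), t • w = (t ⊗ₜ[F] 1) * w :=
    fun t w => (Algebra.smul_def (A := SymExt F n) t w)
  rw [key, key, map_mul, symExtAct_tmul, map_one]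

theorem extAct_ι_single (g : GL (Fin n) F) (c : Fin n) :
    extAct g (ExteriorAlgebra.ι F (Pi.single c 1)) =
      ∑ k, g k c • ExteriorAlgebra.ι F (Pi.single k 1 : Fin n → F) := by
  rw [extAct, ExteriorAlgebra.map_apply_ι]
  simp only [← map_smul, ← map_sum]
  congr 1
  funext a
  rw [Matrix.toLin'_apply, Matrix.mulVec_single_one, Finset.sum_apply, Finset.sum_eq_single a]
  · simp
  · intro b _ hb
    simp [hb.symm]
  · simp

theorem smul_left_cancel_symExt {s : MvPolynomial (Fin n) F} (hs : s ≠ 0) {z w : SymExt F n}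
    (h : s • z = s • w) : z = w := by
  refine (symExtBasis F n).repr.injective (Finsupp.ext fun C => mul_left_cancel₀ hs ?_)
  have := DFunLike.congr_fun (congrArg (symExtBasis F n).repr h) C
  simpa using this

/-- The top coordinate of an element changes by the determinant. -/
theorem coord_univ_symExtAct (g : GL (Fin n) F) (z : SymExt F n) :
    (symExtBasis F n).repr (symExtAct g z) Finset.univ =
      (g : Matrix (Fin n) (Fin n) F).det • symAct g ((symExtBasis F n).repr z Finset.univ) := by
  have hC : ∀ C, (symExtBasis F n).repr (symExtAct g (symExtBasis F n C)) Finset.univ =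
      algebraMap F _ (topCoord F n (extAct g (stdExtBasis F n C))) := by
    intro C
    rw [symExtBasis_apply, symExtAct_tmul, map_one, symExtBasis, Basis.baseChange_repr_tmul,
      ← Algebra.algebraMap_eq_smul_one]
    rfl
  conv_lhs => rw [← (symExtBasis F n).sum_repr z]
  rw [map_sum, map_sum, Finsupp.finsetSum_apply, Finset.sum_eq_single Finset.univ]
  · rw [symExtAct_smul, map_smul, Finsupp.smul_apply, hC,
      extBasis_apply_of_card _ (j := n) (by simp), extAct,
      ExteriorAlgebra.map_apply_ιMulti, topCoord_ιMulti]
    have hemb : (Finset.univ : Finset (Fin n)).orderEmbOfFin (by simp) = RelEmbedding.refl _ := by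
      symm
      exact Finset.orderEmbOfFin_unique' _ (by simp)
    have : (Matrix.of ((Matrix.toLin' (g : Matrix (Fin n) (Fin n) F)) ∘
        (Pi.basisFun F (Fin n) ∘ (Finset.univ : Finset (Fin n)).orderEmbOfFin (by simp)))) =
        (g : Matrix (Fin n) (Fin n) F).transpose := by
      rw [hemb]
      refine Matrix.ext fun i j => ?_
      simp
    rw [this, Matrix.det_transpose, smul_eq_mul, Algebra.smul_def, mul_comm]
  · intro C _ hne
    rw [symExtAct_smul, map_smul, Finsupp.smul_apply, hC, extBasis_apply, extAct,
      ExteriorAlgebra.map_apply_ιMulti, topCoord_ιMulti_of_ne, map_zero, smul_zero]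
    intro h
    exact hne (by rw [← Finset.card_eq_iff_eq_univ]; simpa using h)
  · simp

variable (n) in
/-- The part of a matrix which acts on the first `m` coordinates, completed by an identity
matrix. -/
def flagMat (m : ℕ) (g : Matrix (Fin n) (Fin n) F) : Matrix (Fin n) (Fin n) F :=
  Matrix.of fun k c => if (k : ℕ) < m ∧ (c : ℕ) < m then g k c else if k = c then 1 else 0

/-- The matrix maps the span of the first `m` coordinate vectors to itself. -/
def PreservesFlag (m : ℕ) (g : Matrix (Fin n) (Fin n) F) : Prop :=
  ∀ k c : Fin n, (c : ℕ) < m → m ≤ k → g k c = 0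

theorem det_flagMat_ne_zero {m : ℕ} (g : GL (Fin n) F)
    (hg : PreservesFlag m (g : Matrix (Fin n) (Fin n) F)) :
    (flagMat n m (g : Matrix (Fin n) (Fin n) F)).det ≠ 0 := by
  set A := (g : Matrix (Fin n) (Fin n) F) with hA
  have h1 : A.det ≠ 0 := ((Matrix.isUnit_iff_isUnit_det A).1 g.isUnit).ne_zero
  rw [Matrix.twoBlockTriangular_det A (fun i : Fin n => (i : ℕ) < m)
    fun k hk c hc => hg k c hc (not_lt.1 hk)] at h1
  have h2 : (flagMat n m A).toSquareBlockProp (fun i : Fin n => (i : ℕ) < m) =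
      A.toSquareBlockProp (fun i : Fin n => (i : ℕ) < m) := by
    refine Matrix.ext fun k c => ?_
    exact if_pos ⟨k.2, c.2⟩
  have h3 : (flagMat n m A).toSquareBlockProp (fun i : Fin n => ¬ (i : ℕ) < m) = 1 := by
    refine Matrix.ext fun k c => ?_
    refine (if_neg fun h => k.2 h.1).trans ?_
    rw [Matrix.one_apply]
    simp only [Subtype.ext_iff]
  rw [Matrix.twoBlockTriangular_det (flagMat n m A) (fun i : Fin n => (i : ℕ) < m), h2, h3,
    Matrix.det_one, mul_one]
  · exact left_ne_zero_of_mul h1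
  · intro k hk c hc
    refine (if_neg fun h => hk h.1).trans (if_neg ?_)
    rintro rfl
    exact hk hc

theorem flagMat_self (g : Matrix (Fin n) (Fin n) F) : flagMat n n g = g := by
  refine Matrix.ext fun k c => ?_
  simp [flagMat]

variable [Fintype F]

/-- An element that preserves the span of `x_1, …, x_m` acts on the Moore matrix of these variables
by right multiplication with a matrix over `F`, as the `q`-power map is linear. -/
theorem map_symAct_mooreMat {m : ℕ} (g : GL (Fin n) F)
    (hg : PreservesFlag m (g : Matrix (Fin n) (Fin n) F)) :
    (mooreMat F n m).map (symAct g) =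
      mooreMat F n m * (flagMat n m (g : Matrix (Fin n) (Fin n) F)).map (algebraMap F _) := by
  refine Matrix.ext fun b c => ?_
  rw [Matrix.map_apply, Matrix.mul_apply]
  by_cases hb : (b : ℕ) < m
  · by_cases hc : (c : ℕ) < m
    · rw [mooreMat_apply_of_lt hb hc, map_pow, symAct_X, sum_smul_pow_card_pow]
      refine Finset.sum_congr rfl fun k _ => ?_
      by_cases hk : (k : ℕ) < m
      · rw [mooreMat_apply_of_lt hb hk, Algebra.smul_def, mul_comm]
        rw [Matrix.map_apply, flagMat, Matrix.of_apply, if_pos ⟨hk, hc⟩]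
      · have h1 : b ≠ k := by
          rintro rfl
          exact hk hb
        rw [mooreMat_apply_of_le_right b (not_lt.1 hk), if_neg h1, zero_mul,
          hg k c hc (not_lt.1 hk), zero_smul]
    · have h1 : b ≠ c := by
        rintro rfl
        exact hc hb
      rw [mooreMat_apply_of_le_right b (not_lt.1 hc), if_neg h1, map_zero, Finset.sum_eq_zero]
      intro k _
      rw [Matrix.map_apply, flagMat, Matrix.of_apply, if_neg fun h => hc h.2]
      split_ifs with h
      · subst h
        rw [mooreMat_apply_of_le_right b (not_lt.1 hc), if_neg h1, zero_mul]
      · rw [map_zero, mul_zero]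
  · rw [mooreMat_apply_of_le_left (not_lt.1 hb), Finset.sum_eq_single b]
    · rw [mooreMat_apply_of_le_left (not_lt.1 hb), if_pos rfl, one_mul, Matrix.map_apply, flagMat,
        Matrix.of_apply, if_neg fun h : (b : ℕ) < m ∧ (c : ℕ) < m => hb h.1]
      split_ifs <;> simp
    · intro k _ hk
      rw [mooreMat_apply_of_le_left (not_lt.1 hb), if_neg hk.symm, zero_mul]
    · simp

theorem symAct_flagProd {m : ℕ} (hm : m ≤ n) (g : GL (Fin n) F)
    (hg : PreservesFlag m (g : Matrix (Fin n) (Fin n) F)) :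
    symAct g (flagProd F n m) =
      (flagMat n m (g : Matrix (Fin n) (Fin n) F)).det • flagProd F n m := by
  have h1 : symAct g (mooreMat F n m).det = ((mooreMat F n m).map (symAct g)).det :=
    (symAct g).toRingHom.map_det _
  have h2 : ((flagMat n m (g : Matrix (Fin n) (Fin n) F)).map
      (algebraMap F (MvPolynomial (Fin n) F))).det =
      algebraMap F _ (flagMat n m (g : Matrix (Fin n) (Fin n) F)).det :=
    ((algebraMap F (MvPolynomial (Fin n) F)).map_det _).symm
  rw [← det_mooreMat hm, h1, map_symAct_mooreMat g hg, Matrix.det_mul, h2, Algebra.smul_def,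
    mul_comm]

variable (F) in
/-- The columns of the adjugate of the Moore matrix of `x_1, …, x_m`. -/
noncomputable def adjVec (m : ℕ) (b : Fin n) : Fin n → MvPolynomial (Fin n) F :=
  fun c => (mooreMat F n m).adjugate c b

theorem adjVec_eq_zero {m : ℕ} {b c : Fin n} (hb : (b : ℕ) < m) (hc : m ≤ c) :
    adjVec F m b c = 0 := by
  have h := congrFun (congrFun (Matrix.mul_adjugate (mooreMat F n m)) c) b
  have hcb : c ≠ b := by
    rintro rfl
    omega
  rw [Matrix.mul_apply, Matrix.smul_apply, Matrix.one_apply, if_neg hcb, smul_zero,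
    Finset.sum_eq_single c] at h
  · rw [mooreMat_apply_of_le_left hc, if_pos rfl, one_mul] at h
    exact h
  · intro k _ hk
    rw [mooreMat_apply_of_le_left hc, if_neg hk.symm, zero_mul]
  · simp

/-- The entries of the adjugate outside the row at `c` are minors which involve the column of
powers of `x_c`. -/
theorem X_dvd_adjVec {m : ℕ} {b c c' : Fin n} (hc : (c : ℕ) < m) (hne : c' ≠ c) :
    MvPolynomial.X c ∣ adjVec F m b c' := by
  rw [adjVec, Matrix.adjugate_apply]
  refine Matrix.dvd_det_of_dvd_column _ _ c fun k => ?_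
  rw [Matrix.updateRow_apply]
  split_ifs
  · rw [Pi.single_eq_of_ne hne.symm]
    exact dvd_zero _
  · by_cases hk : (k : ℕ) < m
    · rw [mooreMat_apply_of_lt hk hc]
      exact dvd_pow_self _ (pow_pos Fintype.card_pos _).ne'
    · rw [mooreMat_apply_of_le_left (not_lt.1 hk), if_neg]
      · exact dvd_zero _
      · rintro rfl
        exact hk hc

/-- The adjugate is multiplied by the adjugate of a matrix over `F`, and the action on the `y_c`
multiplies by the matrix itself; only the determinant remains. -/
theorem symExtAct_oneForm_adjVec {m : ℕ} (g : GL (Fin n) F)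
    (hg : PreservesFlag m (g : Matrix (Fin n) (Fin n) F)) {b : Fin n} (hb : (b : ℕ) < m) :
    symExtAct g (oneForm (adjVec F m b)) =
      (flagMat n m (g : Matrix (Fin n) (Fin n) F)).det • oneForm (adjVec F m b) := by
  set G := (flagMat n m (g : Matrix (Fin n) (Fin n) F)).map
    (algebraMap F (MvPolynomial (Fin n) F)) with hG
  have hdet : G.det = algebraMap F _ (flagMat n m (g : Matrix (Fin n) (Fin n) F)).det :=
    ((algebraMap F (MvPolynomial (Fin n) F)).map_det _).symm
  have hadj : ((mooreMat F n m).adjugate).map (symAct g) =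
      G.adjugate * (mooreMat F n m).adjugate := by
    rw [← Matrix.adjugate_mul_distrib, ← map_symAct_mooreMat g hg]
    exact (symAct g).toRingHom.map_adjugate _
  have h0 : ∀ c : Fin n, m ≤ c → symAct g (adjVec F m b c) = 0 := by
    intro c hc
    rw [adjVec_eq_zero hb hc, map_zero]
  have h1 : ∀ k, ∑ c, symAct g (adjVec F m b c) * algebraMap F _ (g k c) =
      algebraMap F _ (flagMat n m (g : Matrix (Fin n) (Fin n) F)).det * adjVec F m b k := by
    intro k
    have h2 : ∑ c, symAct g (adjVec F m b c) * algebraMap F _ (g k c) =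
        (G * ((mooreMat F n m).adjugate).map (symAct g)) k b := by
      rw [Matrix.mul_apply]
      refine Finset.sum_congr rfl fun c _ => ?_
      rw [mul_comm]
      by_cases hc : (c : ℕ) < m
      · congr 1
        rw [hG, Matrix.map_apply]
        congr 1
        by_cases hk : (k : ℕ) < m
        · exact (if_pos ⟨hk, hc⟩).symm
        · refine (hg k c hc (not_lt.1 hk)).trans (Eq.symm ?_)
          refine (if_neg fun h => hk h.1).trans (if_neg ?_)
          rintro rfl
          exact hk hc
      · rw [h0 c (not_lt.1 hc), mul_zero, Matrix.map_apply]
        have := h0 c (not_lt.1 hc)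
        rw [adjVec] at this
        rw [this, mul_zero]
    rw [h2, hadj, ← Matrix.mul_assoc, Matrix.mul_adjugate, Matrix.smul_mul, Matrix.one_mul,
      Matrix.smul_apply, smul_eq_mul, hdet]
    rfl
  have h3 : symExtAct g (oneForm (adjVec F m b)) =
      ∑ k, (∑ c, symAct g (adjVec F m b c) * algebraMap F _ (g k c)) ⊗ₜ[F]
        ExteriorAlgebra.ι F (Pi.single k 1 : Fin n → F) := by
    rw [oneForm, map_sum]
    simp only [symExtAct_tmul, extAct_ι_single, TensorProduct.tmul_sum, TensorProduct.sum_tmul]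
    rw [Finset.sum_comm]
    refine Finset.sum_congr rfl fun k _ => Finset.sum_congr rfl fun c _ => ?_
    rw [← TensorProduct.smul_tmul, Algebra.smul_def, mul_comm]
  rw [h3, oneForm, Finset.smul_sum]
  refine Finset.sum_congr rfl fun k _ => ?_
  rw [h1, ← Algebra.smul_def, TensorProduct.smul_tmul']

end Action

/-! ### Products of one-forms -/

section FormProd

open Module

theorem List.prod_ofFn_smul {R A : Type*} [CommSemiring R] [Semiring A] [Algebra R A] {j : ℕ}
    (d : Fin j → R) (a : Fin j → A) :
    (List.ofFn fun i => d i • a i).prod = (∏ i, d i) • (List.ofFn a).prod := by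
  induction j with
  | zero => simp
  | succ j ih =>
    rw [List.ofFn_succ, List.prod_cons, ih, List.ofFn_succ, List.prod_cons, Fin.prod_univ_succ,
      smul_mul_smul_comm]

@[to_additive]
theorem Finset.prod_orderEmbOfFin {ι M : Type*} [LinearOrder ι] [CommMonoid M] (C : Finset ι)
    (d : ι → M) : ∏ i, d (C.orderEmbOfFin rfl i) = ∏ b ∈ C, d b := by
  have h : C = Finset.univ.map (C.orderEmbOfFin rfl).toEmbedding := by
    rw [Finset.map_orderEmbOfFin_univ]
  conv_rhs => rw [h, Finset.prod_map]
  rfl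

variable {F : Type*} [Field F] {n : ℕ}

/-- The product of the one-forms `w b`, `b ∈ C`, in increasing order. -/
noncomputable def formProd (w : Fin n → Fin n → MvPolynomial (Fin n) F) (C : Finset (Fin n)) :
    SymExt F n :=
  (List.ofFn fun i => oneForm (w (C.orderEmbOfFin rfl i))).prod

theorem symExtAct_formProd (g : GL (Fin n) F) (w : Fin n → Fin n → MvPolynomial (Fin n) F)
    (C : Finset (Fin n)) (d : Fin n → F)
    (h : ∀ b ∈ C, symExtAct g (oneForm (w b)) = d b • oneForm (w b)) :
    symExtAct g (formProd w C) = (∏ b ∈ C, d b) • formProd w C := by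
  rw [formProd, map_list_prod, List.map_ofFn, ← Finset.prod_orderEmbOfFin, ← List.prod_ofFn_smul]
  congr 2
  funext i
  exact h _ (C.orderEmbOfFin_mem rfl i)

variable (K : Type*) [Field K] [Algebra (MvPolynomial (Fin n) F) K] [Algebra F K]
  [IsScalarTower F (MvPolynomial (Fin n) F) K]

theorem extMap_formProd (w : Fin n → Fin n → MvPolynomial (Fin n) F) (C : Finset (Fin n)) :
    extMap F K (formProd w C) = ExteriorAlgebra.ιMulti K C.card
      fun i c => algebraMap _ K (w (C.orderEmbOfFin rfl i) c) := by
  rw [formProd, map_list_prod, List.map_ofFn, ExteriorAlgebra.ιMulti_apply]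
  congr 2
  funext i
  exact extMap_oneForm K _

theorem extMap_formProd_eq_smul (w : Fin n → Fin n → MvPolynomial (Fin n) F)
    (C : Finset (Fin n)) (U : Basis (Fin n) K (Fin n → K)) (d : Fin n → MvPolynomial (Fin n) F)
    (h : ∀ b ∈ C, (fun c => algebraMap _ K (w b c)) = algebraMap _ K (d b) • U b) :
    extMap F K (formProd w C) = algebraMap _ K (∏ b ∈ C, d b) • U.ExteriorAlgebra C := by
  rw [extMap_formProd, extBasis_apply, ← Finset.prod_orderEmbOfFin, map_prod]
  refine Eq.trans ?_ ((ExteriorAlgebra.ιMulti K C.card).toMultilinearMap.map_smul_univ _ _)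
  refine congrArg (ExteriorAlgebra.ιMulti K C.card) (funext fun i => ?_)
  exact h _ (C.orderEmbOfFin_mem rfl i)

/-- The coordinate at the top of the product of a monomial and a product of one-forms. -/
theorem repr_mul_formProd_eq_det [IsFractionRing (MvPolynomial (Fin n) F) K]
    (w : Fin n → Fin n → MvPolynomial (Fin n) F)
    {D C : Finset (Fin n)} (h : D.card + C.card = n) :
    (symExtBasis F n).repr (symExtBasis F n D * formProd w C) Finset.univ =
      (Matrix.of fun (i : Fin n) c =>
        (Fin.append (fun i => Pi.single (D.orderEmbOfFin rfl i) 1)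
          (fun i => w (C.orderEmbOfFin rfl i)) : Fin (D.card + C.card) → _) (Fin.cast h.symm i)
          c).det := by
  apply IsFractionRing.injective (MvPolynomial (Fin n) F) K
  rw [← repr_extMap, map_mul, extMap_symExtBasis, extMap_formProd, extBasis_apply,
    ExteriorAlgebra.ιMulti_mul_ιMulti, RingHom.map_det]
  have hcast : ∀ {k : ℕ} (hk : k = n) (v : Fin k → Fin n → K),
      ExteriorAlgebra.ιMulti K k v =
        ExteriorAlgebra.ιMulti K n fun i => v (Fin.cast hk.symm i) := by
    rintro k rfl v
    rfl
  rw [hcast h]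
  refine (topCoord_ιMulti _).trans ?_
  congr 1
  refine Matrix.ext fun i c => ?_
  rw [Matrix.of_apply, RingHom.mapMatrix_apply, Matrix.map_apply, Matrix.of_apply]
  refine Fin.addCases (fun a => ?_) (fun a => ?_) (Fin.cast h.symm i)
  · rw [Fin.append_left, Fin.append_left, Function.comp, Pi.basisFun_apply, Pi.single_apply,
      Pi.single_apply]
    split_ifs <;> simp
  · rw [Fin.append_right, Fin.append_right]

theorem repr_mul_formProd_eq_zero [IsFractionRing (MvPolynomial (Fin n) F) K]
    (w : Fin n → Fin n → MvPolynomial (Fin n) F)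
    {D C : Finset (Fin n)} (h : D.card + C.card ≠ n) :
    (symExtBasis F n).repr (symExtBasis F n D * formProd w C) Finset.univ = 0 := by
  apply IsFractionRing.injective (MvPolynomial (Fin n) F) K
  rw [← repr_extMap, map_mul, extMap_symExtBasis, extMap_formProd, extBasis_apply,
    ExteriorAlgebra.ιMulti_mul_ιMulti, map_zero]
  exact topCoord_ιMulti_of_ne h _

end FormProd

section Mui

open Module

variable {F : Type*} [Field F] [Fintype F] {n : ℕ}
variable (K : Type*) [Field K] [Algebra (MvPolynomial (Fin n) F) K]

/-- The adjugate columns are multiples of the columns of the inverse. -/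
theorem algebraMap_adjVec [IsFractionRing (MvPolynomial (Fin n) F) K] {m : ℕ} (hm : m ≤ n)
    (b : Fin n) : (fun c => algebraMap _ K (adjVec F m b c)) =
      algebraMap _ K (flagProd F n m) • invVec F K m b := by
  have hu := isUnit_det_map_mooreMat F K hm
  funext c
  have h1 : ((mooreMat F n m).map (algebraMap _ K)).adjugate =
      ((mooreMat F n m).adjugate).map (algebraMap _ K) :=
    ((algebraMap (MvPolynomial (Fin n) F) K).map_adjugate _).symm
  rw [Pi.smul_apply, invVec, Matrix.inv_def, h1, Matrix.smul_apply, det_map_mooreMat F K hm,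
    Ring.inverse_eq_inv', smul_smul, mul_inv_cancel₀ (algebraMap_flagProd_ne_zero F K m), one_smul]
  rfl

/-- The elements of the group which preserve the span of `x_1, …, x_m` multiply the Mui elements
for these variables by a determinant. -/
theorem symExtAct_muiInvariant {m : ℕ} (hm : m ≤ n) (g : GL (Fin n) F)
    (hg : PreservesFlag m (g : Matrix (Fin n) (Fin n) F)) (B : Finset (Fin n))
    (hB : ∀ b ∈ B, (b : ℕ) < m) :
    symExtAct g (muiInvariant F hm (B.map Fin.valEmbedding)) =
      (flagMat n m (g : Matrix (Fin n) (Fin n) F)).det •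
        muiInvariant F hm (B.map Fin.valEmbedding) := by
  let K := FractionRing (MvPolynomial (Fin n) F)
  set M := muiInvariant F hm (B.map Fin.valEmbedding) with hM
  set L := flagProd F n m with hL
  set δ := (flagMat n m (g : Matrix (Fin n) (Fin n) F)).det with hδ
  have hδ0 : δ ≠ 0 := det_flagMat_ne_zero g hg
  have hL0 : L ≠ 0 := flagProd_ne_zero m
  obtain ⟨U, hU⟩ := exists_basis_invVec F K hm
  obtain ⟨ε, hε⟩ := exists_extMap_muiInvariant K hm U hU B hB
  have hN := extMap_formProd_eq_smul K (adjVec F m) B U (fun _ => L)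
    (fun b _ => by rw [algebraMap_adjVec K hm, hU])
  -- the Mui element is a product of the semi-invariant one-forms, up to powers of `L`
  have hrel : L • formProd (adjVec F m) B = ε • (∏ _b ∈ B, L) • M := by
    apply extMap_injective K
    rw [map_smul, hN, Units.smul_def, map_zsmul, map_smul, hε, ← Units.smul_def,
      ← algebraMap_smul K L, ← algebraMap_smul K (∏ _b ∈ B, L),
      smul_comm ε ((algebraMap (MvPolynomial (Fin n) F) K) (∏ _b ∈ B, L)), smul_smul ε ε,
      Int.units_mul_self, one_smul, smul_comm]
  have hNg : symExtAct g (formProd (adjVec F m) B) =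
      (∏ _b ∈ B, δ) • formProd (adjVec F m) B :=
    symExtAct_formProd g _ B (fun _ => δ) fun b hb => symExtAct_oneForm_adjVec g hg (hB b hb)
  have h1 := congrArg (symExtAct g) hrel
  have hLg : symAct g L = δ • L := symAct_flagProd hm g hg
  rw [symExtAct_smul, hNg, hLg, Units.smul_def, map_zsmul, symExtAct_smul, map_prod,
    ← Units.smul_def] at h1
  simp only [hLg, Finset.prod_const, smul_pow] at h1
  simp only [Finset.prod_const] at hrel
  have hcomm : ∀ (d : F) (z : SymExt F n), d • ε • z = ε • d • z := by
    intro d z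
    rcases Int.units_eq_one_or ε with h | h <;> simp [h]
  have h2 : δ ^ B.card • δ • L • formProd (adjVec F m) B =
      δ ^ B.card • ε • L ^ B.card • symExtAct g M := by
    rw [hcomm, ← smul_assoc (δ ^ B.card) (L ^ B.card), ← h1, smul_assoc δ L,
      smul_comm L (δ ^ B.card), smul_comm δ (δ ^ B.card)]
  have h3 := smul_right_injective (SymExt F n) (pow_ne_zero _ hδ0) h2
  rw [hrel, hcomm] at h3
  have h4 := smul_left_cancel ε h3
  rw [smul_comm δ] at h4
  exact (smul_left_cancel_symExt (pow_ne_zero _ hL0) h4).symm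

end Mui

/-! ### Elements of the parabolic subgroup -/

section Parabolic

open Module

variable {F : Type*} [Field F] {n : ℕ} {I : Composition n}

/-- Elements of the parabolic subgroup preserve the span of the variables of the first `i`
blocks. -/
theorem preservesFlag_of_mem_parabolic {g : GL (Fin n) F} (hg : g ∈ parabolic (F := F) I) (i : ℕ) :
    PreservesFlag (I.sizeUpTo i) (g : Matrix (Fin n) (Fin n) F) := by
  intro k c hc hk
  refine hg (show I.index c < I.index k from ?_)
  have h1 : (I.index c : ℕ) < i := by
    by_contra! h
    have := I.monotone_sizeUpTo h
    have := I.sizeUpTo_index_le c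
    omega
  have h2 : i ≤ (I.index k : ℕ) := by
    by_contra! h
    have h3 := I.monotone_sizeUpTo (show (I.index k : ℕ) + 1 ≤ i from h)
    have h4 : (k : ℕ) < I.sizeUpTo ((I.index k : ℕ) + 1) := lt_blockEnd I k
    omega
  exact Fin.lt_def.2 (by omega)

theorem preservesFlag_blockEnd {g : GL (Fin n) F} (hg : g ∈ parabolic (F := F) I) (b : Fin n) :
    PreservesFlag (blockEnd I b) (g : Matrix (Fin n) (Fin n) F) :=
  preservesFlag_of_mem_parabolic hg (I.index b + 1)

/-- The unipotent matrix whose column at `c` has the entries `leadVec c l`. -/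
noncomputable def leadUnipotent (c : Fin n) (l : Fin (c : ℕ) → F) : Matrix (Fin n) (Fin n) F :=
  Matrix.of fun a b => if b = c then leadVec c l a else if a = b then 1 else 0

theorem leadUnipotent_of_lt (c : Fin n) (l : Fin (c : ℕ) → F) {a b : Fin n} (h : b < a) :
    leadUnipotent c l a b = 0 := by
  rw [leadUnipotent, Matrix.of_apply]
  split_ifs with h1 h2
  · subst h1
    exact leadVec_of_lt l h
  · exact absurd h2 h.ne'
  · rfl

theorem leadUnipotent_self (c : Fin n) (l : Fin (c : ℕ) → F) (a : Fin n) :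
    leadUnipotent c l a a = 1 := by
  rw [leadUnipotent, Matrix.of_apply]
  by_cases h1 : a = c
  · subst h1
    rw [if_pos rfl]
    exact leadVec_self a l
  · rw [if_neg h1, if_pos rfl]

theorem det_leadUnipotent (c : Fin n) (l : Fin (c : ℕ) → F) : (leadUnipotent c l).det = 1 := by
  rw [Matrix.det_of_isUpperTriangular, Finset.prod_eq_one]
  · exact fun a _ => leadUnipotent_self c l a
  · exact fun a b h => leadUnipotent_of_lt c l h

theorem det_flagMat_leadUnipotent (m : ℕ) (c : Fin n) (l : Fin (c : ℕ) → F) :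
    (flagMat n m (leadUnipotent c l)).det = 1 := by
  rw [Matrix.det_of_isUpperTriangular, Finset.prod_eq_one]
  · intro a _
    rw [flagMat, Matrix.of_apply, if_pos rfl, leadUnipotent_self]
    split_ifs <;> rfl
  · intro a b h
    have h' : b < a := h
    rw [flagMat, Matrix.of_apply, leadUnipotent_of_lt c l h', if_neg h'.ne']
    split_ifs <;> rfl

theorem mem_parabolic_of_upper (I : Composition n) (g : GL (Fin n) F)
    (h : ∀ a b : Fin n, b < a → (g : Matrix (Fin n) (Fin n) F) a b = 0) :
    g ∈ parabolic (F := F) I := by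
  intro a b hab
  apply h
  by_contra! hle
  have h1 := I.sizeUpTo_index_le a
  have h2 : (b : ℕ) < I.sizeUpTo ((I.index b : ℕ) + 1) := lt_blockEnd I b
  have h3 := I.monotone_sizeUpTo (show (I.index b : ℕ) + 1 ≤ I.index a from hab)
  have h4 : (a : ℕ) ≤ b := hle
  omega

/-- Every factor of `leadProd F c` is the image of `x_c` under a unipotent element of the parabolic
subgroup. -/
theorem exists_mem_parabolic_symAct_X (I : Composition n) (c : Fin n) (l : Fin (c : ℕ) → F) :
    ∃ g ∈ parabolic (F := F) I, symAct g (MvPolynomial.X c) = linForm (leadVec c l) ∧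
      (g : Matrix (Fin n) (Fin n) F).det = 1 ∧
      ∀ m, (flagMat n m (g : Matrix (Fin n) (Fin n) F)).det = 1 := by
  let g : GL (Fin n) F := Matrix.GeneralLinearGroup.mkOfDetNeZero (leadUnipotent c l)
    (by rw [det_leadUnipotent]; exact one_ne_zero)
  refine ⟨g, mem_parabolic_of_upper I g fun a b h => leadUnipotent_of_lt c l h, ?_,
    det_leadUnipotent c l, fun m => det_flagMat_leadUnipotent m c l⟩
  rw [← linForm_single, symAct_linForm]
  congr 1
  funext a
  rw [Matrix.mulVec_single_one]
  exact if_pos rfl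

theorem symAct_symAct_inv (g : GL (Fin n) F) (p : MvPolynomial (Fin n) F) :
    symAct g (symAct g⁻¹ p) = p := by
  have : (symAct g).comp (symAct g⁻¹) = AlgHom.id F _ := by
    refine MvPolynomial.algHom_ext fun c => ?_
    rw [AlgHom.comp_apply, ← linForm_single, symAct_linForm, symAct_linForm, Matrix.mulVec_mulVec,
      ← Units.val_mul, mul_inv_cancel, Units.val_one, Matrix.one_mulVec, AlgHom.id_apply]
  exact DFunLike.congr_fun this p

theorem irreducible_linForm_leadVec (c : Fin n) (l : Fin (c : ℕ) → F) :
    Irreducible (linForm (leadVec c l)) := by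
  obtain ⟨g, -, hg, -⟩ := exists_mem_parabolic_symAct_X (Composition.ones n) c l
  let e : MvPolynomial (Fin n) F ≃* MvPolynomial (Fin n) F :=
    { toFun := symAct g
      invFun := symAct g⁻¹
      left_inv := fun p => by simpa using symAct_symAct_inv g⁻¹ p
      right_inv := symAct_symAct_inv g
      map_mul' := map_mul _ }
  rw [← hg]
  exact (MulEquiv.irreducible_iff e).2 (MvPolynomial.X_prime).irreducible

/-- Distinct linear forms with last nonzero coefficient `1` are relatively prime, so that
divisibility by their powers may be checked for each of them separately. -/
theorem prod_linForm_pow_dvd {p : MvPolynomial (Fin n) F} [Fintype F] (e : Fin n → ℕ)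
    (h : ∀ c l, linForm (leadVec c l) ^ e c ∣ p) : ∏ c, leadProd F c ^ e c ∣ p := by
  simp only [leadProd_eq_prod_linForm, ← Finset.prod_pow]
  rw [← Fintype.prod_sigma (fun x : Σ c : Fin n, Fin (c : ℕ) → F =>
    linForm (leadVec x.1 x.2) ^ e x.1)]
  refine Fintype.prod_dvd_of_isRelPrime (fun x y hxy => ?_) fun x => h _ _
  apply IsRelPrime.pow
  rw [(irreducible_linForm_leadVec x.1 x.2).isRelPrime_iff_not_dvd]
  exact fun hd => hxy (eq_of_linForm_dvd hd)

end Parabolic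

/-! ### Local conditions on the coefficients of an invariant -/

section Local

open Module

variable {F : Type*} [Field F] {n : ℕ}

theorem X_pow_dvd_of_le {p : MvPolynomial (Fin n) F} {c : Fin n} {e : ℕ}
    (h : ∀ m ∈ p.support, e ≤ m c) : MvPolynomial.X c ^ e ∣ p := by
  rw [p.as_sum]
  refine Finset.dvd_sum fun m hm => ?_
  have : m = Finsupp.single c e + (m - Finsupp.single c e) := by
    rw [add_tsub_cancel_of_le]
    exact Finsupp.single_le_iff.2 (h m hm)
  rw [this, ← one_mul (MvPolynomial.coeff _ _), ← MvPolynomial.monomial_mul,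
    MvPolynomial.X_pow_eq_monomial]
  exact dvd_mul_right _ _

theorem ne_zero_of_X_dvd {p : MvPolynomial (Fin n) F} {c : Fin n} (h : MvPolynomial.X c ∣ p) :
    ∀ m ∈ p.support, m c ≠ 0 := by
  obtain ⟨p, rfl⟩ := h
  intro m hm h0
  rw [MvPolynomial.mem_support_iff, MvPolynomial.coeff_X_mul', if_neg] at hm
  · exact hm rfl
  · simpa using h0

/-- The diagonal matrix with entry `z` at the place `c` and `1` elsewhere. -/
noncomputable def torusElt (c : Fin n) (z : Fˣ) : GL (Fin n) F :=
  Matrix.GeneralLinearGroup.mkOfDetNeZero (Matrix.diagonal fun a => if a = c then (z : F) else 1)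
    (by rw [Matrix.det_diagonal, Finset.prod_ite_eq' Finset.univ c (fun _ => (z : F))]; simp)

theorem coe_torusElt (c : Fin n) (z : Fˣ) : (torusElt c z : Matrix (Fin n) (Fin n) F) =
    Matrix.diagonal fun a => if a = c then (z : F) else 1 := rfl

theorem det_torusElt (c : Fin n) (z : Fˣ) :
    (torusElt c z : Matrix (Fin n) (Fin n) F).det = z := by
  rw [coe_torusElt, Matrix.det_diagonal, Finset.prod_ite_eq' Finset.univ c (fun _ => (z : F))]
  simp

theorem symAct_torusElt_monomial (c : Fin n) (z : Fˣ) (m : Fin n →₀ ℕ) (a : F) :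
    symAct (torusElt c z) (MvPolynomial.monomial m a) =
      MvPolynomial.monomial m ((z : F) ^ m c * a) := by
  have hX : ∀ b, symAct (torusElt c z) (MvPolynomial.X b) =
      MvPolynomial.C (if b = c then (z : F) else 1) * MvPolynomial.X b := by
    intro b
    rw [symAct_X, Finset.sum_eq_single b]
    · rw [coe_torusElt, Matrix.diagonal_apply_eq, MvPolynomial.smul_eq_C_mul]
    · intro k _ hk
      rw [coe_torusElt, Matrix.diagonal_apply_ne _ hk, zero_smul]
    · simp
  rw [MvPolynomial.monomial_eq, map_mul, Finsupp.prod_fintype _ _ (by simp), map_prod]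
  simp only [map_pow, hX, mul_pow, Finset.prod_mul_distrib, ← MvPolynomial.C_pow, ite_pow, one_pow]
  rw [← map_prod, Finset.prod_ite_eq' Finset.univ c (fun b => (z : F) ^ m b),
    if_pos (Finset.mem_univ c), MvPolynomial.monomial_eq, Finsupp.prod_fintype _ _ (by simp),
    MvPolynomial.C_mul, ← mul_assoc]
  congr 1
  rw [mul_comm]
  congr 1
  exact AlgHom.commutes _ _

theorem coeff_symAct_torusElt (c : Fin n) (z : Fˣ) (p : MvPolynomial (Fin n) F)
    (m : Fin n →₀ ℕ) :
    (symAct (torusElt c z) p).coeff m = (z : F) ^ m c * p.coeff m := by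
  induction p using MvPolynomial.induction_on' with
  | monomial m' a =>
    rw [symAct_torusElt_monomial, MvPolynomial.coeff_monomial, MvPolynomial.coeff_monomial]
    split_ifs with h
    · rw [h]
    · simp
  | add p p' h h' =>
    rw [map_add, MvPolynomial.coeff_add, MvPolynomial.coeff_add, h, h', mul_add]

theorem extAct_torusElt (c : Fin n) (z : Fˣ) (D : Finset (Fin n)) :
    extAct (torusElt c z) (stdExtBasis F n D) =
      (if c ∈ D then (z : F) else 1) • stdExtBasis F n D := by
  have h : ∏ b ∈ D, (if b = c then (z : F) else 1) = if c ∈ D then (z : F) else 1 :=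
    Finset.prod_ite_eq' D c fun _ => (z : F)
  rw [extBasis_apply, extAct, ExteriorAlgebra.map_apply_ιMulti, ← h, ← Finset.prod_orderEmbOfFin]
  refine Eq.trans ?_ ((ExteriorAlgebra.ιMulti F D.card).toMultilinearMap.map_smul_univ _ _)
  refine congrArg (ExteriorAlgebra.ιMulti F D.card) (funext fun i => ?_)
  simp only [Function.comp, Pi.basisFun_apply, Matrix.toLin'_apply, coe_torusElt,
    Matrix.mulVec_single_one]
  funext a
  by_cases ha : a = D.orderEmbOfFin rfl i
  · subst ha
    simp
  · simp [ha]

theorem sum_repr_smul_symExtAct (g : GL (Fin n) F) (f : SymExt F n) :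
    symExtAct g f =
      ∑ C, symAct g ((symExtBasis F n).repr f C) • symExtAct g (symExtBasis F n C) := by
  conv_lhs => rw [← (symExtBasis F n).sum_repr f]
  rw [map_sum]
  simp only [symExtAct_smul]

variable [Fintype F] {I : Composition n}

/-- Invariance under the diagonal matrices restricts the exponents of `x_c` in the coefficients of
an invariant to a residue class modulo `q - 1`. -/
theorem exponent_dvd_of_mem {k : ℕ} {f : SymExt F n}
    (hf : f ∈ twistedInvariants (F := F) (parabolic I) k) (c : Fin n) (D : Finset (Fin n)) :
    ∀ m ∈ ((symExtBasis F n).repr f D).support,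
      Fintype.card F - 1 ∣ k + (if c ∈ D then 1 else 0) + m c := by
  classical
  intro m hm
  obtain ⟨z, hz⟩ := IsCyclic.exists_generator (α := Fˣ)
  have hord : orderOf z = Fintype.card F - 1 := by
    rw [orderOf_eq_card_of_forall_mem_zpowers hz, Nat.card_eq_fintype_card, Fintype.card_units]
  have hmem : torusElt c z ∈ parabolic (F := F) I :=
    mem_parabolic_of_upper I _ fun a b h => by
      rw [coe_torusElt, Matrix.diagonal_apply_ne _ h.ne']
  have h1 := hf _ hmem
  have h2 : ∀ C, symExtAct (torusElt c z) (symExtBasis F n C) =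
      (if c ∈ C then (z : F) else 1) • symExtBasis F n C := by
    intro C
    rw [symExtBasis_apply, symExtAct_tmul, map_one, extAct_torusElt, TensorProduct.tmul_smul]
  rw [sum_repr_smul_symExtAct] at h1
  have h3 := congrArg (fun f => ((symExtBasis F n).repr f D).coeff m) h1
  have h4 : (symExtBasis F n).repr (∑ C, symAct (torusElt c z) ((symExtBasis F n).repr f C) •
      symExtAct (torusElt c z) (symExtBasis F n C)) D =
      MvPolynomial.C (if c ∈ D then (z : F) else 1) *
        symAct (torusElt c z) ((symExtBasis F n).repr f D) := by
    rw [map_sum, Finsupp.finsetSum_apply, Finset.sum_eq_single D]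
    · rw [h2, ← algebraMap_smul (MvPolynomial (Fin n) F) (if c ∈ D then (z : F) else 1), smul_smul,
        map_smul, Finsupp.smul_apply, Basis.repr_self, Finsupp.single_eq_same, smul_eq_mul, mul_one,
        mul_comm]
      rfl
    · intro C _ hC
      rw [h2, ← algebraMap_smul (MvPolynomial (Fin n) F) (if c ∈ C then (z : F) else 1), smul_smul,
        map_smul, Finsupp.smul_apply, Basis.repr_self, Finsupp.single_eq_of_ne hC.symm, smul_zero]
    · simp
  rw [det_torusElt] at h3
  rw [← algebraMap_smul (MvPolynomial (Fin n) F) ((z : F) ^ k), map_smul, Finsupp.smul_apply,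
    smul_eq_mul, MvPolynomial.algebraMap_eq, MvPolynomial.coeff_C_mul, h4,
    MvPolynomial.coeff_C_mul, coeff_symAct_torusElt] at h3
  have h5 : (z : F) ^ (k + (if c ∈ D then 1 else 0) + m c) = 1 := by
    apply mul_right_cancel₀ (MvPolynomial.mem_support_iff.1 hm)
    rw [one_mul, pow_add, pow_add, mul_assoc, mul_assoc]
    refine Eq.trans ?_ h3
    split_ifs <;> simp
  rw [← hord]
  apply orderOf_dvd_of_pow_eq_one
  ext
  simpa using h5

end Local

/-! ### Divisibility of the coefficients of an invariant -/

section Transvection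

open Module

variable {F : Type*} [Field F] {n : ℕ} {I : Composition n}

/-- The elementary matrix which adds `x_c` to `x_d`. -/
noncomputable def transvectionElt (c d : Fin n) (h : c ≠ d) : GL (Fin n) F :=
  Matrix.GeneralLinearGroup.mkOfDetNeZero (Matrix.transvection c d 1)
    (by rw [Matrix.det_transvection_of_ne _ _ h]; exact one_ne_zero)

theorem coe_transvectionElt {c d : Fin n} (h : c ≠ d) :
    (transvectionElt (F := F) c d h : Matrix (Fin n) (Fin n) F) = Matrix.transvection c d 1 := rfl

theorem transvectionElt_mem_parabolic {c d : Fin n} (h : c ≠ d) (hcd : blockStart I c ≤ d) :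
    transvectionElt c d h ∈ parabolic (F := F) I := by
  refine Matrix.BlockTriangular.add Matrix.blockTriangular_one ?_
  intro a b hab
  rw [Matrix.single_apply, if_neg]
  rintro ⟨rfl, rfl⟩
  exact absurd (index_le_index_of_blockStart_le hcd) (not_le.2 hab)

theorem transvection_mulVec_single {c d : Fin n} (b : Fin n) :
    (Matrix.transvection c d (1 : F)).mulVec (Pi.single b 1) =
      Pi.single b 1 + if b = d then Pi.single c 1 else 0 := by
  rw [Matrix.transvection, Matrix.add_mulVec, Matrix.one_mulVec]
  congr 1
  rw [Matrix.mulVec_single_one]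
  funext a
  rw [Matrix.col_apply, Matrix.single_apply]
  by_cases h : b = d
  · subst h
    simp [Pi.single_apply, eq_comm]
  · rw [if_neg h, if_neg (fun h' => h h'.2.symm)]
    rfl

theorem X_dvd_symAct_transvectionElt_sub {c d : Fin n} (h : c ≠ d) (p : MvPolynomial (Fin n) F) :
    MvPolynomial.X c ∣ symAct (transvectionElt c d h) p - p := by
  induction p using MvPolynomial.induction_on with
  | C a =>
    have : symAct (transvectionElt c d h) (MvPolynomial.C a) = MvPolynomial.C a :=
      AlgHom.commutes _ a
    rw [this, sub_self]
    exact dvd_zero _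
  | add p p' hp hp' =>
    rw [map_add, add_sub_add_comm]
    exact dvd_add hp hp'
  | mul_X p b hp =>
    have hb : MvPolynomial.X c ∣ symAct (transvectionElt (F := F) c d h) (MvPolynomial.X b) -
        MvPolynomial.X b := by
      rw [← linForm_single b, symAct_linForm, coe_transvectionElt, transvection_mulVec_single]
      have hadd : ∀ v w : Fin n → F, linForm (v + w) - linForm v = linForm w := by
        intro v w
        simp only [linForm, Pi.add_apply, add_smul, Finset.sum_add_distrib, add_sub_cancel_left]
      rw [hadd]
      split_ifs
      · rw [linForm_single]
      · simp [linForm]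
    rw [map_mul]
    have : symAct (transvectionElt c d h) p * symAct (transvectionElt c d h) (MvPolynomial.X b) -
        p * MvPolynomial.X b = (symAct (transvectionElt c d h) p - p) *
          symAct (transvectionElt c d h) (MvPolynomial.X b) +
          p * (symAct (transvectionElt c d h) (MvPolynomial.X b) - MvPolynomial.X b) := by ring
    rw [this]
    exact dvd_add (hp.mul_right _) (hb.mul_left _)

theorem extAct_transvectionElt_of_notMem {c d : Fin n} (h : c ≠ d) {C : Finset (Fin n)}
    (hd : d ∉ C) : extAct (transvectionElt c d h) (stdExtBasis F n C) = stdExtBasis F n C := by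
  rw [extBasis_apply, extAct, ExteriorAlgebra.map_apply_ιMulti]
  refine congrArg (ExteriorAlgebra.ιMulti F C.card) (funext fun i => ?_)
  simp only [Function.comp, Pi.basisFun_apply, Matrix.toLin'_apply, coe_transvectionElt]
  rw [transvection_mulVec_single, if_neg, add_zero]
  intro h'
  exact hd (h' ▸ C.orderEmbOfFin_mem rfl i)

theorem exists_extAct_transvectionElt {c d : Fin n} (h : c ≠ d) {C : Finset (Fin n)} (hd : d ∈ C) :
    ∃ ε : ℤˣ, extAct (transvectionElt c d h) (stdExtBasis F n C) = stdExtBasis F n C +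
      if c ∈ C then 0 else ε • stdExtBasis F n (insert c (C.erase d)) := by
  obtain ⟨ε, hε⟩ := exists_ι_mul_extBasis (Pi.basisFun F (Fin n)) (Finset.notMem_erase d C)
  rw [Finset.insert_erase hd, Pi.basisFun_apply] at hε
  have hC : stdExtBasis F n C =
      ε • (ExteriorAlgebra.ι F (Pi.single d 1) * stdExtBasis F n (C.erase d)) := by
    rw [hε, smul_smul, Int.units_mul_self, one_smul]
  have hg : extAct (transvectionElt c d h) (stdExtBasis F n C) = stdExtBasis F n C +
      ε • (ExteriorAlgebra.ι F (Pi.single c 1) * stdExtBasis F n (C.erase d)) := by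
    rw [hC, Units.smul_def, map_zsmul, map_mul,
      extAct_transvectionElt_of_notMem h (Finset.notMem_erase d C), extAct,
      ExteriorAlgebra.map_apply_ι, Matrix.toLin'_apply, coe_transvectionElt,
      transvection_mulVec_single, if_pos rfl, map_add, add_mul, smul_add]
    rfl
  by_cases hc : c ∈ C
  · refine ⟨1, ?_⟩
    have := ι_mul_extBasis_eq_zero (Pi.basisFun F (Fin n)) (Finset.mem_erase.2 ⟨h, hc⟩)
    rw [Pi.basisFun_apply] at this
    rw [hg, if_pos hc, this, smul_zero]
  · obtain ⟨ε', hε'⟩ := exists_ι_mul_extBasis (Pi.basisFun F (Fin n))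
      (fun h' => hc (Finset.mem_of_mem_erase h') : c ∉ C.erase d)
    rw [Pi.basisFun_apply] at hε'
    refine ⟨ε * ε', ?_⟩
    rw [hg, if_neg hc, hε', smul_smul]

/-- The coefficient of `f` at `D` is, up to a sign, the change of another coefficient under the
transvection. -/
theorem X_dvd_repr_of_transvection {k : ℕ} {f : SymExt F n}
    (hf : f ∈ twistedInvariants (F := F) (parabolic I) k) {c d : Fin n} {D : Finset (Fin n)}
    (hc : c ∉ D) (hd : d ∈ D) (hcd : blockStart I c ≤ d) :
    MvPolynomial.X c ∣ (symExtBasis F n).repr f D := by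
  have hne : c ≠ d := fun h => hc (h ▸ hd)
  have h1 := hf _ (transvectionElt_mem_parabolic hne hcd)
  rw [coe_transvectionElt, Matrix.det_transvection_of_ne _ _ hne, one_pow, one_smul,
    sum_repr_smul_symExtAct] at h1
  set g := transvectionElt (F := F) c d hne with hg
  set D' := insert c (D.erase d) with hD'
  have hdD' : d ∉ D' := by
    rw [hD', Finset.mem_insert]
    simp [hne.symm]
  have hDD' : D ≠ D' := fun h => hdD' (h ▸ hd)
  obtain ⟨ε, hε⟩ : ∃ ε : ℤˣ, symExtAct g (symExtBasis F n D) =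
      symExtBasis F n D + ε • symExtBasis F n D' := by
    obtain ⟨ε, hε⟩ := exists_extAct_transvectionElt (F := F) hne hd
    refine ⟨ε, ?_⟩
    rw [symExtBasis_apply, symExtAct_tmul, map_one, hε, if_neg hc, TensorProduct.tmul_add,
      symExtBasis_apply]
    rcases Int.units_eq_one_or ε with rfl | rfl
    · simp [hD']
    · simp [hD', TensorProduct.tmul_neg]
  have hother : ∀ C, C ≠ D → (symExtBasis F n).repr (symExtAct g (symExtBasis F n C)) D' =
      if C = D' then 1 else 0 := by
    intro C hC
    rw [symExtBasis_apply, symExtAct_tmul, map_one]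
    by_cases hdC : d ∈ C
    · obtain ⟨ε', hε'⟩ := exists_extAct_transvectionElt (F := F) hne hdC
      have hCD' : C ≠ D' := fun h => hdD' (h ▸ hdC)
      rw [hε', if_neg hCD', TensorProduct.tmul_add, map_add, Finsupp.add_apply, ← symExtBasis_apply,
        Basis.repr_self, Finsupp.single_eq_of_ne hCD'.symm, zero_add]
      split_ifs with hcC
      · simp
      · have hne' : insert c (C.erase d) ≠ D' := by
          intro h
          apply hC
          have h2 := congrArg (fun s => insert d (s.erase c)) h
          simpa [hD', Finset.erase_insert, hcC, hc, hdC, hd, Finset.insert_erase] using h2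
        have : (1 : MvPolynomial (Fin n) F) ⊗ₜ[F] (ε' • stdExtBasis F n (insert c (C.erase d))) =
            ε' • symExtBasis F n (insert c (C.erase d)) := by
          rw [symExtBasis_apply]
          rcases Int.units_eq_one_or ε' with rfl | rfl
          · simp
          · simp [TensorProduct.tmul_neg]
        rw [this, Units.smul_def, map_zsmul, Finsupp.smul_apply, Basis.repr_self,
          Finsupp.single_eq_of_ne hne'.symm, smul_zero]
    · rw [extAct_transvectionElt_of_notMem hne hdC, ← symExtBasis_apply, Basis.repr_self,
        Finsupp.single_apply]
  have h2 := DFunLike.congr_fun (congrArg (symExtBasis F n).repr h1) D'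
  rw [map_sum, Finsupp.finsetSum_apply, ← Finset.add_sum_erase _ _ (Finset.mem_univ D)] at h2
  rw [Finset.sum_eq_single D'] at h2
  · rw [map_smul, map_smul, Finsupp.smul_apply, Finsupp.smul_apply, hother D' hDD'.symm,
      if_pos rfl, hε, map_add, Units.smul_def, map_zsmul, Finsupp.add_apply, Finsupp.smul_apply,
      Basis.repr_self, Basis.repr_self, Finsupp.single_eq_same,
      Finsupp.single_eq_of_ne hDD'.symm, smul_eq_mul, smul_eq_mul, mul_one, zero_add] at h2
    have h3 : MvPolynomial.X c ∣ symAct g ((symExtBasis F n).repr f D) := by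
      have h4 := X_dvd_symAct_transvectionElt_sub hne ((symExtBasis F n).repr f D')
      have h5 : symAct g ((symExtBasis F n).repr f D') - (symExtBasis F n).repr f D' =
          - (symAct g ((symExtBasis F n).repr f D) * ((ε : ℤ) • 1)) := by
        linear_combination h2
      rw [h5, dvd_neg] at h4
      rcases Int.units_eq_one_or ε with rfl | rfl
      · simpa using h4
      · simpa using h4
    have h6 := dvd_sub h3 (X_dvd_symAct_transvectionElt_sub hne ((symExtBasis F n).repr f D))
    rwa [sub_sub_cancel] at h6
  · intro C hC hCD'
    rw [map_smul, Finsupp.smul_apply, hother C (Finset.ne_of_mem_erase hC), if_neg hCD', smul_zero]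
  · intro h
    exact absurd (Finset.mem_erase.2 ⟨hDD'.symm, Finset.mem_univ _⟩) h

variable [Fintype F]

/-- The smallest exponent of `x_c` that is allowed by its residue class modulo `q - 1`. If `k = 0`
and `c ∉ D`, the exponent `0` is in this class, and is excluded by a transvection. -/
theorem X_pow_dvd_repr {k : ℕ} {f : SymExt F n}
    (hf : f ∈ twistedInvariants (F := F) (parabolic I) k) {c : Fin n} {D : Finset (Fin n)}
    (h : k ≠ 0 ∨ ∃ d ∈ D, blockStart I c ≤ d) :
    MvPolynomial.X c ^ (Fintype.card F - 1 - k - if c ∈ D then 1 else 0) ∣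
      (symExtBasis F n).repr f D := by
  refine X_pow_dvd_of_le fun m hm => ?_
  have h1 := exponent_dvd_of_mem hf c D m hm
  have h2 : k + (if c ∈ D then 1 else 0) + m c ≠ 0 := by
    by_cases hc : c ∈ D
    · rw [if_pos hc]
      omega
    · rcases h with h | ⟨d, hd, hcd⟩
      · omega
      · have := ne_zero_of_X_dvd (X_dvd_repr_of_transvection hf hc hd hcd) m hm
        omega
  have h3 := Nat.le_of_dvd (Nat.pos_of_ne_zero h2) h1
  omega

end Transvection

/-! ### Divisibility of the coordinates in the mixed basis -/

section Coordinates

open Module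

variable {F : Type*} [Field F] [Fintype F] {n : ℕ} (I : Composition n)

variable (F) in
/-- The product of the one-forms `adjVec (blockEnd I b) b`, `b ∈ C`. -/
noncomputable def blockForm (C : Finset (Fin n)) : SymExt F n :=
  formProd (fun b => adjVec F (blockEnd I b) b) C

/-- Scaling the column at `c` by `x_c` makes the rows with `c < blockEnd b` divisible by `x_c`. -/
theorem X_pow_dvd_repr_mul_blockForm (c : Fin n) (D C : Finset (Fin n)) :
    MvPolynomial.X c ^ ((if c ∈ D then 1 else 0) +
      (C.filter fun b => (c : ℕ) < blockEnd I b).card) ∣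
      MvPolynomial.X c *
        (symExtBasis F n).repr (symExtBasis F n D * blockForm F I C) Finset.univ := by
  let K := FractionRing (MvPolynomial (Fin n) F)
  by_cases h : D.card + C.card = n
  swap
  · rw [blockForm, repr_mul_formProd_eq_zero K _ h, mul_zero]
    exact dvd_zero _
  rw [blockForm, repr_mul_formProd_eq_det K _ h]
  set A := Matrix.of fun (i : Fin n) c =>
    (Fin.append (fun i => Pi.single (D.orderEmbOfFin rfl i) 1)
      (fun i => adjVec F (blockEnd I (C.orderEmbOfFin rfl i)) (C.orderEmbOfFin rfl i)) :
        Fin (D.card + C.card) → Fin n → MvPolynomial (Fin n) F) (Fin.cast h.symm i) c with hA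
  let v : Fin (D.card + C.card) → MvPolynomial (Fin n) F :=
    Fin.append (fun i => if D.orderEmbOfFin rfl i = c then MvPolynomial.X c else 1)
      (fun i => if (c : ℕ) < blockEnd I (C.orderEmbOfFin rfl i) then MvPolynomial.X c else 1)
  have hv : ∏ i : Fin n, v (Fin.cast h.symm i) = MvPolynomial.X c ^ ((if c ∈ D then 1 else 0) +
      (C.filter fun b => (c : ℕ) < blockEnd I b).card) := by
    refine ((finCongr h.symm).prod_comp v).trans ?_
    rw [Fin.prod_univ_add, pow_add]
    simp only [v, Fin.append_left, Fin.append_right]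
    rw [Finset.prod_orderEmbOfFin D fun b => if b = c then MvPolynomial.X c else 1,
      Finset.prod_orderEmbOfFin C fun b => if (c : ℕ) < blockEnd I b then MvPolynomial.X c else 1,
      Finset.prod_ite_eq' D c fun _ => MvPolynomial.X c, Finset.prod_ite, Finset.prod_const_one,
      mul_one, Finset.prod_const]
    split_ifs <;> simp
  have hdet : (A.updateCol c ((MvPolynomial.X c : MvPolynomial (Fin n) F) • fun i => A i c)).det =
      MvPolynomial.X c * A.det := by
    rw [Matrix.det_updateCol_smul]
    exact congrArg (fun M => MvPolynomial.X c * Matrix.det M) (Matrix.updateCol_eq_self A c)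
  rw [← hv, ← hdet]
  refine Matrix.prod_dvd_det _ _ fun i a => ?_
  rw [Matrix.updateCol_apply, Pi.smul_apply, smul_eq_mul, hA, Matrix.of_apply, Matrix.of_apply]
  refine Fin.addCases (fun r => ?_) (fun r => ?_) (Fin.cast h.symm i)
  · simp only [v, Fin.append_left]
    split_ifs with h1 h2 h2
    · exact dvd_mul_right _ _
    · rw [Pi.single_eq_of_ne (h1 ▸ h2)]
      exact dvd_zero _
    · exact one_dvd _
    · exact one_dvd _
  · simp only [v, Fin.append_right]
    split_ifs with h1 h2 h2
    · exact dvd_mul_right _ _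
    · exact X_dvd_adjVec h1 h2
    · exact one_dvd _
    · exact one_dvd _

/-- The rows which belong to `D` and to the elements of `Bᶜ` before the block of `c` are supported
on the columns before this block. There are more of them than such columns, because `B` has an element
in the block of `c` or after it. -/
theorem repr_mul_blockForm_eq_zero {c : Fin n} {D B : Finset (Fin n)}
    (hD : ∀ d ∈ D, (d : ℕ) < blockStart I c) (hB : ∃ b ∈ B, blockStart I c ≤ b)
    (hcard : D.card = B.card) :
    (symExtBasis F n).repr (symExtBasis F n D * blockForm F I Bᶜ) Finset.univ = 0 := by
  let K := FractionRing (MvPolynomial (Fin n) F)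
  have h : D.card + Bᶜ.card = n := by
    rw [hcard, Finset.card_add_card_compl, Fintype.card_fin]
  rw [blockForm, repr_mul_formProd_eq_det K _ h]
  let J : Finset (Fin n) := Finset.univ.filter fun a => (a : ℕ) < blockStart I c
  -- the rows of the matrix
  let R : Fin (D.card + Bᶜ.card) → Fin n → MvPolynomial (Fin n) F :=
    Fin.append (fun i => Pi.single (D.orderEmbOfFin rfl i) 1)
      (fun i => adjVec F (blockEnd I (Bᶜ.orderEmbOfFin rfl i)) (Bᶜ.orderEmbOfFin rfl i))
  classical
  refine Matrix.det_eq_zero_of_card_lt _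
    (Finset.univ.filter fun i : Fin n => ∀ a ∉ J, R (Fin.cast h.symm i) a = 0) J ?_
    fun i hi a ha => (Finset.mem_filter.1 hi).2 a ha
  have h0 : (Finset.univ.filter fun i : Fin n => ∀ a ∉ J, R (Fin.cast h.symm i) a = 0).card =
      ∑ i, if ∀ a ∉ J, R i a = 0 then 1 else 0 := by
    rw [Finset.card_filter]
    exact (finCongr h.symm).sum_comp fun i => if ∀ a ∉ J, R i a = 0 then 1 else 0
  rw [h0, Fin.sum_univ_add]
  have h1 : ∀ i : Fin D.card, (if ∀ a ∉ J, R (Fin.castAdd _ i) a = 0 then 1 else 0) = 1 := by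
    intro i
    refine if_pos fun a ha => ?_
    simp only [R, Fin.append_left]
    refine Pi.single_eq_of_ne ?_ _
    rintro rfl
    exact ha (Finset.mem_filter.2 ⟨Finset.mem_univ _, hD _ (D.orderEmbOfFin_mem rfl i)⟩)
  have h2 : ∀ i : Fin Bᶜ.card, (if Bᶜ.orderEmbOfFin rfl i ∈ J then 1 else 0) ≤
      if ∀ a ∉ J, R (Fin.natAdd _ i) a = 0 then 1 else 0 := by
    intro i
    by_cases hi : Bᶜ.orderEmbOfFin rfl i ∈ J
    · rw [if_pos hi, if_pos]
      intro a ha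
      simp only [R, Fin.append_right]
      refine adjVec_eq_zero (lt_blockEnd I _) ?_
      by_contra! hlt
      exact ha (Finset.mem_filter.2 ⟨Finset.mem_univ _, hlt.trans_le
        (blockEnd_le_blockStart_of_lt (Finset.mem_filter.1 hi).2)⟩)
    · rw [if_neg hi]
      exact Nat.zero_le _
  have h3 := Finset.sum_le_sum fun i (_ : i ∈ Finset.univ) => h2 i
  rw [Finset.sum_orderEmbOfFin Bᶜ fun b => if b ∈ J then 1 else 0, ← Finset.card_filter] at h3
  simp only [h1, Finset.sum_const, Finset.card_univ, Fintype.card_fin, smul_eq_mul, mul_one]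
  have h4 : (B.filter (· ∈ J)).card < B.card := by
    refine Finset.card_lt_card (Finset.filter_ssubset.2 ?_)
    obtain ⟨b, hb, hcb⟩ := hB
    exact ⟨b, hb, fun h => not_lt.2 hcb (Finset.mem_filter.1 h).2⟩
  have h5 : J.card = (B.filter (· ∈ J)).card + (Bᶜ.filter (· ∈ J)).card := by
    rw [← Finset.card_union_of_disjoint, ← Finset.filter_union, Finset.union_compl]
    · simp
    · exact Finset.disjoint_filter_filter disjoint_compl_right
  omega

/-- The exponent of `leadProd F c` in the weight of the basis element at `B`. -/
def weightExp (q k : ℕ) (B : Finset (Fin n)) (c : Fin n) : ℕ :=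
  if k = 0 ∧ ¬ (c : ℕ) < supEnd I B then 0 else q - 1 - k

variable (F) in
/-- The weight of the basis element at `B`: the product of linear forms by which the exterior
product of the `u_b`, `b ∈ B`, has to be multiplied to get this element. -/
noncomputable def weight (k : ℕ) (B : Finset (Fin n)) : MvPolynomial (Fin n) F :=
  ∏ c, leadProd F c ^ weightExp I (Fintype.card F) k B c

variable {I}

/-- The terms of the expansion of `f` in the `y_D` are treated separately; for each of them the
exponents of `x_c` in the two factors add up. -/
theorem X_pow_dvd_coord {k : ℕ} {f : SymExt F n}
    (hf : f ∈ twistedInvariants (F := F) (parabolic I) k) (B : Finset (Fin n)) (c : Fin n) :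
    MvPolynomial.X c ^ (weightExp I (Fintype.card F) k B c +
      (Bᶜ.filter fun b => (c : ℕ) < blockEnd I b).card) ∣
      MvPolynomial.X c * (symExtBasis F n).repr (f * blockForm F I Bᶜ) Finset.univ := by
  let K := FractionRing (MvPolynomial (Fin n) F)
  have hsum : (symExtBasis F n).repr (f * blockForm F I Bᶜ) Finset.univ =
      ∑ D, (symExtBasis F n).repr f D *
        (symExtBasis F n).repr (symExtBasis F n D * blockForm F I Bᶜ) Finset.univ := by
    conv_lhs => rw [← (symExtBasis F n).sum_repr f]
    rw [Finset.sum_mul, map_sum, Finsupp.finsetSum_apply]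
    refine Finset.sum_congr rfl fun D _ => ?_
    rw [smul_mul_assoc, map_smul, Finsupp.smul_apply, smul_eq_mul]
  rw [hsum, Finset.mul_sum]
  refine Finset.dvd_sum fun D _ => ?_
  rw [mul_left_comm]
  by_cases hcard : D.card = B.card
  swap
  · rw [blockForm, repr_mul_formProd_eq_zero K, mul_zero, mul_zero]
    · exact dvd_zero _
    · intro h
      have := Finset.card_add_card_compl B
      rw [Fintype.card_fin] at this
      omega
  have h1 := X_pow_dvd_repr_mul_blockForm (F := F) I c D Bᶜ
  by_cases hw : k = 0 ∧ ¬ (c : ℕ) < supEnd I B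
  · rw [weightExp, if_pos hw, zero_add]
    exact ((pow_dvd_pow _ (Nat.le_add_left _ _)).trans h1).mul_left _
  rw [weightExp, if_neg hw]
  by_cases hk : k ≠ 0 ∨ ∃ d ∈ D, blockStart I c ≤ d
  · refine Dvd.dvd.trans ?_ (mul_dvd_mul (X_pow_dvd_repr hf hk) h1)
    rw [← pow_add]
    apply pow_dvd_pow
    split_ifs <;> omega
  · push Not at hk hw
    rw [repr_mul_blockForm_eq_zero I hk.2 (exists_blockStart_le (hw hk.1)) hcard, mul_zero,
      mul_zero]
    exact dvd_zero _

/-- The divisibility by powers of `x_c` carries over to all linear forms with leading variable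
`x_c`, as the top coordinate is fixed by the unipotent elements. The factor `flagProd F n n` makes up for
the factor `x_c` in `X_pow_dvd_coord`. -/
theorem dvd_coord {k : ℕ} {f : SymExt F n}
    (hf : f ∈ twistedInvariants (F := F) (parabolic I) k) (B : Finset (Fin n)) :
    weight F I k B * ∏ b ∈ Bᶜ, flagProd F n (blockEnd I b) ∣
      flagProd F n n * (symExtBasis F n).repr (f * blockForm F I Bᶜ) Finset.univ := by
  set τ := (symExtBasis F n).repr (f * blockForm F I Bᶜ) Finset.univ with hτ
  have hprod : weight F I k B * ∏ b ∈ Bᶜ, flagProd F n (blockEnd I b) =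
      ∏ c, leadProd F c ^ (weightExp I (Fintype.card F) k B c +
        (Bᶜ.filter fun b => (c : ℕ) < blockEnd I b).card) := by
    simp only [pow_add, Finset.prod_mul_distrib, weight, flagProd, Finset.prod_filter]
    rw [Finset.prod_comm]
    congr 1
    refine Finset.prod_congr rfl fun c _ => ?_
    rw [← Finset.prod_filter, Finset.prod_const]
  rw [hprod]
  refine prod_linForm_pow_dvd _ fun c l => ?_
  obtain ⟨g, hg, hgX, hdet, hflag⟩ := exists_mem_parabolic_symAct_X I c l
  have hform : symExtAct g (blockForm F I Bᶜ) = blockForm F I Bᶜ := by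
    rw [blockForm, symExtAct_formProd g _ _ (fun _ => 1), Finset.prod_const_one, one_smul]
    intro b _
    rw [symExtAct_oneForm_adjVec g (preservesFlag_blockEnd hg b) (lt_blockEnd I b), hflag]
  have hfg : symExtAct g f = f := by
    have := hf g hg
    rwa [hdet, one_pow, one_smul] at this
  have hτg : symAct g τ = τ := by
    have := coord_univ_symExtAct g (f * blockForm F I Bᶜ)
    rw [map_mul, hform, hfg, hdet, one_smul] at this
    exact this.symm
  have h1 := map_dvd (symAct g) (X_pow_dvd_coord hf B c)
  rw [map_pow, map_mul, hgX, ← hτ, hτg] at h1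
  refine h1.trans (mul_dvd_mul_right ?_ _)
  refine Dvd.dvd.trans ?_ (Finset.dvd_prod_of_mem (fun c => leadProd F c)
    (Finset.mem_filter.2 ⟨Finset.mem_univ c, c.isLt⟩))
  rw [leadProd_eq_prod_linForm]
  exact Finset.dvd_prod_of_mem (fun l => linForm (leadVec c l)) (Finset.mem_univ l)

end Coordinates

/-! ### Invariants are combinations of the Mui elements -/

section Span

open Module

variable (F : Type*) [Field F] [Fintype F] {n : ℕ} (K : Type*) [Field K]
  [Algebra (MvPolynomial (Fin n) F) K] [IsFractionRing (MvPolynomial (Fin n) F) K]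

/-- The basis of the vectors `invVec F K m b`, for `m ≤ n`. -/
noncomputable def invBasis (m : ℕ) : Basis (Fin n) K (Fin n → K) :=
  (exists_basis_invVec F K (min_le_right m n)).choose

theorem invBasis_apply {m : ℕ} (hm : m ≤ n) (b : Fin n) : invBasis F K m b = invVec F K m b := by
  have h : invBasis F K m b = invVec F K (min m n) b :=
    (exists_basis_invVec F K (min_le_right m n)).choose_spec b
  rwa [min_eq_left hm] at h

/-- The basis of the vectors `mixedVec F K I b`. -/
noncomputable def mixedBasis (I : Composition n) : Basis (Fin n) K (Fin n → K) :=
  (exists_basis_mixedVec F K I).choose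

theorem mixedBasis_apply (I : Composition n) (b : Fin n) : mixedBasis F K I b = mixedVec F K I b :=
  (exists_basis_mixedVec F K I).choose_spec b

variable {F} {I : Composition n}

/-- In terms of `invBasis F K m`, a product of the mixed basis involves only products which contain
the factors of the last block. -/
theorem extBasis_mixedBasis_mem_span {m : ℕ} (hm : m ≤ n) (B : Finset (Fin n))
    (hB : ∀ b ∈ B, blockEnd I b ≤ m) :
    (mixedBasis F K I).ExteriorAlgebra B ∈ Submodule.span (MvPolynomial (Fin n) F)
      {z | ∃ B' : Finset (Fin n), (∀ b ∈ B', (b : ℕ) < m) ∧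
        (∀ b ∈ B, blockEnd I b = m → b ∈ B') ∧ z = (invBasis F K m).ExteriorAlgebra B'} := by
  classical
  induction B using Finset.induction_on with
  | empty =>
    refine Submodule.subset_span ⟨∅, by simp, by simp, ?_⟩
    rw [extBasis_empty, extBasis_empty]
  | insert a B ha ih =>
    specialize ih fun b hb => hB b (Finset.mem_insert_of_mem hb)
    have ham := hB a (Finset.mem_insert_self a B)
    obtain ⟨ε, hε⟩ := exists_ι_mul_extBasis (mixedBasis F K I) ha
    -- the mixed vector at `a` is one of the `u_t` if the block of `a` ends at `m`, and otherwise a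
    -- combination of the `u_t` with `t < m`
    have hsum : ∃ r : Fin n → MvPolynomial (Fin n) F,
        mixedBasis F K I a = ∑ t, algebraMap _ K (r t) • invBasis F K m t ∧
        ∀ t, r t ≠ 0 → (t : ℕ) < m ∧ (blockEnd I a = m → t = a) := by
      obtain ⟨r, h1, h2, h3, h4⟩ := exists_invVec_eq_sum F K ham hm
      refine ⟨r a, ?_, fun t ht => ⟨?_, fun hat => ?_⟩⟩
      · rw [mixedBasis_apply, mixedVec, h1 a (lt_blockEnd I a)]
        exact Finset.sum_congr rfl fun t _ => by rw [invBasis_apply F K hm]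
      · by_contra! hle
        rcases h4 a t hle with h | h
        · exact ht h
        · exact absurd (lt_blockEnd I a) (not_lt.2 h)
      · by_contra hne
        by_cases htm : (t : ℕ) < m
        · exact ht (h3 a t (lt_blockEnd I a) (hat ▸ htm) hne)
        · rcases h4 a t (not_lt.1 htm) with h | h
          · exact ht h
          · exact absurd (lt_blockEnd I a) (not_lt.2 h)
    obtain ⟨r, hr, hr'⟩ := hsum
    have hmem : ∀ z ∈ Submodule.span (MvPolynomial (Fin n) F)
          {z | ∃ B' : Finset (Fin n), (∀ b ∈ B', (b : ℕ) < m) ∧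
            (∀ b ∈ B, blockEnd I b = m → b ∈ B') ∧ z = (invBasis F K m).ExteriorAlgebra B'},
        ExteriorAlgebra.ι K (mixedBasis F K I a) * z ∈ Submodule.span (MvPolynomial (Fin n) F)
          {z | ∃ B' : Finset (Fin n), (∀ b ∈ B', (b : ℕ) < m) ∧
            (∀ b ∈ insert a B, blockEnd I b = m → b ∈ B') ∧
            z = (invBasis F K m).ExteriorAlgebra B'} := by
      intro z hz
      induction hz using Submodule.span_induction with
      | zero => rw [mul_zero]; exact Submodule.zero_mem _
      | add z z' _ _ hz hz' => rw [mul_add]; exact Submodule.add_mem _ hz hz'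
      | smul s z _ hz => rw [mul_smul_comm]; exact Submodule.smul_mem _ _ hz
      | mem z hz =>
        obtain ⟨B', h1, h2, rfl⟩ := hz
        rw [hr, map_sum, Finset.sum_mul]
        refine Submodule.sum_mem _ fun t _ => ?_
        rw [map_smul, smul_mul_assoc, algebraMap_smul]
        by_cases hrt : r t = 0
        · rw [hrt, zero_smul]
          exact Submodule.zero_mem _
        refine Submodule.smul_mem _ _ ?_
        by_cases htB : t ∈ B'
        · rw [ι_mul_extBasis_eq_zero _ htB]
          exact Submodule.zero_mem _
        · obtain ⟨ε', hε'⟩ := exists_ι_mul_extBasis (invBasis F K m) htB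
          rw [hε', Units.smul_def]
          refine zsmul_mem ?_ _
          refine Submodule.subset_span ⟨insert t B', ?_, ?_, rfl⟩
          · intro b hb
            rcases Finset.mem_insert.1 hb with rfl | hb
            · exact (hr' _ hrt).1
            · exact h1 b hb
          · intro b hb hbm
            rcases Finset.mem_insert.1 hb with rfl | hb
            · rw [(hr' t hrt).2 hbm]
              exact Finset.mem_insert_self _ _
            · exact Finset.mem_insert_of_mem (h2 b hb hbm)
    have h5 : (mixedBasis F K I).ExteriorAlgebra (insert a B) =
        (ε : ℤ) • (ExteriorAlgebra.ι K (mixedBasis F K I a) *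
          (mixedBasis F K I).ExteriorAlgebra B) := by
      rw [hε, ← Units.smul_def, smul_smul, Int.units_mul_self, one_smul]
    rw [h5]
    exact zsmul_mem (hmem _ ih) _

theorem supEnd_eq_of_subset {B B' : Finset (Fin n)} (hB : B.Nonempty)
    (h1 : ∀ b ∈ B', (b : ℕ) < supEnd I B) (h2 : ∀ b ∈ B, blockEnd I b = supEnd I B → b ∈ B') :
    supEnd I B' = supEnd I B := by
  obtain ⟨b, hb, hbe⟩ := exists_blockEnd_eq_supEnd (I := I) hB
  apply le_antisymm
  · refine Finset.sup_le fun a ha => ?_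
    rw [← hbe]
    exact blockEnd_le_of_lt (hbe ▸ h1 a ha)
  · conv_lhs => rw [← hbe]
    exact Finset.le_sup (f := blockEnd I) (h2 b hb hbe)

theorem weight_congr {k : ℕ} {B B' : Finset (Fin n)} (h : supEnd I B' = supEnd I B) :
    weight F I k B' = weight F I k B := by
  simp only [weight, weightExp, h]

/-- The image over the fraction field of a basis element of the invariants, up to a sign. -/
noncomputable def normElt (I : Composition n) (k : ℕ) (B : Finset (Fin n)) :
    ExteriorAlgebra K (Fin n → K) :=
  weight F I k B • (invBasis F K (supEnd I B)).ExteriorAlgebra B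

/-- The exterior products of `invBasis F K m` which occur for `B` belong to sets `B'` with the same
last block, thus with the same weight. -/
theorem weight_smul_mixedBasis_mem_span (k : ℕ) (B : Finset (Fin n)) :
    weight F I k B • (mixedBasis F K I).ExteriorAlgebra B ∈
      Submodule.span (MvPolynomial (Fin n) F) (Set.range (normElt (F := F) K I k)) := by
  rcases B.eq_empty_or_nonempty with rfl | hB
  · refine Submodule.subset_span ⟨∅, ?_⟩
    rw [normElt, extBasis_empty, extBasis_empty]
  · have h := extBasis_mixedBasis_mem_span (F := F) K (supEnd_le_card B) B
      fun b hb => Finset.le_sup (f := blockEnd I) hb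
    generalize (mixedBasis F K I).ExteriorAlgebra B = z at h
    induction h using Submodule.span_induction with
    | zero => rw [smul_zero]; exact Submodule.zero_mem _
    | add z z' _ _ hz hz' => rw [smul_add]; exact Submodule.add_mem _ hz hz'
    | smul s z _ hz => rw [smul_comm]; exact Submodule.smul_mem _ _ hz
    | mem z hz =>
      obtain ⟨B', h1, h2, rfl⟩ := hz
      have h3 := supEnd_eq_of_subset hB h1 h2
      refine Submodule.subset_span ⟨B', ?_⟩
      rw [normElt, weight_congr h3, h3]

variable [Algebra F K] [IsScalarTower F (MvPolynomial (Fin n) F) K]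

theorem extMap_blockForm (C : Finset (Fin n)) :
    extMap F K (blockForm F I C) = algebraMap _ K (∏ b ∈ C, flagProd F n (blockEnd I b)) •
      (mixedBasis F K I).ExteriorAlgebra C := by
  refine extMap_formProd_eq_smul K _ _ _ _ fun b _ => ?_
  rw [algebraMap_adjVec K (blockEnd_le_card I b), mixedBasis_apply, mixedVec]

/-- The coordinates of an invariant in the mixed basis are divisible by the weights: multiplication
with `blockForm F I Bᶜ` turns the coordinate at `B` into a top coordinate, up to the factors
`flagProd F n (blockEnd I b)`, `b ∉ B`, and the determinant `(flagProd F n n)⁻¹` of the basis. -/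
theorem exists_repr_mixedBasis_eq {k : ℕ} {f : SymExt F n}
    (hf : f ∈ twistedInvariants (F := F) (parabolic I) k) (B : Finset (Fin n)) :
    ∃ s, (mixedBasis F K I).ExteriorAlgebra.repr (extMap F K f) B =
      algebraMap _ K (s * weight F I k B) := by
  obtain ⟨s, hs⟩ := dvd_coord hf B
  obtain ⟨ε, hε⟩ := exists_topCoord_mul_compl (mixedBasis F K I) B
  have hdet : (Matrix.of fun i => mixedBasis F K I i).det =
      (algebraMap (MvPolynomial (Fin n) F) K (flagProd F n n))⁻¹ := by
    rw [← det_mixedVec F K I]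
    simp only [mixedBasis_apply]
  have h1 : topCoord K n (extMap F K (f * blockForm F I Bᶜ)) =
      algebraMap _ K ((symExtBasis F n).repr (f * blockForm F I Bᶜ) Finset.univ) :=
    repr_extMap K _ _
  set κ := (mixedBasis F K I).ExteriorAlgebra.repr (extMap F K f) B with hκ
  set P := ∏ b ∈ Bᶜ, flagProd F n (blockEnd I b) with hP
  have hL := algebraMap_flagProd_ne_zero F K (n := n) n
  have hP0 : algebraMap (MvPolynomial (Fin n) F) K P ≠ 0 := by
    rw [hP, map_prod]
    exact Finset.prod_ne_zero_iff.2 fun b _ => algebraMap_flagProd_ne_zero F K _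
  rw [map_mul, extMap_blockForm, mul_smul_comm, map_smul, hε, hdet, smul_eq_mul] at h1
  have h2 := congrArg (algebraMap _ K) hs
  rw [map_mul, ← h1] at h2
  simp only [map_mul] at h2
  have h3 : ((ε : ℤ) : K) * κ = algebraMap _ K s * algebraMap _ K (weight F I k B) := by
    apply mul_left_cancel₀ hP0
    rw [Units.smul_def, zsmul_eq_mul] at h2
    field_simp at h2
    linear_combination h2
  refine ⟨(ε : ℤ) * s, ?_⟩
  have hεε : ((ε : ℤ) : K) * ((ε : ℤ) : K) = 1 := by
    rcases Int.units_eq_one_or ε with rfl | rfl <;> simp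
  rw [map_mul, map_mul, map_intCast, mul_assoc, ← h3, ← mul_assoc, hεε, one_mul]

theorem extMap_mem_span {k : ℕ} {f : SymExt F n}
    (hf : f ∈ twistedInvariants (F := F) (parabolic I) k) :
    extMap F K f ∈ Submodule.span (MvPolynomial (Fin n) F)
      (Set.range (normElt (F := F) K I k)) := by
  rw [← (mixedBasis F K I).ExteriorAlgebra.sum_repr (extMap F K f)]
  refine Submodule.sum_mem _ fun B _ => ?_
  obtain ⟨s, hs⟩ := exists_repr_mixedBasis_eq K hf B
  rw [hs, algebraMap_smul, mul_smul]
  exact Submodule.smul_mem _ _ (weight_smul_mixedBasis_mem_span K k B)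

omit [Algebra F K] [IsScalarTower F (MvPolynomial (Fin n) F) K] in
theorem weight_ne_zero (k : ℕ) (B : Finset (Fin n)) : weight F I k B ≠ 0 :=
  Finset.prod_ne_zero_iff.2 fun c _ => pow_ne_zero _ (leadProd_ne_zero c)

omit [Algebra F K] [IsScalarTower F (MvPolynomial (Fin n) F) K] in
/-- There are `2 ^ n` of these elements, and they span the exterior algebra of `K^n`. -/
theorem linearIndependent_normElt (I : Composition n) (k : ℕ) :
    LinearIndependent K (normElt (F := F) K I k) := by
  refine linearIndependent_of_top_le_span_of_card_eq_finrank ?_ ?_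
  · rw [← (mixedBasis F K I).ExteriorAlgebra.span_eq, Submodule.span_le]
    rintro _ ⟨B, rfl⟩
    have h := Submodule.span_le_restrictScalars (MvPolynomial (Fin n) F) K _
      (weight_smul_mixedBasis_mem_span (F := F) (I := I) K k B)
    rw [Submodule.restrictScalars_mem, ← algebraMap_smul K (weight F I k B)] at h
    refine (Submodule.smul_mem_iff _ ?_).1 h
    rw [Ne, map_eq_zero_iff _ (IsFractionRing.injective (MvPolynomial (Fin n) F) K)]
    exact weight_ne_zero k B
  · rw [finrank_eq_card_basis (stdExtBasis K n)]

end Span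

/-! ### The basis of the invariants, indexed by subsets -/

section InvariantBasis

open Module

variable (F : Type*) [Field F] [Fintype F] {n : ℕ} (I : Composition n)

/-- The quotient of the weight by `flagProd F n (supEnd I B)`, the factor which the Mui element
provides. The subtraction of exponents is exact for `k ≤ q - 2`, see `flagProd_mul_coweight`. -/
noncomputable def coweight (k : ℕ) (B : Finset (Fin n)) : MvPolynomial (Fin n) F :=
  ∏ c : Fin n, leadProd F c ^ (weightExp I (Fintype.card F) k B c -
    if (c : ℕ) < supEnd I B then 1 else 0)

/-- The basis element of the invariants at the subset `B` of `{0, …, n-1}`. -/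
noncomputable def invElt (k : ℕ) (B : Finset (Fin n)) : SymExt F n :=
  if B = ∅ then weight F I k B ⊗ₜ[F] 1 else
    coweight F I k B • muiInvariant F (supEnd_le_card (I := I) B) (B.map Fin.valEmbedding)

variable {F I}

theorem flagProd_mul_coweight {k : ℕ} (hk : k ≤ Fintype.card F - 2) (B : Finset (Fin n)) :
    flagProd F n (supEnd I B) * coweight F I k B = weight F I k B := by
  have hq : 1 < Fintype.card F := Fintype.one_lt_card
  rw [flagProd, Finset.prod_filter, coweight, ← Finset.prod_mul_distrib, weight]
  refine Finset.prod_congr rfl fun c _ => ?_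
  by_cases hc : (c : ℕ) < supEnd I B
  · have hw : weightExp I (Fintype.card F) k B c = Fintype.card F - 1 - k := by
      rw [weightExp, if_neg fun h => h.2 hc]
    rw [if_pos hc, if_pos hc, hw, ← pow_succ']
    congr 1
    omega
  · rw [if_neg hc, if_neg hc, one_mul, Nat.sub_zero]

theorem flagProd_smul_invElt {k : ℕ} (hk : k ≤ Fintype.card F - 2) {B : Finset (Fin n)}
    (hB : B ≠ ∅) : flagProd F n (supEnd I B) • invElt F I k B = weight F I k B •
      muiInvariant F (supEnd_le_card (I := I) B) (B.map Fin.valEmbedding) := by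
  rw [invElt, if_neg hB, smul_smul, flagProd_mul_coweight hk]

theorem exists_extMap_invElt (K : Type*) [Field K] [Algebra (MvPolynomial (Fin n) F) K]
    [Algebra F K] [IsScalarTower F (MvPolynomial (Fin n) F) K]
    [IsFractionRing (MvPolynomial (Fin n) F) K] {k : ℕ} (hk : k ≤ Fintype.card F - 2)
    (B : Finset (Fin n)) :
    ∃ ε : ℤˣ, extMap F K (invElt F I k B) = ε • normElt (F := F) K I k B := by
  by_cases hB : B = ∅
  · refine ⟨1, ?_⟩
    rw [invElt, if_pos hB, extMap_tmul_one, one_smul, normElt, hB, extBasis_empty,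
      Algebra.algebraMap_eq_smul_one]
  · obtain ⟨ε, hε⟩ := exists_extMap_muiInvariant K (supEnd_le_card (I := I) B)
      (invBasis F K (supEnd I B)) (invBasis_apply F K (supEnd_le_card B)) B
      (fun b hb => lt_supEnd hb)
    refine ⟨ε, ?_⟩
    rw [invElt, if_neg hB, map_smul, hε, algebraMap_smul, smul_comm, smul_smul, mul_comm,
      flagProd_mul_coweight hk, normElt]

omit [Fintype F] in
theorem preservesFlag_supEnd {g : GL (Fin n) F} (hg : g ∈ parabolic (F := F) I)
    (B : Finset (Fin n)) :
    PreservesFlag (supEnd I B) (g : Matrix (Fin n) (Fin n) F) := by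
  rcases B.eq_empty_or_nonempty with rfl | hB
  · intro a c hc
    exact absurd hc (Nat.not_lt_zero _)
  · obtain ⟨b, -, hb⟩ := exists_blockEnd_eq_supEnd (I := I) hB
    exact hb ▸ preservesFlag_blockEnd hg b

/-- The weights are semi-invariants, being powers of `flagProd F n m` with `m = supEnd I B` or
`m = n`. -/
theorem det_pow_smul_symAct_weight {k : ℕ} (hk : k ≤ Fintype.card F - 2) {g : GL (Fin n) F}
    (hg : g ∈ parabolic (F := F) I) (B : Finset (Fin n)) :
    (g : Matrix (Fin n) (Fin n) F).det ^ k • symAct g (weight F I k B) = weight F I k B := by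
  by_cases hk0 : k = 0
  · subst hk0
    have hw : weight F I 0 B = flagProd F n (supEnd I B) ^ (Fintype.card F - 1) := by
      rw [weight, flagProd, Finset.prod_filter, ← Finset.prod_pow]
      refine Finset.prod_congr rfl fun c _ => ?_
      by_cases hc : (c : ℕ) < supEnd I B <;> simp [weightExp, hc]
    have hf := preservesFlag_supEnd hg B
    rw [pow_zero, one_smul, hw, map_pow, symAct_flagProd (supEnd_le_card B) g hf, smul_pow,
      FiniteField.pow_card_sub_one_eq_one _ (det_flagMat_ne_zero g hf), one_smul]
  · have hw : weight F I k B = flagProd F n n ^ (Fintype.card F - 1 - k) := by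
      rw [weight, flagProd, Finset.prod_filter, ← Finset.prod_pow]
      refine Finset.prod_congr rfl fun c _ => ?_
      simp [weightExp, hk0]
    have hf : PreservesFlag n (g : Matrix (Fin n) (Fin n) F) :=
      fun a _ _ ha => absurd a.isLt (not_lt.2 ha)
    have h0 := det_flagMat_ne_zero g hf
    rw [flagMat_self] at h0
    rw [hw, map_pow, symAct_flagProd le_rfl g hf, flagMat_self, smul_pow, smul_smul, ← pow_add,
      show k + (Fintype.card F - 1 - k) = Fintype.card F - 1 by omega,
      FiniteField.pow_card_sub_one_eq_one _ h0, one_smul]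

theorem invElt_mem {k : ℕ} (hk : k ≤ Fintype.card F - 2) (B : Finset (Fin n)) :
    invElt F I k B ∈ twistedInvariants (F := F) (parabolic I) k := by
  intro g hg
  have hw := det_pow_smul_symAct_weight hk hg B
  by_cases hB : B = ∅
  · rw [invElt, if_pos hB, symExtAct_tmul, map_one, TensorProduct.smul_tmul', hw]
  · have hf := preservesFlag_supEnd hg B
    have h1 := congrArg (symExtAct g) (flagProd_smul_invElt (I := I) hk hB)
    rw [symExtAct_smul, symExtAct_smul, symAct_flagProd (supEnd_le_card B) g hf,
      symExtAct_muiInvariant (supEnd_le_card B) g hf B fun b hb => lt_supEnd hb] at h1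
    have h0 := det_flagMat_ne_zero g hf
    set δ := (flagMat n (supEnd I B) (g : Matrix (Fin n) (Fin n) F)).det
    have h2 : flagProd F n (supEnd I B) • symExtAct g (invElt F I k B) =
        symAct g (weight F I k B) •
          muiInvariant F (supEnd_le_card (I := I) B) (B.map Fin.valEmbedding) := by
      refine smul_right_injective (SymExt F n) h0 ?_
      beta_reduce
      rw [← smul_assoc, h1, smul_comm]
    apply smul_left_cancel_symExt (flagProd_ne_zero (F := F) (n := n) (supEnd I B))
    rw [smul_comm, h2, ← smul_assoc, hw, flagProd_smul_invElt hk hB]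

theorem linearIndependent_invElt {k : ℕ} (hk : k ≤ Fintype.card F - 2) :
    LinearIndependent (MvPolynomial (Fin n) F) (invElt F I k) := by
  let K := FractionRing (MvPolynomial (Fin n) F)
  choose ε hε using exists_extMap_invElt (F := F) (I := I) K hk
  have h1 : LinearIndependent (MvPolynomial (Fin n) F) (normElt (F := F) K I k) :=
    LinearIndependent.restrict_scalars' (MvPolynomial (Fin n) F)
      (linearIndependent_normElt (F := F) K I k)
  have h2 := h1.units_smul
    fun B => Units.map (Int.castRingHom (MvPolynomial (Fin n) F)).toMonoidHom (ε B)
  refine LinearIndependent.of_comp (extMap F K).toLinearMap ?_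
  convert! h2 using 1
  funext B
  refine (hε B).trans ?_
  rw [Pi.smul_apply', Units.smul_def, Units.smul_def]
  exact (Int.cast_smul_eq_zsmul (MvPolynomial (Fin n) F) _ _).symm

theorem mem_span_invElt {k : ℕ} (hk : k ≤ Fintype.card F - 2) {f : SymExt F n}
    (hf : f ∈ twistedInvariants (F := F) (parabolic I) k) :
    f ∈ Submodule.span (MvPolynomial (Fin n) F) (Set.range (invElt F I k)) := by
  let K := FractionRing (MvPolynomial (Fin n) F)
  have h : Submodule.span (MvPolynomial (Fin n) F) (Set.range (normElt (F := F) K I k)) ≤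
      (Submodule.span (MvPolynomial (Fin n) F) (Set.range (invElt F I k))).map
        (extMap F K).toLinearMap := by
    rw [Submodule.span_le]
    rintro _ ⟨B, rfl⟩
    obtain ⟨ε, hε⟩ := exists_extMap_invElt (I := I) K hk B
    have hB : invElt F I k B ∈ Submodule.span (MvPolynomial (Fin n) F)
        (Set.range (invElt F I k)) := Submodule.subset_span ⟨B, rfl⟩
    refine ⟨(ε : ℤ) • invElt F I k B, zsmul_mem hB _, ?_⟩
    rw [AlgHom.toLinearMap_apply, map_zsmul, hε, ← Units.smul_def, smul_smul,
      Int.units_mul_self, one_smul]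
  obtain ⟨f', hf', he⟩ := h (extMap_mem_span K hf)
  rwa [← extMap_injective K he]

/-- The coefficients of an invariant with respect to the elements `invElt F I k B` are invariant, as
they are unique. -/
theorem exists_basis_twistedInvariants {k : ℕ} (hk : k ≤ Fintype.card F - 2) :
    ∃ β : Basis (Finset (Fin n)) (symInvariants (F := F) (parabolic I))
      (twistedInvariants (F := F) (parabolic I) k), ∀ B, (β B : SymExt F n) = invElt F I k B := by
  have hli := linearIndependent_invElt (F := F) (I := I) hk
  let v : Finset (Fin n) → twistedInvariants (F := F) (parabolic I) k :=
    fun B => ⟨invElt F I k B, invElt_mem hk B⟩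
  have hv : LinearIndependent (symInvariants (F := F) (parabolic I)) v := by
    refine LinearIndependent.of_comp (Submodule.subtype _) ?_
    exact hli.restrict_scalars (R := symInvariants (F := F) (parabolic I)) (by
      intro a b h
      simpa [Algebra.smul_def] using h)
  have hspan : ⊤ ≤ Submodule.span (symInvariants (F := F) (parabolic I)) (Set.range v) := by
    rintro ⟨f, hf⟩ -
    obtain ⟨a, ha⟩ := (Submodule.mem_span_range_iff_exists_fun _).1 (mem_span_invElt hk hf)
    have hinv : ∀ B, a B ∈ symInvariants (F := F) (parabolic I) := by
      intro B g hg
      have h1 : ∑ B, symAct g (a B) • invElt F I k B = ∑ B, a B • invElt F I k B := by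
        rw [ha]
        conv_rhs => rw [← hf g hg, ← ha, map_sum, Finset.smul_sum]
        refine Finset.sum_congr rfl fun B _ => ?_
        rw [symExtAct_smul, smul_comm, invElt_mem hk B g hg]
      have h2 := (Fintype.linearIndependent_iff.1 hli) (fun B => symAct g (a B) - a B)
        (by simp only [sub_smul, Finset.sum_sub_distrib, h1, sub_self]) B
      exact sub_eq_zero.1 h2
    refine (Submodule.mem_span_range_iff_exists_fun _).2
      ⟨fun B => ⟨a B, hinv B⟩, Subtype.ext ?_⟩
    rw [Submodule.coe_sum]
    exact ha
  refine ⟨Basis.mk hv hspan, fun B => ?_⟩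
  rw [Basis.mk_apply]

end InvariantBasis

/-! ### The labels of the Mui elements -/

section Labels

variable {n : ℕ} {I : Composition n}

theorem index_eq_of_sizeUpTo {i : Fin I.length} {c : Fin n} (h1 : I.sizeUpTo i ≤ c)
    (h2 : (c : ℕ) < I.sizeUpTo ((i : ℕ) + 1)) : I.index c = i := by
  apply le_antisymm
  · by_contra! h
    have h3 := I.monotone_sizeUpTo (show (i : ℕ) + 1 ≤ I.index c from h)
    have := I.sizeUpTo_index_le c
    omega
  · by_contra! h
    have h3 := I.monotone_sizeUpTo (show (I.index c : ℕ) + 1 ≤ i from h)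
    have h4 : (c : ℕ) < I.sizeUpTo ((I.index c : ℕ) + 1) := lt_blockEnd I c
    omega

/-- The set `{b_1, …, b_j}` of a label, as a subset of `Fin n`. -/
def MuiLabel.toFinset (l : MuiLabel I) : Finset (Fin n) :=
  Finset.univ.filter fun c => (c : ℕ) ∈ l.B

theorem MuiLabel.map_toFinset (l : MuiLabel I) : l.toFinset.map Fin.valEmbedding = l.B := by
  ext b
  simp only [MuiLabel.toFinset, Finset.mem_map, Finset.mem_filter, Finset.mem_univ, true_and,
    Fin.valEmbedding_apply]
  constructor
  · rintro ⟨c, hc, rfl⟩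
    exact hc
  · intro hb
    exact ⟨⟨b, (l.lt_top b hb).trans_le (I.sizeUpTo_le _)⟩, hb, rfl⟩

theorem MuiLabel.supEnd_toFinset (l : MuiLabel I) :
    supEnd I l.toFinset = I.sizeUpTo ((l.i : ℕ) + 1) := by
  obtain ⟨b, hb, hib⟩ := l.exists_ge
  have hbn := l.lt_top b hb
  let c : Fin n := ⟨b, hbn.trans_le (I.sizeUpTo_le _)⟩
  have hc : blockEnd I c = I.sizeUpTo ((l.i : ℕ) + 1) := by
    rw [blockEnd, index_eq_of_sizeUpTo (c := c) hib hbn]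
  apply le_antisymm
  · refine Finset.sup_le fun a ha => ?_
    rw [← hc]
    apply blockEnd_le_of_lt
    rw [hc]
    exact l.lt_top _ (Finset.mem_filter.1 ha).2
  · rw [← hc]
    exact Finset.le_sup (f := blockEnd I) (Finset.mem_filter.2 ⟨Finset.mem_univ c, hb⟩)

theorem MuiLabel.lt_supEnd_iff (l : MuiLabel I) (c : Fin n) :
    (c : ℕ) < supEnd I l.toFinset ↔ I.index c ≤ l.i := by
  rw [l.supEnd_toFinset]
  constructor
  · intro h
    by_contra! hlt
    have h3 := I.monotone_sizeUpTo (show (l.i : ℕ) + 1 ≤ I.index c from hlt)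
    have := I.sizeUpTo_index_le c
    omega
  · intro h
    have h3 := I.monotone_sizeUpTo (Nat.succ_le_succ (show (I.index c : ℕ) ≤ l.i from h))
    exact (lt_blockEnd I c).trans_le h3

theorem MuiLabel.toFinset_ne_empty (l : MuiLabel I) : l.toFinset ≠ ∅ := by
  obtain ⟨b, hb, -⟩ := l.exists_ge
  intro h
  have := l.map_toFinset
  rw [h, Finset.map_empty] at this
  rw [← this] at hb
  exact absurd hb (Finset.notMem_empty b)

theorem MuiLabel.toFinset_injective :
    Function.Injective (MuiLabel.toFinset : MuiLabel I → Finset (Fin n)) := by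
  intro l l' h
  have hB : l.B = l'.B := by rw [← l.map_toFinset, ← l'.map_toFinset, h]
  have hi : l.i = l'.i := by
    have h1 : ∀ c, I.index c ≤ l.i ↔ I.index c ≤ l'.i := fun c => by
      rw [← l.lt_supEnd_iff, ← l'.lt_supEnd_iff, h]
    have h2 : ∀ i : Fin I.length, ∃ c, I.index c = i := fun i =>
      ⟨I.embedding i ⟨0, I.one_le_blocksFun i⟩, I.index_embedding i _⟩
    obtain ⟨c, hc⟩ := h2 l.i
    obtain ⟨c', hc'⟩ := h2 l'.i
    have h3 := h1 c
    have h4 := h1 c'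
    rw [hc] at h3
    rw [hc'] at h4
    exact le_antisymm (h3.1 le_rfl) (h4.2 le_rfl)
  cases l
  cases l'
  cases hB
  cases hi
  rfl

theorem MuiLabel.exists_toFinset_eq {B : Finset (Fin n)} (hB : B.Nonempty) :
    ∃ l : MuiLabel I, l.toFinset = B := by
  obtain ⟨b, hb, hbe⟩ := exists_blockEnd_eq_supEnd (I := I) hB
  refine ⟨⟨I.index b, B.map Fin.valEmbedding, ?_, b, ?_, I.sizeUpTo_index_le b⟩, ?_⟩
  · intro a ha
    obtain ⟨a, ha', rfl⟩ := Finset.mem_map.1 ha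
    exact (lt_supEnd (I := I) ha').trans_eq hbe.symm
  · exact Finset.mem_map_of_mem Fin.valEmbedding hb
  · ext c
    simp only [MuiLabel.toFinset, Finset.mem_filter, Finset.mem_univ, true_and]
    exact Finset.mem_map' Fin.valEmbedding

variable (I) in
/-- The labels of the Mui elements correspond to the nonempty subsets of `{0, …, n-1}`. -/
noncomputable def labelEquiv : Option (MuiLabel I) ≃ Finset (Fin n) :=
  Equiv.ofBijective (fun o => o.elim ∅ MuiLabel.toFinset) <| by
    constructor
    · rintro (_ | l) (_ | l') h
      · rfl
      · exact absurd h.symm l'.toFinset_ne_empty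
      · exact absurd h l.toFinset_ne_empty
      · exact congrArg some (MuiLabel.toFinset_injective h)
    · intro B
      rcases B.eq_empty_or_nonempty with rfl | hB
      · exact ⟨none, rfl⟩
      · obtain ⟨l, rfl⟩ := MuiLabel.exists_toFinset_eq (I := I) hB
        exact ⟨some l, rfl⟩

end Labels

/-! ### The structure of the invariants -/

section Main

variable {F : Type*} [Field F] [Fintype F] {n : ℕ} {I : Composition n}

theorem muiInvariant_congr {m m' : ℕ} (h : m = m') (hm : m ≤ n) (hm' : m' ≤ n) (B : Finset ℕ) :
    muiInvariant F hm B = muiInvariant F hm' B := by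
  subst h
  rfl

/-- The exponent `0` for `k = 0` reflects that the blocks after the block of the label contribute
nothing in the untwisted case. -/
theorem invElt_label (k : ℕ) (l : MuiLabel I) : invElt F I k l.toFinset =
    muiInvariant F (I.sizeUpTo_le ((l.i : ℕ) + 1)) l.B *
      (((∏ a with a ≤ l.i, theta F I a ^ (Fintype.card F - 2 - k)) *
        ∏ a with l.i < a, theta F I a ^ (if k = 0 then 0 else Fintype.card F - 1 - k))
          ⊗ₜ[F] 1) := by
  have hco : coweight F I k l.toFinset =
      (∏ a with a ≤ l.i, theta F I a ^ (Fintype.card F - 2 - k)) *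
        ∏ a with l.i < a, theta F I a ^ (if k = 0 then 0 else Fintype.card F - 1 - k) := by
    rw [prod_theta_pow, prod_theta_pow, Finset.prod_filter, Finset.prod_filter,
      ← Finset.prod_mul_distrib, coweight]
    refine Finset.prod_congr rfl fun c _ => ?_
    rw [weightExp]
    by_cases hc : I.index c ≤ l.i
    · rw [if_pos hc, if_neg (not_lt.2 hc), if_pos ((l.lt_supEnd_iff c).2 hc),
        if_neg fun h => h.2 ((l.lt_supEnd_iff c).2 hc), mul_one]
      congr 1
      omega
    · have hc' := fun h => hc ((l.lt_supEnd_iff c).1 h)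
      rw [if_neg hc, if_pos (not_le.1 hc), if_neg hc', one_mul, Nat.sub_zero]
      by_cases hk : k = 0
      · rw [if_pos ⟨hk, hc'⟩, if_pos hk]
      · rw [if_neg fun h => hk h.1, if_neg hk]
  have hcomm : ∀ (t : MvPolynomial (Fin n) F) (w : SymExt F n), t • w = w * (t ⊗ₜ[F] 1) :=
    fun t w => (Algebra.smul_def (A := SymExt F n) t w).trans (Algebra.commutes t w)
  rw [invElt, if_neg l.toFinset_ne_empty, hco, hcomm, l.map_toFinset,
    muiInvariant_congr l.supEnd_toFinset]

theorem exists_basis_label {k : ℕ} (hk : k ≤ Fintype.card F - 2) :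
    ∃ β : Module.Basis (Option (MuiLabel I)) (symInvariants (F := F) (parabolic I))
          (twistedInvariants (F := F) (parabolic I) k),
      Module.finrank (symInvariants (F := F) (parabolic I))
        (twistedInvariants (F := F) (parabolic I) k) = 2 ^ n ∧
      (β none : SymExt F n) =
        (∏ a, theta F I a ^ (if k = 0 then 0 else Fintype.card F - 1 - k)) ⊗ₜ[F] 1 ∧
      ∀ l : MuiLabel I, (β (some l) : SymExt F n) = invElt F I k l.toFinset := by
  obtain ⟨β, hβ⟩ := exists_basis_twistedInvariants (F := F) (I := I) hk
  refine ⟨β.reindex (labelEquiv I).symm, ?_, ?_, fun l => ?_⟩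
  · rw [Module.finrank_eq_card_basis β, Fintype.card_finset, Fintype.card_fin]
  · rw [Module.Basis.reindex_apply, hβ]
    change invElt F I k ∅ = _
    have h := prod_theta_pow (F := F) I (fun _ => True)
      (if k = 0 then 0 else Fintype.card F - 1 - k)
    simp only [Finset.filter_true] at h
    rw [invElt, if_pos rfl, h, weight]
    congr 1
    refine Finset.prod_congr rfl fun c _ => ?_
    simp [weightExp, supEnd]
  · rw [Module.Basis.reindex_apply, hβ]
    rfl

end Main

theorem theorem3p1 {F : Type*} [Field F] [Fintype F] {n : ℕ} (I : Composition n) :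
    -- the untwisted case
    (Module.Free (symInvariants (F := F) (parabolic I)) (twistedInvariants (F := F) (parabolic I) 0) ∧
      Module.finrank (symInvariants (F := F) (parabolic I))
        (twistedInvariants (F := F) (parabolic I) 0) = 2 ^ n ∧
      ∃ β : Module.Basis (Option (MuiLabel I)) (symInvariants (F := F) (parabolic I))
          (twistedInvariants (F := F) (parabolic I) 0),
        (β none : SymExt F n) = 1 ∧
        ∀ l : MuiLabel I, (β (some l) : SymExt F n) =
          muiInvariant F (I.sizeUpTo_le ((l.i : ℕ) + 1)) l.B *
            ((∏ a with a ≤ l.i, theta F I a ^ (Fintype.card F - 2)) ⊗ₜ[F] 1)) ∧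
    -- the case of the twist by `Det^k`, `1 ≤ k ≤ q - 2`
    ∀ k : ℕ, 1 ≤ k → k ≤ Fintype.card F - 2 →
      Module.Free (symInvariants (F := F) (parabolic I))
        (twistedInvariants (F := F) (parabolic I) k) ∧
      Module.finrank (symInvariants (F := F) (parabolic I))
        (twistedInvariants (F := F) (parabolic I) k) = 2 ^ n ∧
      ∃ β : Module.Basis (Option (MuiLabel I)) (symInvariants (F := F) (parabolic I))
          (twistedInvariants (F := F) (parabolic I) k),
        (β none : SymExt F n) = (∏ a, theta F I a ^ (Fintype.card F - 1 - k)) ⊗ₜ[F] 1 ∧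
        ∀ l : MuiLabel I, (β (some l) : SymExt F n) =
          muiInvariant F (I.sizeUpTo_le ((l.i : ℕ) + 1)) l.B *
            (((∏ a with a ≤ l.i, theta F I a ^ (Fintype.card F - 2 - k)) *
              ∏ a with l.i < a, theta F I a ^ (Fintype.card F - 1 - k)) ⊗ₜ[F] 1) := by
  refine ⟨?_, fun k hk1 hk => ?_⟩
  · obtain ⟨β, hrank, hnone, hsome⟩ := exists_basis_label (F := F) (I := I) (Nat.zero_le _)
    refine ⟨Module.Free.of_basis β, hrank, β, ?_, fun l => ?_⟩
    · rw [hnone]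
      simp [Algebra.TensorProduct.one_def]
    · rw [hsome, invElt_label]
      simp
  · obtain ⟨β, hrank, hnone, hsome⟩ := exists_basis_label (F := F) (I := I) hk
    have hk0 : k ≠ 0 := by omega
    refine ⟨Module.Free.of_basis β, hrank, β, ?_, fun l => ?_⟩
    · rw [hnone, if_neg hk0]
    · rw [hsome, invElt_label, if_neg hk0]
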